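/- **Setting.** Let $M,N$ be $m$-dimensional smooth manifolds (Hausdorff, second countable), $h:M\to N$ and $\eta:N\to M$ diffeomorphisms, $F\to N$ and $E\to M$ smooth real vector bundles of ranks $p$ and $r$, and $\pi:E^*\to M$ the dual bundle of $E$. Let $(F,[\,,]_{F,h},(\rho,\eta))$ be a generalized Lie algebroid: $\rho:F\to TM$ is a vector bundle morphism over $\eta$ and $[\,,]_{F,h}$ is an $\mathbb R$-Lie bracket on $\Gamma(F)$ such that $[u,fv]=f[u,v]+(\theta(u)f)\,v$ for $f\in C^\infty(N)$ and $\theta[u,v]=[\theta(u),\theta(v)]$, where $\theta(u)(y)=Th\big(\rho(u((h\circ\eta)^{-1}(y)))\big)$. (These axioms force $\rho=0$ on $F_y$ unless $h(\eta(y))=y$.) For $x\in M$ let $a_x:F_{h(x)}\to T_xM$ be $\rho$ if $\eta(h(x))=x$ and $0$ otherwise. The generalized tangent bundle $(\rho,\eta)TE^*\to E^*$ has the fibre $$\{\,z\oplus w\in F_{h(\pi(u))}\oplus T_uE^* : d\pi_u(w)=a_{\pi(u)}(z)\,\}$$ over $u$; write $\tilde\rho(z\oplus w)=w$, and let the vertical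 subbundle $V$ be the kernel of $z\oplus w\mapsto z$. Let a $(\rho,\eta)$-connection be given, i.e. a smooth bundle morphism $\Gamma:(\rho,\eta)TE^*\to V$ that is the identity on $V$; its kernel is the horizontal subbundle $H$. Over an open $U\subset M$, local frames $t_\alpha$ of $F$ over $h(U)$ and $e^a$ of $E^*$ over $U$ define over $\pi^{-1}(U)$ the adapted base $(\tilde\delta_\alpha,\dot\partial^a)$: $\tilde\delta_\alpha$ is the section of $H$ projecting to $t_\alpha\circ h\circ\pi$, and $\dot\partial^a=0\oplus(\text{vertical lift of }e^a)$. Let $(d\tilde z^\alpha,\delta\tilde p_a)$ be the dual base, and define $L^\gamma_{\alpha\beta}$ by $[t_\alpha,t_\beta]_{F,h}=L^\gamma_{\alpha\beta}t_\gamma$ (summation convention). For a section $X$ and a function $f$ on $E^*$ write $X f$ for $\tilde\rho(X)f$. A distinguished linear $(\rho,\eta)$-connection is an $\mathbb R$-bilinear operation $(X,Y)\mapsto D_XY$ on smooth sections of $(\rho,\eta)TE^*$ with $D_{fX}Y=fD_XY$ and $D_X(fY)=fD_XY+(Xf)Y$ for $f\in C^\infty(E^*)$, such that $D_X$ preserves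 $\Gamma(H)$ and $\Gamma(V)$. Its components $(H^\alpha_{\beta\gamma},H^a_{b\gamma},V^{\alpha c}_\beta,V^{ac}_b)$ are defined by $$D_{\tilde\delta_\gamma}\tilde\delta_\beta=H^\alpha_{\beta\gamma}\tilde\delta_\alpha,\quad D_{\tilde\delta_\gamma}\dot\partial^a=H^a_{b\gamma}\dot\partial^b,\quad D_{\dot\partial^c}\tilde\delta_\beta=V^{\alpha c}_\beta\tilde\delta_\alpha,\quad D_{\dot\partial^c}\dot\partial^b=V^{bc}_a\dot\partial^a .$$ A pseudometrical structure is a smooth symmetric tensor field $G=g_{\alpha\beta}\,d\tilde z^\alpha\otimes d\tilde z^\beta+g^{ab}\,\delta\tilde p_a\otimes\delta\tilde p_b$ with $(g_{\alpha\beta})$ and $(g^{ab})$ nondegenerate at every point of $E^*$; it is a metrical structure if moreover both matrices have constant signature on $E^*$. Let $(\tilde g^{\alpha\beta})$ and $(\tilde g_{ab})$ be the inverse matrices, and $(D_XG)(Y,Z)=X(G(Y,Z))-G(D_XY,Z)-G(Y,D_XZ)$. The bundle $(\rho,\eta)TE^*$ (with $\Gamma$) is $(\rho,\eta)$-pseudometrizable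 (resp. $(\rho,\eta)$-metrizable) if there are a pseudometrical (resp. metrical) structure $G$ and a distinguished linear $(\rho,\eta)$-connection $D$ with $D_XG=0$ for all $X$. **Theorem 5.1.** Let $\mathring D$ be any distinguished linear $(\rho,\eta)$-connection, with components $(\mathring H,\mathring V)$, and let $G$ be a pseudometrical structure. Put $$g^{ea}{}_{\overset{0}{|}\gamma}=\tilde\delta_\gamma g^{ea}-\mathring H^e_{d\gamma}g^{da}-\mathring H^a_{d\gamma}g^{ed},\qquad g_{\varepsilon\beta}\overset{0}{|}{}^{c}=\dot\partial^c g_{\varepsilon\beta}-\mathring V^{\theta c}_\varepsilon g_{\theta\beta}-\mathring V^{\theta c}_\beta g_{\varepsilon\theta}.$$ Then there is a distinguished linear $(\rho,\eta)$-connection $D$ with $D_XG=0$ for all $X$ whose components, in every adapted base as above, are the functions $$\begin{aligned} H^\alpha_{\beta\gamma}&=\tfrac12\tilde g^{\alpha\varepsilon}\big(\tilde\delta_\gamma g_{\varepsilon\beta}+\tilde\delta_\beta g_{\varepsilon\gamma}-\tilde\delta_\varepsilon g_{\beta\gamma}+g_{\theta\varepsilon}\,L^\theta_{\gamma\beta}\circ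 h\circ\pi-g_{\beta\theta}\,L^\theta_{\gamma\varepsilon}\circ h\circ\pi-g_{\theta\gamma}\,L^\theta_{\beta\varepsilon}\circ h\circ\pi\big),\\ H^a_{b\gamma}&=\mathring H^a_{b\gamma}+\tfrac12\tilde g_{be}\,g^{ea}{}_{\overset{0}{|}\gamma},\qquad V^{\alpha c}_\beta=\mathring V^{\alpha c}_\beta+\tfrac12\tilde g^{\alpha\varepsilon}\,g_{\varepsilon\beta}\overset{0}{|}{}^{c},\\ V^{ac}_b&=\tfrac12\tilde g_{be}\big(\dot\partial^c g^{ea}+\dot\partial^a g^{ec}-\dot\partial^e g^{ac}\big). \end{aligned}$$ Hence $(\rho,\eta)TE^*$ is $(\rho,\eta)$-pseudometrizable, and it is $(\rho,\eta)$-metrizable if $G$ is a metrical structure. -/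

import Mathlib

open Bundle Filter Topology
open scoped Manifold ContDiff

set_option linter.unusedSectionVars false

noncomputable section GenLieDefs

/-- `op X Y` evaluated at `b` on two *locally defined* sections `σ`, `τ` has the value `v`: every
pair of globally defined smooth sections `X`, `Y` that coincide with `σ`, `τ` near `b` satisfies
`op X Y b = v`.  (Local operators on global sections are evaluated on local frames in this way;
smooth extensions of germs exist by multiplication with bump functions.) -/
def IsLocalValue {B : Type*} [TopologicalSpace B] {V : B → Type*}
    (Smooth : (Π b, V b) → Prop) (op : (Π b, V b) → (Π b, V b) → Π b, V b)
    (σ τ : Π b, V b) (b : B) (v : V b) : Prop :=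
  ∀ X Y : Π b, V b, Smooth X → Smooth Y →
    (∀ᶠ b' in 𝓝 b, X b' = σ b') → (∀ᶠ b' in 𝓝 b, Y b' = τ b') → op X Y b = v

/-- Smooth sections of a vector bundle over an `m`-dimensional manifold. -/
def IsSmoothSec (m : ℕ) {N : Type*} [TopologicalSpace N]
    [ChartedSpace (EuclideanSpace ℝ (Fin m)) N]
    (FF : Type*) [NormedAddCommGroup FF] [NormedSpace ℝ FF] {F : N → Type*}
    [TopologicalSpace (TotalSpace FF F)] [∀ y, TopologicalSpace (F y)] [FiberBundle FF F]
    (s : Π y, F y) : Prop :=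
  ContMDiff (𝓡 m) ((𝓡 m).prod 𝓘(ℝ, FF)) ∞ (fun y => (⟨y, s y⟩ : TotalSpace FF F))

section Algebroid

variable {m : ℕ}
  {M : Type*} [TopologicalSpace M] [ChartedSpace (EuclideanSpace ℝ (Fin m)) M]
  [IsManifold (𝓡 m) ∞ M]
  {N : Type*} [TopologicalSpace N] [ChartedSpace (EuclideanSpace ℝ (Fin m)) N]
  [IsManifold (𝓡 m) ∞ N]
  {FF : Type*} [NormedAddCommGroup FF] [NormedSpace ℝ FF]
  {F : N → Type*} [TopologicalSpace (TotalSpace FF F)]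
  [∀ y, AddCommGroup (F y)] [∀ y, Module ℝ (F y)] [∀ y, TopologicalSpace (F y)]
  [FiberBundle FF F] [VectorBundle ℝ FF F] [ContMDiffVectorBundle ∞ FF F (𝓡 m)]

/-- The map `Γ(Th ∘ ρ, h ∘ η)` from sections of `F` to vector fields on `N`:
`y ↦ Th (ρ (u (κ)))` where `κ = (h ∘ η)⁻¹ (y)`.  (The value lies in the tangent space at
`h (η κ) = y`; in Mathlib all tangent spaces of `N` are the model space, so that no transport along
this equality is written.) -/
def pushAnchor (h : M ≃ₘ^∞⟮𝓡 m, 𝓡 m⟯ N) (η : N ≃ₘ^∞⟮𝓡 m, 𝓡 m⟯ M)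
    (ρ : ∀ y, F y →ₗ[ℝ] TangentSpace (𝓡 m) (η y)) (u : Π y, F y) (y : N) :
    TangentSpace (𝓡 m) y :=
  mfderiv (𝓡 m) (𝓡 m) h (η (η.symm (h.symm y)))
    (ρ (η.symm (h.symm y)) (u (η.symm (h.symm y))))

/-- The derivative of a real function along a tangent vector. -/
def dirDeriv {EB : Type*} [NormedAddCommGroup EB] [NormedSpace ℝ EB] {HB : Type*}
    [TopologicalSpace HB] (I : ModelWithCorners ℝ EB HB) {B : Type*} [TopologicalSpace B]
    [ChartedSpace HB B] (f : B → ℝ) (b : B) (w : TangentSpace I b) : ℝ :=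
  mfderiv I 𝓘(ℝ, ℝ) f b w

variable (FF F) in
/-- A generalized Lie algebroid `((F, ν, N), [ , ]_{F,h}, (ρ, η))`, for given diffeomorphisms
`h : M → N` and `η : N → M`: a vector bundle morphism `(ρ, η)` from `F` to `TM` and a bracket on the
smooth sections of `F`.  The bracket is written as an operation on all sections; only its values on
smooth sections are meaningful. -/
structure GenLieAlgebroid (h : M ≃ₘ^∞⟮𝓡 m, 𝓡 m⟯ N) (η : N ≃ₘ^∞⟮𝓡 m, 𝓡 m⟯ M) where
  /-- the bundle morphism `ρ`, covering `η` -/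
  ρ : ∀ y, F y →ₗ[ℝ] TangentSpace (𝓡 m) (η y)
  smooth_ρ : ContMDiff ((𝓡 m).prod 𝓘(ℝ, FF)) (𝓡 m).tangent ∞
    (fun v : TotalSpace FF F => (⟨η v.proj, ρ v.proj v.snd⟩ : TangentBundle (𝓡 m) M))
  /-- the bracket `[ , ]_{F,h}` -/
  bracket : (Π y, F y) → (Π y, F y) → Π y, F y
  bracket_smooth : ∀ u v, IsSmoothSec m FF u → IsSmoothSec m FF v → IsSmoothSec m FF (bracket u v)
  bracket_add : ∀ u v w, IsSmoothSec m FF u → IsSmoothSec m FF v → IsSmoothSec m FF w →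
    bracket u (v + w) = bracket u v + bracket u w
  bracket_smul : ∀ (c : ℝ) (u v), IsSmoothSec m FF u → IsSmoothSec m FF v →
    bracket u (c • v) = c • bracket u v
  bracket_skew : ∀ u v, IsSmoothSec m FF u → IsSmoothSec m FF v → bracket v u = - bracket u v
  jacobi : ∀ u v w, IsSmoothSec m FF u → IsSmoothSec m FF v → IsSmoothSec m FF w →
    bracket u (bracket v w) + bracket v (bracket w u) + bracket w (bracket u v) = 0
  leibniz : ∀ (f : N → ℝ) (u v), ContMDiff (𝓡 m) 𝓘(ℝ, ℝ) ∞ f →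
    IsSmoothSec m FF u → IsSmoothSec m FF v →
    bracket u (fun y => f y • v y) =
      fun y => f y • bracket u v y + dirDeriv (𝓡 m) f y (pushAnchor h η ρ u y) • v y
  pushAnchor_bracket : ∀ u v, IsSmoothSec m FF u → IsSmoothSec m FF v →
    pushAnchor h η ρ (bracket u v) =
      VectorField.mlieBracket (𝓡 m) (pushAnchor h η ρ u) (pushAnchor h η ρ v)

variable {h : M ≃ₘ^∞⟮𝓡 m, 𝓡 m⟯ N} {η : N ≃ₘ^∞⟮𝓡 m, 𝓡 m⟯ M}

open Classical in
/-- The linear map `F_{h(x)} → T_x M`, `z^α t_α(h(x)) ↦ z^α (ρ^i_α ∘ h)(x) ∂_i|_x`, where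
`(ρ^i_α ∘ h) ∂_i` is the vector field `x ↦ ρ (t_α (η⁻¹(x)))` on `M`.
The axioms of a generalized Lie algebroid force `ρ` to vanish on `F_y` unless `h (η y) = y`. Hence
the above map is `ρ` on `F_{h(x)}` (with values in the tangent space at `η (h x) = x`) if
`η (h x) = x`, and it is zero otherwise. -/
def GenLieAlgebroid.anchorAt (A : GenLieAlgebroid FF F h η) (x : M) :
    F (h x) →ₗ[ℝ] TangentSpace (𝓡 m) x :=
  if η (h x) = x then (A.ρ (h x) : F (h x) →ₗ[ℝ] EuclideanSpace ℝ (Fin m)) else 0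

/-- `L` are the structure functions of the local frame `t` on `S`:
`[t_α, t_β]_{F,h} = L^γ_{αβ} t_γ` on `S`; the entry `L^γ_{αβ}` is `L γ α β`. -/
def GenLieAlgebroid.IsStructureFunctions (A : GenLieAlgebroid FF F h η) {ι : Type*} [Fintype ι]
    (t : ι → Π y, F y) (S : Set N) (L : ι → ι → ι → N → ℝ) : Prop :=
  ∀ y ∈ S, ∀ α β, IsLocalValue (IsSmoothSec m FF) A.bracket (t α) (t β) y
    (∑ γ, L γ α β y • t γ y)

/-! ### The generalized tangent bundle

From here on `W` is the vector bundle over `M` whose total space carries the geometry (it is the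
dual bundle of `E` in the application). -/

section Tangent

variable {FW : Type*} [NormedAddCommGroup FW] [NormedSpace ℝ FW]
  {W : M → Type*} [TopologicalSpace (TotalSpace FW W)]
  [∀ x, AddCommGroup (W x)] [∀ x, Module ℝ (W x)] [∀ x, TopologicalSpace (W x)]
  [FiberBundle FW W] [VectorBundle ℝ FW W] [ContMDiffVectorBundle ∞ FW W (𝓡 m)]

/-- The fibre over `u` of the generalized tangent bundle `(ρ,η)TW`: the pairs `z ⊕ w` in
`F_{h(π(u))} ⊕ T_u W` such that `w` projects to the anchor of `z`, i.e. the span of the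
`T_α ⊕ (ρ^i_α ∘ h ∘ π) ∂_i` and the `0 ⊕ ∂̇^a`. -/
def GenLieAlgebroid.GT (A : GenLieAlgebroid FF F h η) (u : TotalSpace FW W) :
    Submodule ℝ (F (h u.proj) × TangentSpace ((𝓡 m).prod 𝓘(ℝ, FW)) u) :=
  LinearMap.ker
    ((mfderiv ((𝓡 m).prod 𝓘(ℝ, FW)) (𝓡 m) (π FW W) u).toLinearMap ∘ₗ LinearMap.snd ℝ _ _ -
      A.anchorAt u.proj ∘ₗ LinearMap.fst ℝ _ _)

variable {A : GenLieAlgebroid FF F h η}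

theorem GenLieAlgebroid.mem_GT {u : TotalSpace FW W}
    {q : F (h u.proj) × TangentSpace ((𝓡 m).prod 𝓘(ℝ, FW)) u} :
    q ∈ A.GT u ↔
      mfderiv ((𝓡 m).prod 𝓘(ℝ, FW)) (𝓡 m) (π FW W) u q.2 = A.anchorAt u.proj q.1 := by
  simp only [GenLieAlgebroid.GT, LinearMap.mem_ker, LinearMap.sub_apply, sub_eq_zero]
  rfl

/-- The projection `(ρ,η)π! : z ⊕ w ↦ z` of a fibre of the generalized tangent bundle. -/
def GenLieAlgebroid.pr (A : GenLieAlgebroid FF F h η) (u : TotalSpace FW W) :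
    A.GT u →ₗ[ℝ] F (h u.proj) :=
  LinearMap.fst ℝ _ _ ∘ₗ (A.GT u).subtype

/-- The anchor `ρ̃ : z ⊕ w ↦ w` of the generalized tangent bundle, on a fibre. -/
def GenLieAlgebroid.anchor (A : GenLieAlgebroid FF F h η) (u : TotalSpace FW W) :
    A.GT u →ₗ[ℝ] TangentSpace ((𝓡 m).prod 𝓘(ℝ, FW)) u :=
  LinearMap.snd ℝ _ _ ∘ₗ (A.GT u).subtype

/-- The fibre of the vertical subbundle, the kernel of the projection to `F`. -/
def GenLieAlgebroid.vert (A : GenLieAlgebroid FF F h η) (u : TotalSpace FW W) :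
    Submodule ℝ (A.GT u) :=
  LinearMap.ker (A.pr u)

/-- Smooth sections of the generalized tangent bundle. -/
def GenLieAlgebroid.SmoothGT (A : GenLieAlgebroid FF F h η)
    (X : Π u : TotalSpace FW W, A.GT u) : Prop :=
  ContMDiff ((𝓡 m).prod 𝓘(ℝ, FW)) ((𝓡 m).prod 𝓘(ℝ, FF)) ∞
    (fun u => (⟨h u.proj, A.pr u (X u)⟩ : TotalSpace FF F)) ∧
  ContMDiff ((𝓡 m).prod 𝓘(ℝ, FW)) ((𝓡 m).prod 𝓘(ℝ, FW)).tangent ∞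
    (fun u => (⟨u, A.anchor u (X u)⟩ : TangentBundle ((𝓡 m).prod 𝓘(ℝ, FW)) (TotalSpace FW W)))

/-- The action `Γ(ρ̃, Id)(X) f` of an element of the generalized tangent bundle on a function. -/
def GenLieAlgebroid.act (A : GenLieAlgebroid FF F h η) (u : TotalSpace FW W) (X : A.GT u)
    (f : TotalSpace FW W → ℝ) : ℝ :=
  dirDeriv ((𝓡 m).prod 𝓘(ℝ, FW)) f u (A.anchor u X)

/-- The vertical lift of `e ∈ W_{π(u)}`: the velocity at `0` of the curve `t ↦ u + t e`.  For the
elements `e^a` of a frame this is `∂/∂p_a`, where `p_a` are the fibre coordinates of the frame. -/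
def vertLift (u : TotalSpace FW W) (e : W u.proj) :
    TangentSpace ((𝓡 m).prod 𝓘(ℝ, FW)) u :=
  mfderiv 𝓘(ℝ, ℝ) ((𝓡 m).prod 𝓘(ℝ, FW))
    (fun s : ℝ => (⟨u.proj, u.snd + s • e⟩ : TotalSpace FW W)) 0 (1 : ℝ)

theorem mfderiv_proj_vertLift (u : TotalSpace FW W) (e : W u.proj) :
    mfderiv ((𝓡 m).prod 𝓘(ℝ, FW)) (𝓡 m) (π FW W) u (vertLift u e) = 0 := by
  have key : ∀ (c : ℝ → TotalSpace FW W) (v : TotalSpace FW W), c 0 = v →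
      (∀ s, (c s).proj = v.proj) →
      mfderiv ((𝓡 m).prod 𝓘(ℝ, FW)) (𝓡 m) (π FW W) v
        (mfderiv 𝓘(ℝ, ℝ) ((𝓡 m).prod 𝓘(ℝ, FW)) c 0 (1 : ℝ)) = 0 := by
    rintro c v rfl hc
    by_cases hd : MDifferentiableAt 𝓘(ℝ, ℝ) ((𝓡 m).prod 𝓘(ℝ, FW)) c 0
    · have hp : MDifferentiableAt ((𝓡 m).prod 𝓘(ℝ, FW)) (𝓡 m) (π FW W) (c 0) :=
        (contMDiffAt_proj W (n := ∞)).mdifferentiableAt (by simp)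
      have h1 := mfderiv_comp (0 : ℝ) hp hd
      have h2 : (π FW W) ∘ c = fun _ => (c 0).proj := funext hc
      rw [h2, mfderiv_const] at h1
      exact (DFunLike.congr_fun h1 (1 : ℝ)).symm
    · rw [mfderiv_zero_of_not_mdifferentiableAt hd]
      exact map_zero _
  exact key _ u (by simp) (fun _ => rfl)

theorem mfderiv_proj_surjective (u : TotalSpace FW W) :
    Function.Surjective (mfderiv ((𝓡 m).prod 𝓘(ℝ, FW)) (𝓡 m) (π FW W) u) := by
  have hu : u.proj ∈ (trivializationAt FW W u.proj).baseSet :=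
    FiberBundle.mem_baseSet_trivializationAt' u.proj
  set e := trivializationAt FW W u.proj with he
  have hus : u ∈ e.source := e.mem_source.2 hu
  let c : M → TotalSpace FW W := fun x => e.toOpenPartialHomeomorph.symm (x, (e u).2)
  have hcu : c u.proj = u := by
    have : (u.proj, (e u).2) = e u := Prod.ext (e.coe_fst hus).symm rfl
    simp only [c, this]
    exact e.toOpenPartialHomeomorph.left_inv hus
  have hc : ContMDiffAt (𝓡 m) ((𝓡 m).prod 𝓘(ℝ, FW)) ∞ c u.proj := by
    have h1 := (e.contMDiffOn_symm (n := ∞) (IB := 𝓡 m))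
    have h2 : ContMDiffAt (𝓡 m) ((𝓡 m).prod 𝓘(ℝ, FW)) ∞
        (fun x : M => (x, (e u).2)) u.proj := contMDiffAt_id.prodMk contMDiffAt_const
    refine (h1.contMDiffAt ?_).comp u.proj h2
    exact e.open_target.mem_nhds (e.mem_target.2 hu)
  have hd := hc.mdifferentiableAt (by simp)
  have hp : MDifferentiableAt ((𝓡 m).prod 𝓘(ℝ, FW)) (𝓡 m) (π FW W) (c u.proj) :=
    (contMDiffAt_proj W (n := ∞)).mdifferentiableAt (by simp)
  have h1 := mfderiv_comp u.proj hp hd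
  have h2 : (π FW W) ∘ c =ᶠ[𝓝 u.proj] id := by
    filter_upwards [e.open_baseSet.mem_nhds hu] with x hx
    exact e.proj_symm_apply (e.mem_target.2 hx)
  rw [h2.mfderiv_eq, mfderiv_id] at h1
  rw [← hcu]
  intro v
  exact ⟨mfderiv (𝓡 m) ((𝓡 m).prod 𝓘(ℝ, FW)) c u.proj v, (DFunLike.congr_fun h1 v).symm⟩

/-- The vertical element `0 ⊕ (vertical lift of e)` of the generalized tangent bundle. -/
def GenLieAlgebroid.dot (A : GenLieAlgebroid FF F h η) (u : TotalSpace FW W) (e : W u.proj) :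
    A.GT u :=
  ⟨(0, vertLift u e), GenLieAlgebroid.mem_GT.2 <| by
    simpa using mfderiv_proj_vertLift u e⟩

variable (FW W) in
/-- A `(ρ,η)`-connection `Γ` for `W`: a smooth bundle morphism from the generalized tangent bundle
onto the vertical subbundle, which splits the inclusion of the vertical subbundle. -/
structure RhoConnection (A : GenLieAlgebroid FF F h η) where
  /-- the morphism, fibre by fibre -/
  Γ : ∀ u : TotalSpace FW W, A.GT u →ₗ[ℝ] A.GT u
  mem_vert : ∀ u X, Γ u X ∈ A.vert u
  split : ∀ u, ∀ X ∈ A.vert u, Γ u X = X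
  smooth : ∀ X : Π u, A.GT u, A.SmoothGT X → A.SmoothGT (fun u => Γ u (X u))

/-- The fibre of the horizontal subbundle. -/
def RhoConnection.hor (C : RhoConnection FW W A) (u : TotalSpace FW W) : Submodule ℝ (A.GT u) :=
  LinearMap.ker (C.Γ u)

theorem RhoConnection.exists_lift (C : RhoConnection FW W A) (u : TotalSpace FW W)
    (z : F (h u.proj)) : ∃ X : A.GT u, A.pr u X = z ∧ X ∈ C.hor u := by
  obtain ⟨w, hw⟩ := mfderiv_proj_surjective u (A.anchorAt u.proj z)
  let X : A.GT u := ⟨(z, w), GenLieAlgebroid.mem_GT.2 hw⟩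
  refine ⟨X - C.Γ u X, ?_, ?_⟩
  · have h1 : A.pr u (C.Γ u X) = 0 := C.mem_vert u X
    rw [map_sub, h1, sub_zero]
    rfl
  · have h1 := C.split u _ (C.mem_vert u X)
    simp [RhoConnection.hor, h1]

/-- The horizontal lift of `z ∈ F_{h(π(u))}`: the (unique) element `X` of the generalized tangent
bundle with `(ρ,η)π!(X) = z` and `Γ(X) = 0`. -/
def RhoConnection.lift (C : RhoConnection FW W A) (u : TotalSpace FW W) (z : F (h u.proj)) :
    A.GT u :=
  (C.exists_lift u z).choose

theorem RhoConnection.lift_spec (C : RhoConnection FW W A) (u : TotalSpace FW W)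
    (z : F (h u.proj)) : A.pr u (C.lift u z) = z ∧ C.Γ u (C.lift u z) = 0 :=
  (C.exists_lift u z).choose_spec

/-- The sections `δ̃_α` of the adapted base, for a local frame `t` of `F`. -/
def RhoConnection.delta (C : RhoConnection FW W A) {ι : Type*} (t : ι → Π y, F y) (α : ι)
    (u : TotalSpace FW W) : A.GT u :=
  C.lift u (t α (h u.proj))

variable (A) in
/-- The sections `∂̇^a` of the adapted base, for a local frame `e` of `W`. -/
def GenLieAlgebroid.dotFrame {κ : Type*} (e : κ → Π x, W x) (a : κ) (u : TotalSpace FW W) :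
    A.GT u :=
  A.dot u (e a u.proj)

/-- A distinguished linear `(ρ,η)`-connection: a covariant `(ρ,η)`-derivative `D` on the generalized
tangent bundle which preserves the horizontal and the vertical subbundle by parallelism.  `D` is
written as an operation on all sections; only its values on smooth sections are meaningful. -/
structure DLinearConnection (C : RhoConnection FW W A) where
  /-- the covariant derivative `(X, Y) ↦ D_X Y` -/
  D : (Π u : TotalSpace FW W, A.GT u) → (Π u : TotalSpace FW W, A.GT u) →
    Π u : TotalSpace FW W, A.GT u
  smooth : ∀ X Y, A.SmoothGT X → A.SmoothGT Y → A.SmoothGT (D X Y)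
  add_left : ∀ X X' Y, A.SmoothGT X → A.SmoothGT X' → A.SmoothGT Y →
    D (X + X') Y = D X Y + D X' Y
  smul_left : ∀ (f : TotalSpace FW W → ℝ) (X Y),
    ContMDiff ((𝓡 m).prod 𝓘(ℝ, FW)) 𝓘(ℝ, ℝ) ∞ f → A.SmoothGT X → A.SmoothGT Y →
    D (fun u => f u • X u) Y = fun u => f u • D X Y u
  add_right : ∀ X Y Y', A.SmoothGT X → A.SmoothGT Y → A.SmoothGT Y' →
    D X (Y + Y') = D X Y + D X Y'
  leibniz : ∀ (f : TotalSpace FW W → ℝ) (X Y),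
    ContMDiff ((𝓡 m).prod 𝓘(ℝ, FW)) 𝓘(ℝ, ℝ) ∞ f → A.SmoothGT X → A.SmoothGT Y →
    D X (fun u => f u • Y u) = fun u => f u • D X Y u + A.act u (X u) f • Y u
  horizontal : ∀ X Y, A.SmoothGT X → A.SmoothGT Y →
    (∀ u, Y u ∈ C.hor u) → ∀ u, D X Y u ∈ C.hor u
  vertical : ∀ X Y, A.SmoothGT X → A.SmoothGT Y →
    (∀ u, Y u ∈ A.vert u) → ∀ u, D X Y u ∈ A.vert u

/-- Four families of local functions on the total space, to be the components of a distinguished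
linear connection: `HH α β γ` is `H^α_{βγ}`, `HV a b γ` is `H^a_{bγ}`, `VH α β c` is `V^{αc}_β` and
`VV a b c` is `V^{ac}_b`. -/
structure DComponents (B ι κ : Type*) where
  /-- `H^α_{βγ}` -/
  HH : ι → ι → ι → B → ℝ
  /-- `H^a_{bγ}` -/
  HV : κ → κ → ι → B → ℝ
  /-- `V^{αc}_β` -/
  VH : ι → ι → κ → B → ℝ
  /-- `V^{ac}_b` -/
  VV : κ → κ → κ → B → ℝ

/-- `K` are the components of `D` over `π⁻¹(U)` in the adapted base given by the local frames `t` of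
`F` and `e` of `W`. -/
structure DLinearConnection.HasComponents {C : RhoConnection FW W A} (D : DLinearConnection C)
    {ι κ : Type*} [Fintype ι] [Fintype κ] (t : ι → Π y, F y) (e : κ → Π x, W x) (U : Set M)
    (K : DComponents (TotalSpace FW W) ι κ) : Prop where
  hh : ∀ u : TotalSpace FW W, u.proj ∈ U → ∀ β γ,
    IsLocalValue A.SmoothGT D.D (C.delta t γ) (C.delta t β) u
      (∑ α, K.HH α β γ u • C.delta t α u)
  hv : ∀ u : TotalSpace FW W, u.proj ∈ U → ∀ a γ,
    IsLocalValue A.SmoothGT D.D (C.delta t γ) (A.dotFrame e a) u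
      (∑ b, K.HV a b γ u • A.dotFrame e b u)
  vh : ∀ u : TotalSpace FW W, u.proj ∈ U → ∀ β c,
    IsLocalValue A.SmoothGT D.D (A.dotFrame e c) (C.delta t β) u
      (∑ α, K.VH α β c u • C.delta t α u)
  vv : ∀ u : TotalSpace FW W, u.proj ∈ U → ∀ b c,
    IsLocalValue A.SmoothGT D.D (A.dotFrame e c) (A.dotFrame e b) u
      (∑ a, K.VV b a c u • A.dotFrame e a u)

/-! ### (Pseudo)metrical structures -/

/-- A pseudometrical structure `G = g_{αβ} dz̃^α ⊗ dz̃^β + g^{ab} δp̃_a ⊗ δp̃_b`: a smooth symmetric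
tensor field of type (0,2) without mixed components, nondegenerate on the horizontal and on the
vertical subbundle. -/
structure IsPseudoMetrical (C : RhoConnection FW W A)
    (G : ∀ u : TotalSpace FW W, LinearMap.BilinForm ℝ (A.GT u)) : Prop where
  smooth : ∀ X Y, A.SmoothGT X → A.SmoothGT Y →
    ContMDiff ((𝓡 m).prod 𝓘(ℝ, FW)) 𝓘(ℝ, ℝ) ∞ (fun u => G u (X u) (Y u))
  symm : ∀ u X Y, G u X Y = G u Y X
  mixed : ∀ u, ∀ X ∈ C.hor u, ∀ Y ∈ A.vert u, G u X Y = 0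
  nondegenerate_hor : ∀ u, ((G u).restrict (C.hor u)).Nondegenerate
  nondegenerate_vert : ∀ u, ((G u).restrict (A.vert u)).Nondegenerate

/-- The signature (numbers of positive and of negative squares) of the restriction of a symmetric
bilinear form to a subspace. -/
def signatureOn {V : Type*} [AddCommGroup V] [Module ℝ V] (B : LinearMap.BilinForm ℝ V)
    (S : Submodule ℝ V) : ℕ × ℕ :=
  (sigPos (R := ℝ) (M := S) (B.restrict S).toQuadraticMap,
    sigNeg (R := ℝ) (M := S) (B.restrict S).toQuadraticMap)

/-- A metrical structure: a pseudometrical structure such that `‖g_{αβ}‖` and `‖g^{ab}‖` have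
constant signature. -/
structure IsMetrical (C : RhoConnection FW W A)
    (G : ∀ u : TotalSpace FW W, LinearMap.BilinForm ℝ (A.GT u)) : Prop
    extends IsPseudoMetrical C G where
  signature_hor : ∃ s : ℕ × ℕ, ∀ u, signatureOn (G u) (C.hor u) = s
  signature_vert : ∃ s : ℕ × ℕ, ∀ u, signatureOn (G u) (A.vert u) = s

/-- The covariant derivative of a tensor field of type (0,2):
`(D_X G)(Y, Z) = ρ̃(X)(G(Y, Z)) - G(D_X Y, Z) - G(Y, D_X Z)`. -/
def DLinearConnection.covTensor {C : RhoConnection FW W A} (D : DLinearConnection C)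
    (G : ∀ u : TotalSpace FW W, LinearMap.BilinForm ℝ (A.GT u))
    (X Y Z : Π u : TotalSpace FW W, A.GT u)
    (u : TotalSpace FW W) : ℝ :=
  A.act u (X u) (fun v => G v (Y v) (Z v)) - G u (D.D X Y u) (Z u) - G u (Y u) (D.D X Z u)

/-- `D_X G = 0` for all sections `X`. -/
def DLinearConnection.Parallel {C : RhoConnection FW W A} (D : DLinearConnection C)
    (G : ∀ u : TotalSpace FW W, LinearMap.BilinForm ℝ (A.GT u)) : Prop :=
  ∀ X Y Z, A.SmoothGT X → A.SmoothGT Y → A.SmoothGT Z → ∀ u, D.covTensor G X Y Z u = 0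

/-- The generalized tangent bundle is `(ρ,η)`-pseudometrizable. -/
def RhoConnection.PseudoMetrizable (C : RhoConnection FW W A) : Prop :=
  ∃ (G : ∀ u : TotalSpace FW W, LinearMap.BilinForm ℝ (A.GT u)) (D : DLinearConnection C),
    IsPseudoMetrical C G ∧ D.Parallel G

/-- The generalized tangent bundle is `(ρ,η)`-metrizable. -/
def RhoConnection.Metrizable (C : RhoConnection FW W A) : Prop :=
  ∃ (G : ∀ u : TotalSpace FW W, LinearMap.BilinForm ℝ (A.GT u)) (D : DLinearConnection C),
    IsMetrical C G ∧ D.Parallel G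

/-! ### The local functions -/

section Components

variable {ι κ : Type*} [Fintype ι] [Fintype κ] (C : RhoConnection FW W A)
  (G : ∀ u : TotalSpace FW W, LinearMap.BilinForm ℝ (A.GT u))
  (t : ι → Π y, F y) (e : κ → Π x, W x)

/-- The matrix `‖g_{αβ}‖` in the adapted base. -/
def gHor (u : TotalSpace FW W) : Matrix ι ι ℝ :=
  fun α β => G u (C.delta t α u) (C.delta t β u)

/-- The matrix `‖g^{ab}‖` in the adapted base. -/
def gVert (u : TotalSpace FW W) : Matrix κ κ ℝ :=
  fun a b => G u (A.dotFrame e a u) (A.dotFrame e b u)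

/-- `g^{ab}_{|γ}`, the horizontal covariant derivative of `g^{ab}` for the components `K`. -/
def gVertH (K : DComponents (TotalSpace FW W) ι κ) (a b : κ) (γ : ι) (u : TotalSpace FW W) : ℝ :=
  A.act u (C.delta t γ u) (fun v => gVert G e v a b)
    - ∑ d, K.HV a d γ u * gVert G e u d b - ∑ d, K.HV b d γ u * gVert G e u a d

/-- `g_{αβ}|^c`, the vertical covariant derivative of `g_{αβ}` for the components `K`. -/
def gHorV (K : DComponents (TotalSpace FW W) ι κ) (α β : ι) (c : κ) (u : TotalSpace FW W) : ℝ :=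
  A.act u (A.dotFrame e c u) (fun v => gHor C G t v α β)
    - ∑ θ, K.VH θ α c u * gHor C G t u θ β - ∑ θ, K.VH θ β c u * gHor C G t u α θ

/-- The local functions built from `G`, from the structure functions `L` of the frame `t` and from
the components `K` of a given distinguished linear connection. -/
def metricComponents [DecidableEq ι] [DecidableEq κ] (L : ι → ι → ι → N → ℝ)
    (K : DComponents (TotalSpace FW W) ι κ) : DComponents (TotalSpace FW W) ι κ where
  HH α β γ u := (1 / 2) * ∑ ε, (gHor C G t u)⁻¹ α ε *
    (A.act u (C.delta t γ u) (fun v => gHor C G t v ε β)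
      + A.act u (C.delta t β u) (fun v => gHor C G t v ε γ)
      - A.act u (C.delta t ε u) (fun v => gHor C G t v β γ)
      + ∑ θ, gHor C G t u θ ε * L θ γ β (h u.proj)
      - ∑ θ, gHor C G t u β θ * L θ γ ε (h u.proj)
      - ∑ θ, gHor C G t u θ γ * L θ β ε (h u.proj))
  HV a b γ u := K.HV a b γ u + (1 / 2) * ∑ d, (gVert G e u)⁻¹ b d * gVertH C G t e K d a γ u
  VH α β c u := K.VH α β c u + (1 / 2) * ∑ ε, (gHor C G t u)⁻¹ α ε * gHorV C G t e K ε β c u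
  VV a b c u := (1 / 2) * ∑ d, (gVert G e u)⁻¹ b d *
    (A.act u (A.dotFrame e c u) (fun v => gVert G e v d a)
      + A.act u (A.dotFrame e a u) (fun v => gVert G e v d c)
      - A.act u (A.dotFrame e d u) (fun v => gVert G e v a c))

end Components

end Tangent
end Algebroid

/-- The fibres of the dual vector bundle. -/
abbrev DualFiber {M : Type*} (E : M → Type*) [∀ x, AddCommGroup (E x)] [∀ x, Module ℝ (E x)]
    [∀ x, TopologicalSpace (E x)] (x : M) : Type _ :=
  E x →L[ℝ] Bundle.Trivial M ℝ x

end GenLieDefs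

/-!
# A metric distinguished linear connection on the generalized tangent bundle

Two distinguished linear connections differ by a tensor field, and a tensor field `σ(X, Y, Z)` of
type (0,3) which vanishes when one of `Y`, `Z` is horizontal and the other one vertical can be added
to a given connection `D₀`: the nondegenerate form `G` turns it into a section-valued tensor field
(`IsPseudoMetrical.exists_riesz`, `DLinearConnection.exists_add_tensor`). The new connection is metric
as soon as `σ(X, Y, Z) + σ(X, Z, Y) = (D₀_X G)(Y, Z)`, so that everything depends on the choice of `σ`
(`DLinearConnection.correction`).

If `X` is vertical and `Y`, `Z` are horizontal, or conversely, then `σ` is half of `(D₀_X G)(Y, Z)`,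
which gives the components `V^{αc}_β` and `H^a_{bγ}`. If the three arguments are horizontal, or if they
are all vertical, then `σ` is the difference between the Koszul expression of `G` and
`G(D₀_X Y, Z)`. The Koszul expression contains a bracket, which is available only on horizontal lifts
of sections of `F` (the bracket of the algebroid) and on vertical lifts of sections of the bundle
(where it is zero). In both cases it satisfies the Leibniz rule for functions that come from the
base, and therefore the torsion of `D₀` on lifts is tensorial. The Koszul correction is expressed
by the covariant derivative of `G` and this torsion tensor. The common framework for the two cases is
`LiftedBundle`; the Koszul formula is `LiftedBundle.koszul_sec`, and the metric property is
`LiftedBundle.koszul_add_koszul`.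

For the horizontal Leibniz rule the vector field `Γ(Th ∘ ρ, h ∘ η) u` of the algebroid has to agree with
the anchor of the horizontal lift of `u`. The latter is zero over the points with `η (h x) ≠ x`, and
this is correct because the axioms of a generalized Lie algebroid force `ρ` to vanish there
(`GenLieAlgebroid.ρ_eq_zero`).

The connections operate on global sections. Their values on local frames, and all tensoriality
statements, are obtained by cutting off with bump functions. Smoothness is tested through the pairings
with smooth sections, with the inverse Gram matrix of a local frame
(`IsPseudoMetrical.smoothGT_of_pairing`).
-/

noncomputable section

/-! ### Smoothness of sections along a map -/

section AlongMap

variable {EQ : Type*} [NormedAddCommGroup EQ] [NormedSpace ℝ EQ]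
  {HQ : Type*} [TopologicalSpace HQ] {J : ModelWithCorners ℝ EQ HQ}
  {Q : Type*} [TopologicalSpace Q] [ChartedSpace HQ Q]
  {EB : Type*} [NormedAddCommGroup EB] [NormedSpace ℝ EB]
  {HB : Type*} [TopologicalSpace HB] {I : ModelWithCorners ℝ EB HB}
  {B : Type*} [TopologicalSpace B] [ChartedSpace HB B]
  {FV : Type*} [NormedAddCommGroup FV] [NormedSpace ℝ FV]
  {V : B → Type*} [TopologicalSpace (TotalSpace FV V)]
  [∀ b, AddCommGroup (V b)] [∀ b, Module ℝ (V b)] [∀ b, TopologicalSpace (V b)]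
  [FiberBundle FV V] [VectorBundle ℝ FV V]
  {q : Q → B} {x₀ : Q}

/-- Near `x₀`, the base point `q x` lies in the domain of the trivialization at `q x₀`. -/
lemma eventually_mem_baseSet_along (hq : ContMDiffAt J I ∞ q x₀) :
    ∀ᶠ x in 𝓝 x₀, q x ∈ (trivializationAt FV V (q x₀)).baseSet :=
  hq.continuousAt.eventually_mem ((trivializationAt FV V (q x₀)).open_baseSet.mem_nhds
    (FiberBundle.mem_baseSet_trivializationAt' _))

lemma ContMDiffAt.base_of_along {z : ∀ x, V (q x)}
    (h : ContMDiffAt J (I.prod 𝓘(ℝ, FV)) ∞ (fun x => (⟨q x, z x⟩ : TotalSpace FV V)) x₀) :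
    ContMDiffAt J I ∞ q x₀ :=
  (contMDiffAt_totalSpace.1 h).1

/-- The sum of two smooth maps into a vector bundle which cover the same map `q` is smooth. -/
lemma ContMDiffAt.add_along {z z' : ∀ x, V (q x)}
    (h : ContMDiffAt J (I.prod 𝓘(ℝ, FV)) ∞ (fun x => (⟨q x, z x⟩ : TotalSpace FV V)) x₀)
    (h' : ContMDiffAt J (I.prod 𝓘(ℝ, FV)) ∞ (fun x => (⟨q x, z' x⟩ : TotalSpace FV V)) x₀) :
    ContMDiffAt J (I.prod 𝓘(ℝ, FV)) ∞
      (fun x => (⟨q x, z x + z' x⟩ : TotalSpace FV V)) x₀ := by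
  have hq := h.base_of_along
  rw [contMDiffAt_totalSpace] at h h' ⊢
  refine ⟨hq, (h.2.add h'.2).congr_of_eventuallyEq ?_⟩
  filter_upwards [eventually_mem_baseSet_along (FV := FV) (V := V) hq] with x hx
  exact ((trivializationAt FV V (q x₀)).linear ℝ hx).map_add _ _

lemma ContMDiffAt.smul_along {z : ∀ x, V (q x)} {f : Q → ℝ}
    (hf : ContMDiffAt J 𝓘(ℝ, ℝ) ∞ f x₀)
    (h : ContMDiffAt J (I.prod 𝓘(ℝ, FV)) ∞ (fun x => (⟨q x, z x⟩ : TotalSpace FV V)) x₀) :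
    ContMDiffAt J (I.prod 𝓘(ℝ, FV)) ∞
      (fun x => (⟨q x, f x • z x⟩ : TotalSpace FV V)) x₀ := by
  have hq := h.base_of_along
  rw [contMDiffAt_totalSpace] at h ⊢
  refine ⟨hq, (hf.smul h.2).congr_of_eventuallyEq ?_⟩
  filter_upwards [eventually_mem_baseSet_along (FV := FV) (V := V) hq] with x hx
  exact ((trivializationAt FV V (q x₀)).linear ℝ hx).map_smul _ _

lemma ContMDiffAt.zero_along (hq : ContMDiffAt J I ∞ q x₀) :
    ContMDiffAt J (I.prod 𝓘(ℝ, FV)) ∞ (fun x => (⟨q x, 0⟩ : TotalSpace FV V)) x₀ := by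
  rw [contMDiffAt_totalSpace]
  refine ⟨hq, (contMDiffAt_const (c := (0 : FV))).congr_of_eventuallyEq ?_⟩
  filter_upwards [eventually_mem_baseSet_along (FV := FV) (V := V) hq] with x hx
  exact ((trivializationAt FV V (q x₀)).linear ℝ hx).map_zero

end AlongMap

/-- The derivative of a family of maps `f x`, taken at `g x` and applied to a smooth vector field
`w` along `g`, is smooth in the parameter `x`. -/
lemma ContMDiffAt.mfderiv_apply_along
    {EQ : Type*} [NormedAddCommGroup EQ] [NormedSpace ℝ EQ]
    {HQ : Type*} [TopologicalSpace HQ] {J : ModelWithCorners ℝ EQ HQ}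
    {Q : Type*} [TopologicalSpace Q] [ChartedSpace HQ Q] [IsManifold J ∞ Q]
    {EB : Type*} [NormedAddCommGroup EB] [NormedSpace ℝ EB]
    {HB : Type*} [TopologicalSpace HB] {I : ModelWithCorners ℝ EB HB}
    {B : Type*} [TopologicalSpace B] [ChartedSpace HB B] [IsManifold I ∞ B]
    {EB' : Type*} [NormedAddCommGroup EB'] [NormedSpace ℝ EB']
    {HB' : Type*} [TopologicalSpace HB'] {I' : ModelWithCorners ℝ EB' HB'}
    {B' : Type*} [TopologicalSpace B'] [ChartedSpace HB' B'] [IsManifold I' ∞ B']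
    {x₀ : Q} (f : Q → B → B') (g : Q → B) (w : ∀ x, TangentSpace I (g x))
    (hf : ContMDiffAt (J.prod I) I' ∞ (Function.uncurry f) (x₀, g x₀))
    (hw : ContMDiffAt J I.tangent ∞ (fun x => (⟨g x, w x⟩ : TangentBundle I B)) x₀) :
    ContMDiffAt J I'.tangent ∞
      (fun x => (⟨f x (g x), mfderiv I I' (f x) (g x) (w x)⟩ : TangentBundle I' B')) x₀ := by
  have hg : ContMDiffAt J I ∞ g x₀ := (contMDiffAt_totalSpace.1 hw).1
  have h1 := ContMDiffAt.mfderiv (m := ∞) f g hf hg (by simp)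
  have h2 : ContMDiffAt J I' ∞ (fun x => f x (g x)) x₀ :=
    ContMDiffAt.comp (g := Function.uncurry f) x₀ hf (contMDiffAt_id.prodMk hg)
  exact ContMDiffAt.clm_apply_of_inCoordinates (b₁ := g) (b₂ := fun x => f x (g x)) h1 hw h2

/-! ### Bump functions and extension of germs -/

section Bump

/-- The total space of a fibre bundle with Hausdorff base and Hausdorff fibre is Hausdorff. -/
lemma t2Space_totalSpace {B : Type*} [TopologicalSpace B] [T2Space B] {FV : Type*}
    [TopologicalSpace FV] [T2Space FV] {V : B → Type*} [TopologicalSpace (TotalSpace FV V)]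
    [∀ b, TopologicalSpace (V b)] [FiberBundle FV V] : T2Space (TotalSpace FV V) := by
  refine ⟨fun u v huv => ?_⟩
  by_cases hp : u.proj = v.proj
  · set e := trivializationAt FV V u.proj
    have hu : u ∈ e.source := e.mem_source.2 (FiberBundle.mem_baseSet_trivializationAt' _)
    have hv : v ∈ e.source :=
      e.mem_source.2 (hp ▸ FiberBundle.mem_baseSet_trivializationAt' u.proj)
    have hne : e u ≠ e v := fun h => huv (e.injOn hu hv h)
    obtain ⟨O, O', hO, hO', hmO, hmO', hd⟩ := t2_separation hne
    refine ⟨e.source ∩ e ⁻¹' O, e.source ∩ e ⁻¹' O', ?_, ?_, ⟨hu, hmO⟩, ⟨hv, hmO'⟩, ?_⟩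
    · exact e.toOpenPartialHomeomorph.isOpen_inter_preimage hO
    · exact e.toOpenPartialHomeomorph.isOpen_inter_preimage hO'
    · exact (hd.preimage e).mono Set.inter_subset_right Set.inter_subset_right
  · obtain ⟨O, O', hO, hO', hmO, hmO', hd⟩ := t2_separation hp
    exact ⟨_, _, hO.preimage (FiberBundle.continuous_proj FV V),
      hO'.preimage (FiberBundle.continuous_proj FV V), hmO, hmO', hd.preimage _⟩

variable {EB : Type*} [NormedAddCommGroup EB] [NormedSpace ℝ EB] [FiniteDimensional ℝ EB]
  {HB : Type*} [TopologicalSpace HB] {I : ModelWithCorners ℝ EB HB}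
  {B : Type*} [TopologicalSpace B] [ChartedSpace HB B] [T2Space B] [IsManifold I ∞ B]

/-- A smooth function which is `1` near `b` and whose support lies in a given neighbourhood. -/
lemma exists_bump (I : ModelWithCorners ℝ EB HB) [IsManifold I ∞ B] {b : B} {S : Set B}
    (hS : S ∈ 𝓝 b) :
    ∃ φ : B → ℝ, ContMDiff I 𝓘(ℝ, ℝ) ∞ φ ∧ (∀ᶠ b' in 𝓝 b, φ b' = 1) ∧ tsupport φ ⊆ S := by
  obtain ⟨φ, -, hφ⟩ := (SmoothBumpFunction.nhds_basis_tsupport (I := I) b).mem_iff.1 hS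
  exact ⟨φ, φ.contMDiff, φ.eventuallyEq_one, hφ⟩

variable {FV : Type*} [NormedAddCommGroup FV] [NormedSpace ℝ FV]
  {V : B → Type*} [TopologicalSpace (TotalSpace FV V)]
  [∀ b, AddCommGroup (V b)] [∀ b, Module ℝ (V b)] [∀ b, TopologicalSpace (V b)]
  [FiberBundle FV V] [VectorBundle ℝ FV V]

/-- A section that is smooth near `b` has the germ at `b` of a globally smooth section. -/
lemma exists_smooth_section_germ (I : ModelWithCorners ℝ EB HB) [IsManifold I ∞ B]
    {b : B} {S : Set B} (hS : S ∈ 𝓝 b) {ι : Type*} {σ : ι → ∀ b, V b}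
    (hσ : ∀ i, ContMDiffOn I (I.prod 𝓘(ℝ, FV)) ∞ (fun b => (⟨b, σ i b⟩ : TotalSpace FV V)) S) :
    ∃ s : ι → ∀ b, V b,
      (∀ i, ContMDiff I (I.prod 𝓘(ℝ, FV)) ∞ (fun b => (⟨b, s i b⟩ : TotalSpace FV V))) ∧
      ∀ᶠ b' in 𝓝 b, ∀ i, s i b' = σ i b' := by
  obtain ⟨O, hOS, hO, hbO⟩ := mem_nhds_iff.1 hS
  obtain ⟨φ, hφ, hφ1, hsupp⟩ := exists_bump I (hO.mem_nhds hbO)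
  refine ⟨fun i => φ • σ i, fun i => ?_, ?_⟩
  · exact ContMDiffOn.smul_section_of_tsupport hφ.contMDiffOn hO hsupp ((hσ i).mono hOS)
  · filter_upwards [hφ1] with b' hb' i
    simp [hb']

/-- Through every element of a vector bundle passes a globally smooth section. -/
lemma exists_smooth_section_through (I : ModelWithCorners ℝ EB HB) [IsManifold I ∞ B]
    [ContMDiffVectorBundle ∞ FV V I] [FiniteDimensional ℝ FV] {b : B} (z : V b) :
    ∃ s : ∀ b, V b, ContMDiff I (I.prod 𝓘(ℝ, FV)) ∞ (fun b => (⟨b, s b⟩ : TotalSpace FV V)) ∧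
      s b = z := by
  set e := trivializationAt FV V b
  have hb : b ∈ e.baseSet := FiberBundle.mem_baseSet_trivializationAt' b
  have hfr := e.isLocalFrameOn_localFrame_baseSet I ∞ (Module.finBasis ℝ FV)
  obtain ⟨s, hs, hsg⟩ := exists_smooth_section_germ I (e.open_baseSet.mem_nhds hb) hfr.contMDiffOn
  refine ⟨fun b' => ∑ i, (hfr.toBasisAt hb).repr z i • s i b', ?_, ?_⟩
  · exact ContMDiff.sum_section fun i _ => (hs i).const_smul_section
  · simp only [hsg.self_of_nhds, ← hfr.toBasisAt_coe hb]
    exact (hfr.toBasisAt hb).sum_repr z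

/-- An additive, function-linear operation on global smooth sections vanishes on every section that
vanishes at the point of evaluation. -/
lemma eq_zero_of_tensorial (I : ModelWithCorners ℝ EB HB) [IsManifold I ∞ B]
    [ContMDiffVectorBundle ∞ FV V I] [FiniteDimensional ℝ FV] {Z : Type*} [AddCommGroup Z]
    [Module ℝ Z] {b : B} (Φ : (∀ b, V b) → Z)
    (hadd : ∀ s s', ContMDiff I (I.prod 𝓘(ℝ, FV)) ∞ (fun b => (⟨b, s b⟩ : TotalSpace FV V)) →
      ContMDiff I (I.prod 𝓘(ℝ, FV)) ∞ (fun b => (⟨b, s' b⟩ : TotalSpace FV V)) →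
      Φ (s + s') = Φ s + Φ s')
    (hsmul : ∀ (f : B → ℝ) (s), ContMDiff I 𝓘(ℝ, ℝ) ∞ f →
      ContMDiff I (I.prod 𝓘(ℝ, FV)) ∞ (fun b => (⟨b, s b⟩ : TotalSpace FV V)) →
      Φ (fun b => f b • s b) = f b • Φ s)
    {s : ∀ b, V b} (hs : ContMDiff I (I.prod 𝓘(ℝ, FV)) ∞ (fun b => (⟨b, s b⟩ : TotalSpace FV V)))
    (h0 : s b = 0) : Φ s = 0 := by
  set e := trivializationAt FV V b
  have hb : b ∈ e.baseSet := FiberBundle.mem_baseSet_trivializationAt' b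
  set β := Module.finBasis ℝ FV
  obtain ⟨φ, hφ, hφ1, hsupp⟩ := exists_bump I (e.open_baseSet.mem_nhds hb)
  have : ContMDiffVectorBundle 1 FV V I := ContMDiffVectorBundle.of_le (n := ∞) (by simp)
  let t : Fin (Module.finrank ℝ FV) → ∀ b, V b := fun i b => φ b • e.localFrame β i b
  let c : Fin (Module.finrank ℝ FV) → B → ℝ := fun i b =>
    φ b * e.localFrameCoeff I β i b (s b)
  have ht : ∀ i, ContMDiff I (I.prod 𝓘(ℝ, FV)) ∞ (fun b => (⟨b, t i b⟩ : TotalSpace FV V)) :=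
    fun i => ContMDiffOn.smul_section_of_tsupport hφ.contMDiffOn e.open_baseSet hsupp
      (e.contMDiffOn_localFrame_baseSet ∞ β i)
  have hc : ∀ i, ContMDiff I 𝓘(ℝ, ℝ) ∞ (c i) := fun i => by
    have h1 : ContMDiffOn I 𝓘(ℝ, ℝ) ∞ (LinearMap.piApply (e.localFrameCoeff I β i) s) e.baseSet :=
      contMDiffOn_localFrameCoeff β e.open_baseSet subset_rfl hs.contMDiffOn i
    refine contMDiff_of_contMDiffOn_union_of_isOpen (hφ.contMDiffOn.mul h1) (t := (tsupport φ)ᶜ)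
      ?_ ?_ e.open_baseSet (isOpen_compl_iff.2 (isClosed_tsupport φ))
    · exact (contMDiffOn_const (c := (0 : ℝ))).congr fun y hy => by
        simp [c, image_eq_zero_of_notMem_tsupport hy]
    · exact Set.compl_subset_iff_union.1 (Set.compl_subset_compl.2 hsupp)
  have hsum : (fun b => (φ b * φ b) • s b) = ∑ i, fun b => c i b • t i b := by
    funext y
    rw [Finset.sum_apply]
    by_cases hy : y ∈ e.baseSet
    · conv_lhs => rw [e.eq_sum_localFrameCoeff_smul (I := I) (b := β) (s := s) hy, Finset.smul_sum]
      refine Finset.sum_congr rfl fun i _ => ?_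
      simp only [c, t, smul_smul]
      ring_nf
    · have : φ y = 0 := image_eq_zero_of_notMem_tsupport fun h => hy (hsupp h)
      simp [c, t, this]
  have hzero : Φ 0 = 0 := by
    have := hsmul (fun _ => 0) s contMDiff_const hs
    simp only [zero_smul] at this
    exact this
  have hfin : ∀ T : Finset (Fin (Module.finrank ℝ FV)),
      ContMDiff I (I.prod 𝓘(ℝ, FV)) ∞
        (fun b => (⟨b, (∑ i ∈ T, fun b => c i b • t i b : ∀ b, V b) b⟩ : TotalSpace FV V)) ∧
      Φ (∑ i ∈ T, fun b => c i b • t i b) = ∑ i ∈ T, c i b • Φ (t i) := by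
    classical
    intro T
    induction T using Finset.induction_on with
    | empty => exact ⟨contMDiff_zeroSection ℝ V, by simpa using hzero⟩
    | insert a T ha ih =>
      have hat : ContMDiff I (I.prod 𝓘(ℝ, FV)) ∞
          (fun b => (⟨b, (fun b => c a b • t a b : ∀ b, V b) b⟩ : TotalSpace FV V)) :=
        (hc a).smul_section (ht a)
      rw [Finset.sum_insert ha, Finset.sum_insert ha]
      refine ⟨hat.add_section ih.1, ?_⟩
      rw [hadd _ _ hat ih.1, ih.2, hsmul _ _ (hc a) (ht a)]
  have h1 := hsmul (fun b => φ b * φ b) s (hφ.mul hφ) hs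
  rw [hsum, (hfin _).2] at h1
  simpa [c, h0, hφ1.self_of_nhds] using h1.symm

end Bump
end

noncomputable section

/-! ### The anchor of a generalized Lie algebroid -/

section Anchor

variable {m : ℕ}
  {M : Type*} [TopologicalSpace M] [ChartedSpace (EuclideanSpace ℝ (Fin m)) M]
  [IsManifold (𝓡 m) ∞ M] [T2Space M]
  {N : Type*} [TopologicalSpace N] [ChartedSpace (EuclideanSpace ℝ (Fin m)) N]
  [IsManifold (𝓡 m) ∞ N] [T2Space N]
  {FF : Type*} [NormedAddCommGroup FF] [NormedSpace ℝ FF] [FiniteDimensional ℝ FF]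
  {F : N → Type*} [TopologicalSpace (TotalSpace FF F)]
  [∀ y, AddCommGroup (F y)] [∀ y, Module ℝ (F y)] [∀ y, TopologicalSpace (F y)]
  [FiberBundle FF F] [VectorBundle ℝ FF F] [ContMDiffVectorBundle ∞ FF F (𝓡 m)]
  {h : M ≃ₘ^∞⟮𝓡 m, 𝓡 m⟯ N} {η : N ≃ₘ^∞⟮𝓡 m, 𝓡 m⟯ M}

/-- A tangent vector that annihilates all smooth functions is zero. -/
lemma eq_zero_of_dirDeriv_eq_zero {y : N} {w : TangentSpace (𝓡 m) y}
    (hw : ∀ f : N → ℝ, ContMDiff (𝓡 m) 𝓘(ℝ, ℝ) ∞ f → dirDeriv (𝓡 m) f y w = 0) : w = 0 := by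
  have hinv := isInvertible_mfderiv_extChartAt (I := 𝓡 m) (mem_extChartAt_source (I := 𝓡 m) y)
  refine hinv.injective (?_ : _ = _)
  rw [map_zero]
  refine (SeparatingDual.eq_zero_iff_forall_dual_eq_zero (R := ℝ)
    (V := EuclideanSpace ℝ (Fin m)) _).2 fun ℓ => ?_
  have hn : (extChartAt (𝓡 m) y).source ∈ 𝓝 y := extChartAt_source_mem_nhds y
  obtain ⟨O, hOS, hO, hyO⟩ := mem_nhds_iff.1 hn
  obtain ⟨φ, hφ, hφ1, hsupp⟩ := exists_bump (𝓡 m) (hO.mem_nhds hyO)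
  have hc : ContMDiffOn (𝓡 m) 𝓘(ℝ, ℝ) ∞ (fun y' => ℓ (extChartAt (𝓡 m) y y')) O :=
    ℓ.contMDiff.comp_contMDiffOn ((contMDiffOn_extChartAt (n := ∞)).mono
      (hOS.trans (by rw [extChartAt_source])))
  have hf : ContMDiff (𝓡 m) 𝓘(ℝ, ℝ) ∞ (fun y' => φ y' * ℓ (extChartAt (𝓡 m) y y')) := by
    refine contMDiff_of_contMDiffOn_union_of_isOpen (hφ.contMDiffOn.mul hc) (t := (tsupport φ)ᶜ)
      ?_ ?_ hO (isOpen_compl_iff.2 (isClosed_tsupport φ))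
    · exact (contMDiffOn_const (c := (0 : ℝ))).congr fun y hy => by
        simp [image_eq_zero_of_notMem_tsupport hy]
    · exact Set.compl_subset_iff_union.1 (Set.compl_subset_compl.2 hsupp)
  have h1 := hw _ hf
  have h2 : (fun y' => φ y' * ℓ (extChartAt (𝓡 m) y y')) =ᶠ[𝓝 y]
      ℓ ∘ extChartAt (𝓡 m) y := by
    filter_upwards [hφ1] with y' hy'
    simp [hy']
  have h3 : MDifferentiableAt (𝓡 m) 𝓘(ℝ, EuclideanSpace ℝ (Fin m)) (extChartAt (𝓡 m) y) y :=
    mdifferentiableAt_extChartAt (mem_chart_source _ y)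
  rw [dirDeriv, h2.mfderiv_eq, mfderiv_comp y ℓ.mdifferentiableAt h3,
    ContinuousLinearMap.mfderiv_eq] at h1
  exact h1

variable (A : GenLieAlgebroid FF F h η)

/-- The bracket is a local operator: this follows from the Leibniz rule for a function which vanishes
at the point and is `1` on the support of the section. -/
lemma GenLieAlgebroid.bracket_eq_zero_of_eventually {u v : Π y, F y} {y : N}
    (hu : IsSmoothSec m FF u) (hv : IsSmoothSec m FF v) (h0 : ∀ᶠ y' in 𝓝 y, u y' = 0) :
    A.bracket u v y = 0 := by
  obtain ⟨φ, hφ, hφ1, hsupp⟩ := exists_bump (𝓡 m) h0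
  have hf : ContMDiff (𝓡 m) 𝓘(ℝ, ℝ) ∞ (fun y => 1 - φ y) := contMDiff_const.sub hφ
  have hu' : (fun y => (1 - φ y) • u y) = u := by
    funext y'
    by_cases hy : y' ∈ tsupport φ
    · have : u y' = 0 := hsupp hy
      simp [this]
    · simp [image_eq_zero_of_notMem_tsupport hy]
  have h1 := congrFun (A.leibniz _ v u hf hv hu) y
  rw [hu'] at h1
  rw [A.bracket_skew v u hv hu, Pi.neg_apply, h1]
  simp [hφ1.self_of_nhds, h0.self_of_nhds]

/-- The anchor vanishes over the points that `h ∘ η` moves: the bracket `[u, f v]` at `h (η y)` sees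
only the germ of `u` there, while the term `θ(u)(f) v` of the Leibniz rule sees `u (y)`. -/
lemma GenLieAlgebroid.ρ_eq_zero {y : N} (hy : h (η y) ≠ y) (z : F y) : A.ρ y z = 0 := by
  rcases subsingleton_or_nontrivial (F (h (η y))) with hF | hF
  · have e1 := (VectorBundle.continuousLinearEquivAt ℝ FF F (h (η y))).toEquiv
    have e2 := (VectorBundle.continuousLinearEquivAt ℝ FF F y).toEquiv
    have : Subsingleton (F y) := (e2.trans e1.symm).subsingleton
    rw [Subsingleton.elim z 0, map_zero]
  obtain ⟨z', hz'⟩ := exists_ne (0 : F (h (η y)))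
  obtain ⟨s, hs, hsz⟩ := exists_smooth_section_through (𝓡 m) (FV := FF) z
  obtain ⟨v, hv, hvz⟩ := exists_smooth_section_through (𝓡 m) (FV := FF) z'
  obtain ⟨φ, hφ, hφ1, hsupp⟩ := exists_bump (𝓡 m) (isOpen_compl_singleton.mem_nhds hy.symm)
  have hu : IsSmoothSec m FF (fun y => φ y • s y) := hφ.smul_section hs
  have hu0 : ∀ᶠ y' in 𝓝 (h (η y)), φ y' • s y' = 0 := by
    have : (tsupport φ)ᶜ ∈ 𝓝 (h (η y)) :=
      (isOpen_compl_iff.2 (isClosed_tsupport φ)).mem_nhds fun hm => hsupp hm rfl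
    filter_upwards [this] with y' hy'
    rw [image_eq_zero_of_notMem_tsupport hy', zero_smul]
  have hpush : pushAnchor h η A.ρ (fun y => φ y • s y) (h (η y)) = 0 := by
    refine eq_zero_of_dirDeriv_eq_zero fun f hf => ?_
    have h1 := congrFun (A.leibniz f _ v hf hu hv) (h (η y))
    have hfv : IsSmoothSec m FF (fun y => f y • v y) := hf.smul_section hv
    rw [A.bracket_eq_zero_of_eventually hu hfv hu0,
      A.bracket_eq_zero_of_eventually hu hv hu0, smul_zero, zero_add, hvz] at h1
    exact (smul_eq_zero.1 h1.symm).resolve_right hz'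
  -- The value at `h (η y)` of the push-forward is computed at `(h ∘ η)⁻¹ (h (η y)) = y`.
  have key : ∀ κ, κ = y →
      mfderiv (𝓡 m) (𝓡 m) h (η κ) (A.ρ κ (φ κ • s κ)) = 0 → A.ρ y z = 0 := by
    rintro κ rfl h1
    rw [hφ1.self_of_nhds, one_smul, hsz] at h1
    rw [← h.mfderivToContinuousLinearEquiv_coe (by simp)] at h1
    exact (map_eq_zero_iff _ (h.mfderivToContinuousLinearEquiv (by simp) _).injective).1 h1
  exact key _ (by simp) hpush

/-- The anchor at `x` is the value at `x` of the smooth vector field `ρ ∘ u ∘ η⁻¹`. -/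
lemma GenLieAlgebroid.anchorAt_eq (u : Π y, F y) (x : M) :
    A.anchorAt x (u (h x)) = (A.ρ (η.symm x) (u (η.symm x)) : EuclideanSpace ℝ (Fin m)) := by
  by_cases hx : η (h x) = x
  · have key : ∀ y, y = h x → (A.ρ (h x) (u (h x)) : EuclideanSpace ℝ (Fin m)) = A.ρ y (u y) := by
      rintro y rfl; rfl
    have e : A.anchorAt x = (A.ρ (h x) : F (h x) →ₗ[ℝ] EuclideanSpace ℝ (Fin m)) := if_pos hx
    rw [e]
    exact key _ (by rw [← η.symm_apply_apply (h x), hx])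
  · have e : A.anchorAt x = 0 := if_neg hx
    rw [e]
    refine (A.ρ_eq_zero (y := η.symm x) (fun h1 => hx ?_) _).symm
    rw [η.apply_symm_apply] at h1
    rw [h1, η.apply_symm_apply]

lemma GenLieAlgebroid.contMDiff_anchorAt {u : Π y, F y} (hu : IsSmoothSec m FF u) :
    ContMDiff (𝓡 m) (𝓡 m).tangent ∞
      (fun x => (⟨x, A.anchorAt x (u (h x))⟩ : TangentBundle (𝓡 m) M)) := by
  have h1 := A.smooth_ρ.comp (hu.comp η.symm.contMDiff)
  have key : ∀ (x x' : M) (w : EuclideanSpace ℝ (Fin m)), x' = x →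
      (⟨x', w⟩ : TangentBundle (𝓡 m) M) = ⟨x, w⟩ := by
    rintro x x' w rfl; rfl
  convert! h1 using 1
  funext x
  rw [A.anchorAt_eq]
  exact (key _ _ _ (η.apply_symm_apply x)).symm

/-- Along `h`, the vector field `Γ(Th ∘ ρ, h ∘ η) u` is the push-forward of the anchor. -/
lemma GenLieAlgebroid.dirDeriv_pushAnchor {f : N → ℝ} (hf : ContMDiff (𝓡 m) 𝓘(ℝ, ℝ) ∞ f)
    (u : Π y, F y) (x : M) :
    dirDeriv (𝓡 m) f (h x) (pushAnchor h η A.ρ u (h x)) =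
      dirDeriv (𝓡 m) (f ∘ h) x (A.anchorAt x (u (h x))) := by
  have h1 : pushAnchor h η A.ρ u (h x) = mfderiv (𝓡 m) (𝓡 m) h x (A.anchorAt x (u (h x))) := by
    rw [A.anchorAt_eq]
    have key : ∀ x' x'' : M, x' = x → x'' = x →
        (mfderiv (𝓡 m) (𝓡 m) h (η (η.symm x')) (A.ρ (η.symm x') (u (η.symm x'))) :
          EuclideanSpace ℝ (Fin m)) =
        mfderiv (𝓡 m) (𝓡 m) h x'' (A.ρ (η.symm x) (u (η.symm x)) : EuclideanSpace ℝ (Fin m)) := by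
      rintro x' x'' rfl rfl
      rw [η.apply_symm_apply]
    exact key _ _ (h.symm_apply_apply x) rfl
  have h2 : MDifferentiableAt (𝓡 m) (𝓡 m) h x := h.contMDiff.mdifferentiable (by simp) x
  rw [h1, dirDeriv, dirDeriv, mfderiv_comp x (hf.mdifferentiable (by simp) _) h2]
  rfl

end Anchor
end

noncomputable section

/-! ### Smooth sections of the generalized tangent bundle -/

section SmoothGT

variable {m : ℕ}
  {M : Type*} [TopologicalSpace M] [ChartedSpace (EuclideanSpace ℝ (Fin m)) M]
  [IsManifold (𝓡 m) ∞ M] [T2Space M]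
  {N : Type*} [TopologicalSpace N] [ChartedSpace (EuclideanSpace ℝ (Fin m)) N]
  [IsManifold (𝓡 m) ∞ N] [T2Space N]
  {FF : Type*} [NormedAddCommGroup FF] [NormedSpace ℝ FF] [FiniteDimensional ℝ FF]
  {F : N → Type*} [TopologicalSpace (TotalSpace FF F)]
  [∀ y, AddCommGroup (F y)] [∀ y, Module ℝ (F y)] [∀ y, TopologicalSpace (F y)]
  [FiberBundle FF F] [VectorBundle ℝ FF F] [ContMDiffVectorBundle ∞ FF F (𝓡 m)]
  {h : M ≃ₘ^∞⟮𝓡 m, 𝓡 m⟯ N} {η : N ≃ₘ^∞⟮𝓡 m, 𝓡 m⟯ M}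
variable {FW : Type*} [NormedAddCommGroup FW] [NormedSpace ℝ FW] [FiniteDimensional ℝ FW]
  {W : M → Type*} [TopologicalSpace (TotalSpace FW W)]
  [∀ x, AddCommGroup (W x)] [∀ x, Module ℝ (W x)] [∀ x, TopologicalSpace (W x)]
  [FiberBundle FW W] [VectorBundle ℝ FW W] [ContMDiffVectorBundle ∞ FW W (𝓡 m)]
  {A : GenLieAlgebroid FF F h η}

variable (A) in
/-- Smoothness at a point of a section of the generalized tangent bundle. -/
def GenLieAlgebroid.SmoothGTAt (X : Π u : TotalSpace FW W, A.GT u) (u₀ : TotalSpace FW W) : Prop :=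
  ContMDiffAt ((𝓡 m).prod 𝓘(ℝ, FW)) ((𝓡 m).prod 𝓘(ℝ, FF)) ∞
    (fun u => (⟨h u.proj, A.pr u (X u)⟩ : TotalSpace FF F)) u₀ ∧
  ContMDiffAt ((𝓡 m).prod 𝓘(ℝ, FW)) ((𝓡 m).prod 𝓘(ℝ, FW)).tangent ∞
    (fun u => (⟨u, A.anchor u (X u)⟩ : TangentBundle ((𝓡 m).prod 𝓘(ℝ, FW)) (TotalSpace FW W))) u₀

lemma GenLieAlgebroid.SmoothGT.smoothGTAt {X : Π u : TotalSpace FW W, A.GT u} (hX : A.SmoothGT X)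
    (u : TotalSpace FW W) : A.SmoothGTAt X u :=
  ⟨hX.1 u, hX.2 u⟩

lemma GenLieAlgebroid.smoothGT_of_smoothGTAt {X : Π u : TotalSpace FW W, A.GT u}
    (hX : ∀ u, A.SmoothGTAt X u) : A.SmoothGT X :=
  ⟨fun u => (hX u).1, fun u => (hX u).2⟩

variable {X Y : Π u : TotalSpace FW W, A.GT u} {u₀ : TotalSpace FW W}

lemma GenLieAlgebroid.SmoothGTAt.congr (hX : A.SmoothGTAt X u₀) (hXY : ∀ᶠ u in 𝓝 u₀, Y u = X u) :
    A.SmoothGTAt Y u₀ :=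
  ⟨hX.1.congr_of_eventuallyEq (hXY.mono fun u hu => by simp only [hu]),
    hX.2.congr_of_eventuallyEq (hXY.mono fun u hu => by simp only [hu])⟩

lemma GenLieAlgebroid.SmoothGTAt.add (hX : A.SmoothGTAt X u₀) (hY : A.SmoothGTAt Y u₀) :
    A.SmoothGTAt (X + Y) u₀ :=
  ⟨hX.1.add_along hY.1, hX.2.add_along hY.2⟩

lemma GenLieAlgebroid.SmoothGTAt.smul {f : TotalSpace FW W → ℝ}
    (hf : ContMDiffAt ((𝓡 m).prod 𝓘(ℝ, FW)) 𝓘(ℝ, ℝ) ∞ f u₀) (hX : A.SmoothGTAt X u₀) :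
    A.SmoothGTAt (fun u => f u • X u) u₀ :=
  ⟨hf.smul_along hX.1, hf.smul_along hX.2⟩

variable (A) in
lemma GenLieAlgebroid.smoothGT_zero : A.SmoothGT (0 : Π u : TotalSpace FW W, A.GT u) :=
  ⟨fun _ => ContMDiffAt.zero_along (h.contMDiff.comp (contMDiff_proj W)).contMDiffAt,
    fun _ => ContMDiffAt.zero_along contMDiffAt_id⟩

lemma GenLieAlgebroid.SmoothGTAt.sum {ι : Type*} {T : Finset ι}
    {X : ι → Π u : TotalSpace FW W, A.GT u} (hX : ∀ i ∈ T, A.SmoothGTAt (X i) u₀) :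
    A.SmoothGTAt (∑ i ∈ T, X i) u₀ := by
  classical
  induction T using Finset.induction_on with
  | empty => exact A.smoothGT_zero.smoothGTAt u₀
  | insert a T ha ih =>
    rw [Finset.sum_insert ha]
    exact (hX a (Finset.mem_insert_self a T)).add
      (ih fun i hi => hX i (Finset.mem_insert_of_mem hi))

lemma GenLieAlgebroid.SmoothGT.add (hX : A.SmoothGT X) (hY : A.SmoothGT Y) : A.SmoothGT (X + Y) :=
  A.smoothGT_of_smoothGTAt fun u => (hX.smoothGTAt u).add (hY.smoothGTAt u)

lemma GenLieAlgebroid.SmoothGT.smul {f : TotalSpace FW W → ℝ}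
    (hf : ContMDiff ((𝓡 m).prod 𝓘(ℝ, FW)) 𝓘(ℝ, ℝ) ∞ f) (hX : A.SmoothGT X) :
    A.SmoothGT (fun u => f u • X u) :=
  A.smoothGT_of_smoothGTAt fun u => (hX.smoothGTAt u).smul (hf u)

lemma GenLieAlgebroid.SmoothGT.neg (hX : A.SmoothGT X) : A.SmoothGT (-X) := by
  convert! hX.smul (f := fun _ => -1) contMDiff_const using 1
  funext u
  exact (neg_one_smul ℝ (X u)).symm

lemma GenLieAlgebroid.SmoothGT.sub (hX : A.SmoothGT X) (hY : A.SmoothGT Y) : A.SmoothGT (X - Y) :=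
  sub_eq_add_neg X Y ▸ hX.add hY.neg

lemma GenLieAlgebroid.SmoothGT.sum {ι : Type*} {T : Finset ι}
    {X : ι → Π u : TotalSpace FW W, A.GT u} (hX : ∀ i ∈ T, A.SmoothGT (X i)) :
    A.SmoothGT (∑ i ∈ T, X i) :=
  A.smoothGT_of_smoothGTAt fun u => .sum fun i hi => (hX i hi).smoothGTAt u

end SmoothGT

/-! ### Vertical lifts -/

section Vertical

variable {m : ℕ}
  {M : Type*} [TopologicalSpace M] [ChartedSpace (EuclideanSpace ℝ (Fin m)) M]
  [IsManifold (𝓡 m) ∞ M] [T2Space M]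
  {N : Type*} [TopologicalSpace N] [ChartedSpace (EuclideanSpace ℝ (Fin m)) N]
  [IsManifold (𝓡 m) ∞ N] [T2Space N]
  {FF : Type*} [NormedAddCommGroup FF] [NormedSpace ℝ FF] [FiniteDimensional ℝ FF]
  {F : N → Type*} [TopologicalSpace (TotalSpace FF F)]
  [∀ y, AddCommGroup (F y)] [∀ y, Module ℝ (F y)] [∀ y, TopologicalSpace (F y)]
  [FiberBundle FF F] [VectorBundle ℝ FF F] [ContMDiffVectorBundle ∞ FF F (𝓡 m)]
  {h : M ≃ₘ^∞⟮𝓡 m, 𝓡 m⟯ N} {η : N ≃ₘ^∞⟮𝓡 m, 𝓡 m⟯ M}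
variable {FW : Type*} [NormedAddCommGroup FW] [NormedSpace ℝ FW] [FiniteDimensional ℝ FW]
  {W : M → Type*} [TopologicalSpace (TotalSpace FW W)]
  [∀ x, AddCommGroup (W x)] [∀ x, Module ℝ (W x)] [∀ x, TopologicalSpace (W x)]
  [FiberBundle FW W] [VectorBundle ℝ FW W] [ContMDiffVectorBundle ∞ FW W (𝓡 m)]
  {A : GenLieAlgebroid FF F h η}

/-- The inclusion of a fibre of `W` into the total space, written in the trivialization at the base
point, is differentiable. -/
lemma hasMFDerivAt_fibre_incl (u : TotalSpace FW W) :
    HasMFDerivAt 𝓘(ℝ, FW) ((𝓡 m).prod 𝓘(ℝ, FW))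
      (fun v : FW => (trivializationAt FW W u.proj).toOpenPartialHomeomorph.symm (u.proj, v))
      (trivializationAt FW W u.proj u).2
      (mfderiv 𝓘(ℝ, FW) ((𝓡 m).prod 𝓘(ℝ, FW))
        (fun v : FW => (trivializationAt FW W u.proj).toOpenPartialHomeomorph.symm (u.proj, v))
        (trivializationAt FW W u.proj u).2) := by
  have hu : u.proj ∈ (trivializationAt FW W u.proj).baseSet :=
    FiberBundle.mem_baseSet_trivializationAt' u.proj
  set e := trivializationAt FW W u.proj
  refine MDifferentiableAt.hasMFDerivAt (ContMDiffAt.mdifferentiableAt (n := ∞) ?_ (by simp))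
  refine ((e.contMDiffOn_symm (n := ∞) (IB := 𝓡 m)).contMDiffAt
    (e.open_target.mem_nhds (e.mem_target.2 hu))).comp _ ?_
  exact contMDiffAt_const.prodMk contMDiffAt_id

/-- The vertical lift is the derivative of the inclusion of the fibre; this makes its linearity
visible. -/
lemma vertLift_eq (u : TotalSpace FW W) (z : W u.proj) :
    vertLift u z = (mfderiv 𝓘(ℝ, FW) ((𝓡 m).prod 𝓘(ℝ, FW))
      (fun v : FW => (trivializationAt FW W u.proj).toOpenPartialHomeomorph.symm (u.proj, v))
      (trivializationAt FW W u.proj u).2 (trivializationAt FW W u.proj ⟨u.proj, z⟩).2 :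
        EuclideanSpace ℝ (Fin m) × FW) := by
  have hu : u.proj ∈ (trivializationAt FW W u.proj).baseSet :=
    FiberBundle.mem_baseSet_trivializationAt' u.proj
  have hΨ := hasMFDerivAt_fibre_incl (m := m) u
  set e := trivializationAt FW W u.proj
  have hlin := e.linear ℝ hu
  let f : ℝ → FW := fun s => (e u).2 + s • (e ⟨u.proj, z⟩).2
  have hf : HasMFDerivAt 𝓘(ℝ, ℝ) 𝓘(ℝ, FW) f 0
      (ContinuousLinearMap.toSpanSingleton ℝ (e ⟨u.proj, z⟩).2) := by
    refine HasFDerivAt.hasMFDerivAt ?_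
    exact (((hasDerivAt_id (0 : ℝ)).smul_const (e ⟨u.proj, z⟩).2).const_add
      (e u).2).hasFDerivAt.congr_fderiv (by rw [one_smul]; rfl)
  have hf0 : f 0 = (e u).2 := by simp [f]
  rw [← hf0] at hΨ
  have hc := hΨ.comp 0 hf
  have heq : (fun v : FW => e.toOpenPartialHomeomorph.symm (u.proj, v)) ∘ f =
      fun s : ℝ => (⟨u.proj, u.snd + s • z⟩ : TotalSpace FW W) := by
    funext s
    have h1 : (u.proj, f s) = e ⟨u.proj, u.snd + s • z⟩ := by
      refine Prod.ext (e.coe_fst'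
        (show (⟨u.proj, u.snd + s • z⟩ : TotalSpace FW W).proj ∈ e.baseSet from hu)).symm ?_
      change f s = (e ⟨u.proj, u.snd + s • z⟩).2
      rw [hlin.map_add, hlin.map_smul]
    change e.toOpenPartialHomeomorph.symm (u.proj, f s) = _
    rw [h1]
    exact e.toOpenPartialHomeomorph.left_inv (e.mem_source.2 hu)
  rw [heq] at hc
  rw [vertLift, hc.mfderiv]
  change mfderiv 𝓘(ℝ, FW) ((𝓡 m).prod 𝓘(ℝ, FW)) _ (f 0)
    ((ContinuousLinearMap.toSpanSingleton ℝ (e ⟨u.proj, z⟩).2) (1 : ℝ)) = _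
  rw [ContinuousLinearMap.toSpanSingleton_apply, one_smul, hf0]

/-- The vertical lift as a linear map. -/
def vertLiftₗ (u : TotalSpace FW W) :
    W u.proj →ₗ[ℝ] TangentSpace ((𝓡 m).prod 𝓘(ℝ, FW)) u where
  toFun := vertLift u
  map_add' z z' := by
    have hlin := (trivializationAt FW W u.proj).linear ℝ
      (FiberBundle.mem_baseSet_trivializationAt' u.proj)
    simp only [vertLift_eq, hlin.map_add]
    exact map_add (mfderiv 𝓘(ℝ, FW) ((𝓡 m).prod 𝓘(ℝ, FW))
      (fun v : FW => (trivializationAt FW W u.proj).toOpenPartialHomeomorph.symm (u.proj, v))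
      (trivializationAt FW W u.proj u).2) _ _
  map_smul' c z := by
    have hlin := (trivializationAt FW W u.proj).linear ℝ
      (FiberBundle.mem_baseSet_trivializationAt' u.proj)
    simp only [vertLift_eq, hlin.map_smul]
    exact map_smul (mfderiv 𝓘(ℝ, FW) ((𝓡 m).prod 𝓘(ℝ, FW))
      (fun v : FW => (trivializationAt FW W u.proj).toOpenPartialHomeomorph.symm (u.proj, v))
      (trivializationAt FW W u.proj u).2) _ _

end Vertical
end

noncomputable section

/-! ### The vertical subbundle -/

section VerticalKernel

variable {m : ℕ}
  {M : Type*} [TopologicalSpace M] [ChartedSpace (EuclideanSpace ℝ (Fin m)) M]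
  [IsManifold (𝓡 m) ∞ M] [T2Space M]
  {N : Type*} [TopologicalSpace N] [ChartedSpace (EuclideanSpace ℝ (Fin m)) N]
  [IsManifold (𝓡 m) ∞ N] [T2Space N]
  {FF : Type*} [NormedAddCommGroup FF] [NormedSpace ℝ FF] [FiniteDimensional ℝ FF]
  {F : N → Type*} [TopologicalSpace (TotalSpace FF F)]
  [∀ y, AddCommGroup (F y)] [∀ y, Module ℝ (F y)] [∀ y, TopologicalSpace (F y)]
  [FiberBundle FF F] [VectorBundle ℝ FF F] [ContMDiffVectorBundle ∞ FF F (𝓡 m)]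
  {h : M ≃ₘ^∞⟮𝓡 m, 𝓡 m⟯ N} {η : N ≃ₘ^∞⟮𝓡 m, 𝓡 m⟯ M}
variable {FW : Type*} [NormedAddCommGroup FW] [NormedSpace ℝ FW] [FiniteDimensional ℝ FW]
  {W : M → Type*} [TopologicalSpace (TotalSpace FW W)]
  [∀ x, AddCommGroup (W x)] [∀ x, Module ℝ (W x)] [∀ x, TopologicalSpace (W x)]
  [FiberBundle FW W] [VectorBundle ℝ FW W] [ContMDiffVectorBundle ∞ FW W (𝓡 m)]
  {A : GenLieAlgebroid FF F h η}

lemma vertLift_injective (u : TotalSpace FW W) :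
    Function.Injective (vertLift (m := m) u : W u.proj → _) := by
  have hu : u.proj ∈ (trivializationAt FW W u.proj).baseSet :=
    FiberBundle.mem_baseSet_trivializationAt' u.proj
  have hΨ := hasMFDerivAt_fibre_incl (m := m) u
  set e := trivializationAt FW W u.proj with he
  have hus : u ∈ e.source := e.mem_source.2 hu
  have hΨu : e.toOpenPartialHomeomorph.symm (u.proj, (e u).2) = u := by
    have : (u.proj, (e u).2) = e u := Prod.ext (e.coe_fst hus).symm rfl
    rw [this]
    exact e.toOpenPartialHomeomorph.left_inv hus
  have hp : MDifferentiableAt ((𝓡 m).prod 𝓘(ℝ, FW)) 𝓘(ℝ, FW)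
      (fun u' : TotalSpace FW W => (e u').2)
      (e.toOpenPartialHomeomorph.symm (u.proj, (e u).2)) := by
    rw [hΨu]
    exact (((e.contMDiffOn (n := ∞) (IB := 𝓡 m)).contMDiffAt
      (e.open_source.mem_nhds hus)).snd).mdifferentiableAt (by simp)
  have hcomp := HasMFDerivAt.comp
    (f := fun v : FW => e.toOpenPartialHomeomorph.symm (u.proj, v)) (e u).2 hp.hasMFDerivAt hΨ
  have hid : (fun u' : TotalSpace FW W => (e u').2) ∘
      (fun v : FW => e.toOpenPartialHomeomorph.symm (u.proj, v)) = id := by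
    funext v
    have : e (e.toOpenPartialHomeomorph.symm (u.proj, v)) = (u.proj, v) :=
      e.toOpenPartialHomeomorph.right_inv (e.mem_target.2 hu)
    simp [this]
  rw [hid] at hcomp
  have huniq := hasMFDerivAt_unique hcomp (hasMFDerivAt_id (I := 𝓘(ℝ, FW)) (e u).2)
  intro z z' hzz
  rw [vertLift_eq, vertLift_eq] at hzz
  have h1 := DFunLike.congr_fun huniq (e ⟨u.proj, z⟩).2
  have h2 := DFunLike.congr_fun huniq (e ⟨u.proj, z'⟩).2
  have h3 : (e ⟨u.proj, z⟩).2 = (e ⟨u.proj, z'⟩).2 := by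
    refine h1.symm.trans (Eq.trans ?_ h2)
    exact congrArg (mfderiv ((𝓡 m).prod 𝓘(ℝ, FW)) 𝓘(ℝ, FW)
      (fun u' : TotalSpace FW W => (e u').2)
      (e.toOpenPartialHomeomorph.symm (u.proj, (e u).2))) hzz
  exact (e.continuousLinearEquivAt ℝ u.proj hu).injective h3

/-- Every tangent vector of the total space that projects to zero is a vertical lift. -/
lemma exists_vertLift_eq (u : TotalSpace FW W) (w : TangentSpace ((𝓡 m).prod 𝓘(ℝ, FW)) u)
    (hw : mfderiv ((𝓡 m).prod 𝓘(ℝ, FW)) (𝓡 m) (π FW W) u w = 0) : ∃ z, vertLift u z = w := by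
  have hu : u.proj ∈ (trivializationAt FW W u.proj).baseSet :=
    FiberBundle.mem_baseSet_trivializationAt' u.proj
  set e := trivializationAt FW W u.proj with he
  have hus : u ∈ e.source := e.mem_source.2 hu
  have hp : MDifferentiableAt ((𝓡 m).prod 𝓘(ℝ, FW)) 𝓘(ℝ, FW)
      (fun u' : TotalSpace FW W => (e u').2) u :=
    (((e.contMDiffOn (n := ∞) (IB := 𝓡 m)).contMDiffAt
      (e.open_source.mem_nhds hus)).snd).mdifferentiableAt (by simp)
  have hπ : MDifferentiableAt ((𝓡 m).prod 𝓘(ℝ, FW)) (𝓡 m) (π FW W) u :=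
    (contMDiffAt_proj W (n := ∞)).mdifferentiableAt (by simp)
  have hΨ : MDifferentiableAt ((𝓡 m).prod 𝓘(ℝ, FW)) ((𝓡 m).prod 𝓘(ℝ, FW))
      e.toOpenPartialHomeomorph.symm (u.proj, (e u).2) :=
    ((e.contMDiffOn_symm (n := ∞) (IB := 𝓡 m)).contMDiffAt
      (e.open_target.mem_nhds (e.mem_target.2 hu))).mdifferentiableAt (by simp)
  have hcomp := HasMFDerivAt.comp (f := fun u' : TotalSpace FW W => (u'.proj, (e u').2)) u
    hΨ.hasMFDerivAt (hπ.hasMFDerivAt.prodMk hp.hasMFDerivAt)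
  have hid : e.toOpenPartialHomeomorph.symm ∘
      (fun u' : TotalSpace FW W => (u'.proj, (e u').2)) =ᶠ[𝓝 u] id := by
    filter_upwards [e.open_source.mem_nhds hus] with u' hu'
    have : (u'.proj, (e u').2) = e u' := Prod.ext (e.coe_fst hu').symm rfl
    simp only [Function.comp_apply, this]
    exact e.toOpenPartialHomeomorph.left_inv hu'
  have huniq := hasMFDerivAt_unique (hcomp.congr_of_eventuallyEq hid.symm) (hasMFDerivAt_id u)
  set v : FW := mfderiv ((𝓡 m).prod 𝓘(ℝ, FW)) 𝓘(ℝ, FW)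
    (fun u' : TotalSpace FW W => (e u').2) u w with hv
  refine ⟨(e.continuousLinearEquivAt ℝ u.proj hu).symm v, ?_⟩
  have h2 : (e ⟨u.proj, (e.continuousLinearEquivAt ℝ u.proj hu).symm v⟩).2 = v :=
    (e.continuousLinearEquivAt ℝ u.proj hu).apply_symm_apply v
  have h1 := DFunLike.congr_fun huniq w
  rw [vertLift_eq, ← he, h2]
  refine Eq.trans ?_ h1
  have h3 := mfderiv_prod_eq_add_apply (v := (((0 : EuclideanSpace ℝ (Fin m)), v) :
    TangentSpace ((𝓡 m).prod 𝓘(ℝ, FW)) (u.proj, (e u).2))) hΨ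
  have h4 : (mfderiv ((𝓡 m).prod 𝓘(ℝ, FW)) ((𝓡 m).prod 𝓘(ℝ, FW))
      e.toOpenPartialHomeomorph.symm (u.proj, (e u).2)
      ((0 : EuclideanSpace ℝ (Fin m)), v) : EuclideanSpace ℝ (Fin m) × FW) =
      mfderiv 𝓘(ℝ, FW) ((𝓡 m).prod 𝓘(ℝ, FW))
      (fun v : FW => e.toOpenPartialHomeomorph.symm (u.proj, v)) (e u).2 v := by
    refine h3.trans ?_
    dsimp only
    erw [map_zero, zero_add]
  refine h4.symm.trans ?_
  have h5 : (((mfderiv ((𝓡 m).prod 𝓘(ℝ, FW)) (𝓡 m) (π FW W) u).prod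
      (mfderiv ((𝓡 m).prod 𝓘(ℝ, FW)) 𝓘(ℝ, FW) (fun u' : TotalSpace FW W => (e u').2) u)) w :
      EuclideanSpace ℝ (Fin m) × FW) = (0, v) := Prod.ext hw hv.symm
  exact congrArg (mfderiv ((𝓡 m).prod 𝓘(ℝ, FW)) ((𝓡 m).prod 𝓘(ℝ, FW))
      e.toOpenPartialHomeomorph.symm (u.proj, (e u).2)) h5.symm

variable (A) in
/-- The vertical elements `0 ⊕ (vertical lift)`, as a linear map. -/
def GenLieAlgebroid.dotₗ (u : TotalSpace FW W) : W u.proj →ₗ[ℝ] A.GT u where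
  toFun := A.dot u
  map_add' z z' := Subtype.ext <| Prod.ext (add_zero (0 : F (h u.proj))).symm
    (map_add (vertLiftₗ (m := m) u) z z')
  map_smul' c z := Subtype.ext <| Prod.ext (smul_zero c : c • (0 : F (h u.proj)) = 0).symm
    (map_smul (vertLiftₗ (m := m) u) c z)

variable (A) in
lemma GenLieAlgebroid.dotₗ_injective (u : TotalSpace FW W) : Function.Injective (A.dotₗ u) := by
  intro z z' hzz
  have h1 : A.anchor u (A.dot u z) = A.anchor u (A.dot u z') := congrArg (A.anchor u) hzz
  exact vertLift_injective u h1

variable (A) in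
lemma GenLieAlgebroid.dot_mem_vert (u : TotalSpace FW W) (z : W u.proj) :
    A.dot u z ∈ A.vert u :=
  LinearMap.mem_ker.2 rfl

variable (A) in
lemma GenLieAlgebroid.range_dotₗ (u : TotalSpace FW W) :
    LinearMap.range (A.dotₗ u) = A.vert u := by
  refine le_antisymm ?_ fun X hX => ?_
  · rintro _ ⟨z, rfl⟩
    exact A.dot_mem_vert u z
  · have h0 : X.1.1 = 0 := LinearMap.mem_ker.1 hX
    have h1 := GenLieAlgebroid.mem_GT.1 X.2
    rw [h0, map_zero] at h1
    obtain ⟨z, hz⟩ := exists_vertLift_eq u _ h1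
    exact ⟨z, Subtype.ext <| Prod.ext h0.symm hz⟩

variable (A) in
/-- Vertical lifts of smooth sections are smooth: they are derivatives, at `t = 0`, of a smooth family
of curves `t ↦ u + t s`. -/
lemma GenLieAlgebroid.smoothGT_dot {s : Π x, W x} (hs : IsSmoothSec m FW s) :
    A.SmoothGT (fun u : TotalSpace FW W => A.dotₗ u (s u.proj)) := by
  refine ⟨fun _ => ContMDiffAt.zero_along (h.contMDiff.comp (contMDiff_proj W)).contMDiffAt,
    fun u => ?_⟩
  have hw : ContMDiffAt ((𝓡 m).prod 𝓘(ℝ, FW)) 𝓘(ℝ, ℝ).tangent ∞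
      (fun _ : TotalSpace FW W => (⟨0, (1 : ℝ)⟩ : TangentBundle 𝓘(ℝ, ℝ) ℝ)) u := contMDiffAt_const
  have hf : ContMDiffAt (((𝓡 m).prod 𝓘(ℝ, FW)).prod 𝓘(ℝ, ℝ)) ((𝓡 m).prod 𝓘(ℝ, FW)) ∞
      (fun p : TotalSpace FW W × ℝ =>
        (⟨p.1.proj, p.1.snd + p.2 • s p.1.proj⟩ : TotalSpace FW W)) (u, 0) :=
    ContMDiffAt.add_along contMDiffAt_fst (ContMDiffAt.smul_along contMDiffAt_snd
      ((hs.comp ((contMDiff_proj W).comp contMDiff_fst)).contMDiffAt))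
  have h1 := ContMDiffAt.mfderiv_apply_along
    (fun (u : TotalSpace FW W) (t : ℝ) => (⟨u.proj, u.snd + t • s u.proj⟩ : TotalSpace FW W))
    (fun _ => 0) (fun _ => (1 : ℝ)) hf hw
  convert! h1 using 1
  funext u'
  have key : ∀ (v v' : TotalSpace FW W) (w : EuclideanSpace ℝ (Fin m) × FW), v = v' →
      (⟨v, w⟩ : TangentBundle ((𝓡 m).prod 𝓘(ℝ, FW)) (TotalSpace FW W)) = ⟨v', w⟩ := by
    rintro v v' w rfl; rfl
  refine key _ _ _ ?_
  simp

end VerticalKernel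

/-! ### Horizontal lifts -/

section Horizontal

variable {m : ℕ}
  {M : Type*} [TopologicalSpace M] [ChartedSpace (EuclideanSpace ℝ (Fin m)) M]
  [IsManifold (𝓡 m) ∞ M] [T2Space M]
  {N : Type*} [TopologicalSpace N] [ChartedSpace (EuclideanSpace ℝ (Fin m)) N]
  [IsManifold (𝓡 m) ∞ N] [T2Space N]
  {FF : Type*} [NormedAddCommGroup FF] [NormedSpace ℝ FF] [FiniteDimensional ℝ FF]
  {F : N → Type*} [TopologicalSpace (TotalSpace FF F)]
  [∀ y, AddCommGroup (F y)] [∀ y, Module ℝ (F y)] [∀ y, TopologicalSpace (F y)]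
  [FiberBundle FF F] [VectorBundle ℝ FF F] [ContMDiffVectorBundle ∞ FF F (𝓡 m)]
  {h : M ≃ₘ^∞⟮𝓡 m, 𝓡 m⟯ N} {η : N ≃ₘ^∞⟮𝓡 m, 𝓡 m⟯ M}
variable {FW : Type*} [NormedAddCommGroup FW] [NormedSpace ℝ FW] [FiniteDimensional ℝ FW]
  {W : M → Type*} [TopologicalSpace (TotalSpace FW W)]
  [∀ x, AddCommGroup (W x)] [∀ x, Module ℝ (W x)] [∀ x, TopologicalSpace (W x)]
  [FiberBundle FW W] [VectorBundle ℝ FW W] [ContMDiffVectorBundle ∞ FW W (𝓡 m)]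
  {A : GenLieAlgebroid FF F h η}
variable (C : RhoConnection FW W A)

lemma RhoConnection.eq_of_pr_eq {u : TotalSpace FW W} {X Y : A.GT u} (hp : A.pr u X = A.pr u Y)
    (hΓ : C.Γ u X = C.Γ u Y) : X = Y := by
  have h1 : X - Y ∈ A.vert u := by
    rw [GenLieAlgebroid.vert, LinearMap.mem_ker, map_sub, hp, sub_self]
  have h2 := C.split u _ h1
  rw [map_sub, hΓ, sub_self] at h2
  exact sub_eq_zero.1 h2.symm

/-- The horizontal lift as a linear map. -/
def RhoConnection.liftₗ (u : TotalSpace FW W) : F (h u.proj) →ₗ[ℝ] A.GT u where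
  toFun := C.lift u
  map_add' z z' := C.eq_of_pr_eq (by simp only [map_add, (C.lift_spec u _).1])
    (by simp only [map_add, (C.lift_spec u _).2, add_zero])
  map_smul' c z := C.eq_of_pr_eq (by simp only [map_smul, (C.lift_spec u _).1, RingHom.id_apply])
    (by simp only [map_smul, (C.lift_spec u _).2, smul_zero, RingHom.id_apply])

lemma RhoConnection.liftₗ_apply (u : TotalSpace FW W) (z : F (h u.proj)) :
    C.liftₗ u z = C.lift u z := rfl

/-- The horizontal projection is the horizontal lift of the projection to `F`. -/
lemma RhoConnection.lift_pr (u : TotalSpace FW W) (X : A.GT u) :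
    C.liftₗ u (A.pr u X) = X - C.Γ u X := by
  have h1 : A.pr u (C.Γ u X) = 0 := C.mem_vert u X
  refine C.eq_of_pr_eq ?_ ?_
  · rw [liftₗ_apply, (C.lift_spec u _).1, map_sub, h1, sub_zero]
  · rw [liftₗ_apply, (C.lift_spec u _).2, map_sub, C.split u _ (C.mem_vert u X), sub_self]

/-- Horizontal lifts of smooth sections are smooth: a local trivialization provides some smooth lift
`Y`, and `Y - Γ Y` is the horizontal one. -/
lemma RhoConnection.smoothGT_lift {s : Π y, F y} (hs : IsSmoothSec m FF s) :
    A.SmoothGT (fun u : TotalSpace FW W => C.liftₗ u (s (h u.proj))) := by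
  refine A.smoothGT_of_smoothGTAt fun u₀ => ?_
  have hu₀ : u₀.proj ∈ (trivializationAt FW W u₀.proj).baseSet :=
    FiberBundle.mem_baseSet_trivializationAt' u₀.proj
  set e := trivializationAt FW W u₀.proj with he
  have hus₀ : u₀ ∈ e.source := e.mem_source.2 hu₀
  have hΨu : ∀ u ∈ e.source, e.toOpenPartialHomeomorph.symm (u.proj, (e u).2) = u := by
    intro u hus
    have : (u.proj, (e u).2) = e u := Prod.ext (e.coe_fst hus).symm rfl
    rw [this]
    exact e.toOpenPartialHomeomorph.left_inv hus
  have hΨ : ∀ u ∈ e.source, ContMDiffAt ((𝓡 m).prod 𝓘(ℝ, FW)) ((𝓡 m).prod 𝓘(ℝ, FW)) ∞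
      e.toOpenPartialHomeomorph.symm (u.proj, (e u).2) := fun u hus =>
    (e.contMDiffOn_symm (n := ∞) (IB := 𝓡 m)).contMDiffAt
      (e.open_target.mem_nhds (e.mem_target.2 (e.mem_source.1 hus)))
  -- The lift of the anchor that is constant in the trivialization `e`.
  let w : ∀ u : TotalSpace FW W, EuclideanSpace ℝ (Fin m) × FW := fun u =>
    mfderiv (𝓡 m) ((𝓡 m).prod 𝓘(ℝ, FW))
      (fun x => e.toOpenPartialHomeomorph.symm (x, (e u).2)) u.proj
      (A.anchorAt u.proj (s (h u.proj)))
  have hmem : ∀ u ∈ e.source, ((s (h u.proj), w u) :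
      F (h u.proj) × TangentSpace ((𝓡 m).prod 𝓘(ℝ, FW)) u) ∈ A.GT u := by
    intro u hus
    refine GenLieAlgebroid.mem_GT.2 ?_
    have h1 : MDifferentiableAt (𝓡 m) ((𝓡 m).prod 𝓘(ℝ, FW))
        (fun x => e.toOpenPartialHomeomorph.symm (x, (e u).2)) u.proj :=
      ((hΨ u hus).comp u.proj (contMDiffAt_id.prodMk contMDiffAt_const)).mdifferentiableAt
        (by simp)
    have h2 : MDifferentiableAt ((𝓡 m).prod 𝓘(ℝ, FW)) (𝓡 m) (π FW W)
        (e.toOpenPartialHomeomorph.symm (u.proj, (e u).2)) :=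
      (contMDiffAt_proj W (n := ∞)).mdifferentiableAt (by simp)
    have h3 := h2.hasMFDerivAt.comp u.proj h1.hasMFDerivAt
    have h4 : (π FW W) ∘ (fun x => e.toOpenPartialHomeomorph.symm (x, (e u).2))
        =ᶠ[𝓝 u.proj] id := by
      filter_upwards [e.open_baseSet.mem_nhds (e.mem_source.1 hus)] with x hx
      exact e.proj_symm_apply (e.mem_target.2 hx)
    have h5 := hasMFDerivAt_unique (h3.congr_of_eventuallyEq h4.symm) (hasMFDerivAt_id u.proj)
    have h6 := DFunLike.congr_fun h5 (A.anchorAt u.proj (s (h u.proj)))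
    have key : ∀ v, v = u → ∀ w : EuclideanSpace ℝ (Fin m) × FW,
        (mfderiv ((𝓡 m).prod 𝓘(ℝ, FW)) (𝓡 m) (π FW W) v w : EuclideanSpace ℝ (Fin m)) =
        mfderiv ((𝓡 m).prod 𝓘(ℝ, FW)) (𝓡 m) (π FW W) u w := by
      rintro v rfl w; rfl
    exact (key _ (hΨu u hus) (w u)).symm.trans h6
  have hw : ∀ u ∈ e.source, ContMDiffAt ((𝓡 m).prod 𝓘(ℝ, FW)) ((𝓡 m).prod 𝓘(ℝ, FW)).tangent ∞
      (fun u => (⟨u, w u⟩ : TangentBundle ((𝓡 m).prod 𝓘(ℝ, FW)) (TotalSpace FW W))) u := by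
    intro u hus
    have hp : ContMDiffAt ((𝓡 m).prod 𝓘(ℝ, FW)) 𝓘(ℝ, FW) ∞
        (fun u' : TotalSpace FW W => (e u').2) u :=
      ((e.contMDiffOn (n := ∞) (IB := 𝓡 m)).contMDiffAt (e.open_source.mem_nhds hus)).snd
    have h1 : ContMDiffAt (((𝓡 m).prod 𝓘(ℝ, FW)).prod (𝓡 m)) ((𝓡 m).prod 𝓘(ℝ, FW)) ∞
        (fun p : TotalSpace FW W × M => e.toOpenPartialHomeomorph.symm (p.2, (e p.1).2))
        (u, u.proj) :=
      (hΨ u hus).comp (u, u.proj) (contMDiffAt_snd.prodMk (ContMDiffAt.comp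
        (g := fun u' : TotalSpace FW W => (e u').2) (u, u.proj) hp contMDiffAt_fst))
    have h2 := ContMDiffAt.mfderiv_apply_along
      (fun (u : TotalSpace FW W) x => e.toOpenPartialHomeomorph.symm (x, (e u).2))
      (fun u => u.proj) (fun u => A.anchorAt u.proj (s (h u.proj))) h1
      ((A.contMDiff_anchorAt hs).comp (contMDiff_proj W)).contMDiffAt
    refine h2.congr_of_eventuallyEq ?_
    filter_upwards [e.open_source.mem_nhds hus] with u' hu'
    have key : ∀ (v v' : TotalSpace FW W) (w : EuclideanSpace ℝ (Fin m) × FW), v = v' →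
        (⟨v, w⟩ : TangentBundle ((𝓡 m).prod 𝓘(ℝ, FW)) (TotalSpace FW W)) = ⟨v', w⟩ := by
      rintro v v' w rfl; rfl
    exact key _ _ _ (hΨu u' hu').symm
  have : T2Space (TotalSpace FW W) := t2Space_totalSpace
  obtain ⟨φ, hφ, hφ1, hsupp⟩ := exists_bump ((𝓡 m).prod 𝓘(ℝ, FW)) (e.open_source.mem_nhds hus₀)
  classical
  let Y : Π u : TotalSpace FW W, A.GT u := fun u =>
    if hu : u ∈ e.source then ⟨(s (h u.proj), w u), hmem u hu⟩ else 0
  have hY : A.SmoothGT (fun u => φ u • Y u) := by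
    refine A.smoothGT_of_smoothGTAt fun u => ?_
    by_cases hu : u ∈ tsupport φ
    · refine GenLieAlgebroid.SmoothGTAt.smul (hφ u) ?_
      have hev := e.open_source.mem_nhds (hsupp hu)
      refine ⟨((hs.comp (h.contMDiff.comp (contMDiff_proj W))).contMDiffAt
        (x := u)).congr_of_eventuallyEq ?_, (hw u (hsupp hu)).congr_of_eventuallyEq ?_⟩
      · filter_upwards [hev] with u' hu'
        simp only [Y, dif_pos hu']
        rfl
      · filter_upwards [hev] with u' hu'
        simp only [Y, dif_pos hu']
        rfl
    · refine (A.smoothGT_zero.smoothGTAt u).congr ?_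
      filter_upwards [(isOpen_compl_iff.2 (isClosed_tsupport φ)).mem_nhds hu] with u' hu'
      simp [image_eq_zero_of_notMem_tsupport hu']
  refine ((hY.sub (C.smooth _ hY)).smoothGTAt u₀).congr ?_
  filter_upwards [e.open_source.mem_nhds hus₀, hφ1] with u hu hu1
  have h1 : A.pr u (Y u) = s (h u.proj) := by
    simp only [Y, dif_pos hu]
    rfl
  simp only [hu1, one_smul, Pi.sub_apply]
  rw [← C.lift_pr, h1]

end Horizontal
end

noncomputable section

/-! ### Derivations and locality -/

section Germs

variable {m : ℕ}
  {M : Type*} [TopologicalSpace M] [ChartedSpace (EuclideanSpace ℝ (Fin m)) M]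
  [IsManifold (𝓡 m) ∞ M] [T2Space M]
  {N : Type*} [TopologicalSpace N] [ChartedSpace (EuclideanSpace ℝ (Fin m)) N]
  [IsManifold (𝓡 m) ∞ N] [T2Space N]
  {FF : Type*} [NormedAddCommGroup FF] [NormedSpace ℝ FF] [FiniteDimensional ℝ FF]
  {F : N → Type*} [TopologicalSpace (TotalSpace FF F)]
  [∀ y, AddCommGroup (F y)] [∀ y, Module ℝ (F y)] [∀ y, TopologicalSpace (F y)]
  [FiberBundle FF F] [VectorBundle ℝ FF F] [ContMDiffVectorBundle ∞ FF F (𝓡 m)]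
  {h : M ≃ₘ^∞⟮𝓡 m, 𝓡 m⟯ N} {η : N ≃ₘ^∞⟮𝓡 m, 𝓡 m⟯ M}
variable {FW : Type*} [NormedAddCommGroup FW] [NormedSpace ℝ FW] [FiniteDimensional ℝ FW]
  {W : M → Type*} [TopologicalSpace (TotalSpace FW W)]
  [∀ x, AddCommGroup (W x)] [∀ x, Module ℝ (W x)] [∀ x, TopologicalSpace (W x)]
  [FiberBundle FW W] [VectorBundle ℝ FW W] [ContMDiffVectorBundle ∞ FW W (𝓡 m)]
  {A : GenLieAlgebroid FF F h η}
variable {C : RhoConnection FW W A}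

lemma GenLieAlgebroid.act_congr {u : TotalSpace FW W} (X : A.GT u) {f g : TotalSpace FW W → ℝ}
    (hfg : ∀ᶠ v in 𝓝 u, f v = g v) : A.act u X f = A.act u X g := by
  have : f =ᶠ[𝓝 u] g := hfg
  rw [GenLieAlgebroid.act, GenLieAlgebroid.act, dirDeriv, dirDeriv, this.mfderiv_eq]
  rfl

lemma GenLieAlgebroid.act_add_left {u : TotalSpace FW W} (X Y : A.GT u)
    (f : TotalSpace FW W → ℝ) : A.act u (X + Y) f = A.act u X f + A.act u Y f := by
  rw [GenLieAlgebroid.act, map_add]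
  exact map_add (mfderiv ((𝓡 m).prod 𝓘(ℝ, FW)) 𝓘(ℝ, ℝ) f u) _ _

lemma GenLieAlgebroid.act_smul_left {u : TotalSpace FW W} (c : ℝ) (X : A.GT u)
    (f : TotalSpace FW W → ℝ) : A.act u (c • X) f = c * A.act u X f := by
  rw [GenLieAlgebroid.act, map_smul]
  exact map_smul (mfderiv ((𝓡 m).prod 𝓘(ℝ, FW)) 𝓘(ℝ, ℝ) f u) _ _

lemma GenLieAlgebroid.act_add_right {u : TotalSpace FW W} (X : A.GT u)
    {f g : TotalSpace FW W → ℝ} (hf : ContMDiff ((𝓡 m).prod 𝓘(ℝ, FW)) 𝓘(ℝ, ℝ) ∞ f)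
    (hg : ContMDiff ((𝓡 m).prod 𝓘(ℝ, FW)) 𝓘(ℝ, ℝ) ∞ g) :
    A.act u X (fun v => f v + g v) = A.act u X f + A.act u X g := by
  have h1 := ((hf.mdifferentiable (by simp) u).hasMFDerivAt.add
    (hg.mdifferentiable (by simp) u).hasMFDerivAt).mfderiv
  exact DFunLike.congr_fun h1 (A.anchor u X)

lemma GenLieAlgebroid.act_mul {u : TotalSpace FW W} (X : A.GT u)
    {f g : TotalSpace FW W → ℝ} (hf : ContMDiff ((𝓡 m).prod 𝓘(ℝ, FW)) 𝓘(ℝ, ℝ) ∞ f)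
    (hg : ContMDiff ((𝓡 m).prod 𝓘(ℝ, FW)) 𝓘(ℝ, ℝ) ∞ g) :
    A.act u X (fun v => f v * g v) = f u * A.act u X g + g u * A.act u X f := by
  have h1 := ((hf.mdifferentiable (by simp) u).hasMFDerivAt.mul
    (hg.mdifferentiable (by simp) u).hasMFDerivAt).mfderiv
  exact DFunLike.congr_fun h1 (A.anchor u X)

lemma GenLieAlgebroid.contMDiff_act {X : Π u : TotalSpace FW W, A.GT u} (hX : A.SmoothGT X)
    {f : TotalSpace FW W → ℝ} (hf : ContMDiff ((𝓡 m).prod 𝓘(ℝ, FW)) 𝓘(ℝ, ℝ) ∞ f) :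
    ContMDiff ((𝓡 m).prod 𝓘(ℝ, FW)) 𝓘(ℝ, ℝ) ∞ (fun u => A.act u (X u) f) := by
  have h1 := (hf.contMDiff_tangentMap (m := ∞) (by simp)).comp hX.2
  exact (contMDiff_snd_tangentBundle_modelSpace ℝ 𝓘(ℝ, ℝ)).comp h1

/-- On functions that come from the base, an element of the generalized tangent bundle acts through
the anchor of its projection. -/
lemma GenLieAlgebroid.act_comp_proj {u : TotalSpace FW W} (X : A.GT u) {f : M → ℝ}
    (hf : ContMDiff (𝓡 m) 𝓘(ℝ, ℝ) ∞ f) :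
    A.act u X (fun v => f v.proj) = dirDeriv (𝓡 m) f u.proj (A.anchorAt u.proj (A.pr u X)) := by
  have h1 := GenLieAlgebroid.mem_GT.1 X.2
  have hπ : MDifferentiableAt ((𝓡 m).prod 𝓘(ℝ, FW)) (𝓡 m) (π FW W) u :=
    (contMDiffAt_proj W (n := ∞)).mdifferentiableAt (by simp)
  have h2 := mfderiv_comp u (hf.mdifferentiable (by simp) _) hπ
  refine (DFunLike.congr_fun h2 (A.anchor u X)).trans ?_
  exact congrArg (mfderiv (𝓡 m) 𝓘(ℝ, ℝ) f u.proj) h1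

/-- Vertical elements annihilate the functions that come from the base. -/
lemma GenLieAlgebroid.act_dot_comp_proj {u : TotalSpace FW W} (z : W u.proj) {f : M → ℝ}
    (hf : ContMDiff (𝓡 m) 𝓘(ℝ, ℝ) ∞ f) : A.act u (A.dotₗ u z) (fun v => f v.proj) = 0 := by
  have h1 : A.pr u (A.dotₗ u z) = 0 := A.dot_mem_vert u z
  rw [A.act_comp_proj _ hf, h1, map_zero]
  exact map_zero (mfderiv (𝓡 m) 𝓘(ℝ, ℝ) f u.proj)

/-- On functions that come from `N`, horizontal lifts act through the vector fields that occur in the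
Leibniz rule of the algebroid. -/
lemma RhoConnection.act_lift_comp_proj {u : TotalSpace FW W} {f : N → ℝ}
    (hf : ContMDiff (𝓡 m) 𝓘(ℝ, ℝ) ∞ f) (s : Π y, F y) :
    A.act u (C.liftₗ u (s (h u.proj))) (fun v => f (h v.proj)) =
      dirDeriv (𝓡 m) f (h u.proj) (pushAnchor h η A.ρ s (h u.proj)) := by
  have h1 : A.pr u (C.liftₗ u (s (h u.proj))) = s (h u.proj) := (C.lift_spec u _).1
  have h2 := A.act_comp_proj (f := f ∘ h) (C.liftₗ u (s (h u.proj))) (hf.comp h.contMDiff)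
  refine h2.trans ?_
  rw [A.dirDeriv_pushAnchor hf, h1]

variable (D : DLinearConnection C) {X X' Y Y' : Π u : TotalSpace FW W, A.GT u}

lemma DLinearConnection.sub_left (hX : A.SmoothGT X) (hX' : A.SmoothGT X') (hY : A.SmoothGT Y) :
    D.D (X - X') Y = D.D X Y - D.D X' Y := by
  rw [eq_sub_iff_add_eq, ← D.add_left _ _ _ (hX.sub hX') hX' hY, sub_add_cancel]

lemma DLinearConnection.sub_right (hX : A.SmoothGT X) (hY : A.SmoothGT Y) (hY' : A.SmoothGT Y') :
    D.D X (Y - Y') = D.D X Y - D.D X Y' := by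
  rw [eq_sub_iff_add_eq, ← D.add_right _ _ _ hX (hY.sub hY') hY', sub_add_cancel]

/-- A smooth function which vanishes at `u` and is `1` outside a given neighbourhood. -/
lemma exists_cutoff {u : TotalSpace FW W} {S : Set (TotalSpace FW W)} (hS : S ∈ 𝓝 u) :
    ∃ ψ : TotalSpace FW W → ℝ, ContMDiff ((𝓡 m).prod 𝓘(ℝ, FW)) 𝓘(ℝ, ℝ) ∞ ψ ∧ ψ u = 0 ∧
      ∀ v ∉ S, ψ v = 1 := by
  have : T2Space (TotalSpace FW W) := t2Space_totalSpace
  obtain ⟨φ, hφ, hφ1, hsupp⟩ := exists_bump ((𝓡 m).prod 𝓘(ℝ, FW)) hS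
  refine ⟨fun v => 1 - φ v, contMDiff_const.sub hφ, by simp [hφ1.self_of_nhds], fun v hv => ?_⟩
  simp [image_eq_zero_of_notMem_tsupport fun hm => hv (hsupp hm)]

/-- The value of `D X Y` at a point depends only on the germs of `X` and `Y` there. -/
lemma DLinearConnection.congr_of_eventually {u : TotalSpace FW W} (hX : A.SmoothGT X)
    (hX' : A.SmoothGT X') (hY : A.SmoothGT Y) (hY' : A.SmoothGT Y')
    (hXX' : ∀ᶠ v in 𝓝 u, X v = X' v) (hYY' : ∀ᶠ v in 𝓝 u, Y v = Y' v) :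
    D.D X Y u = D.D X' Y' u := by
  have key : ∀ {Z Z' : Π u : TotalSpace FW W, A.GT u} {ψ : TotalSpace FW W → ℝ},
      (∀ v ∉ {v | Z v = Z' v}, ψ v = 1) → (fun v => ψ v • (Z - Z') v) = Z - Z' := by
    intro Z Z' ψ h1
    funext v
    by_cases hv : Z v = Z' v
    · simp [hv]
    · simp [h1 v hv]
  have e1 : D.D (X - X') Y u = 0 := by
    obtain ⟨ψ, hψ, hψ0, hψ1⟩ := exists_cutoff (m := m) hXX'
    have h1 := congrFun (D.smul_left ψ (X - X') Y hψ (hX.sub hX') hY) u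
    rwa [key hψ1, hψ0, zero_smul] at h1
  have e2 : D.D X' (Y - Y') u = 0 := by
    obtain ⟨ψ, hψ, hψ0, hψ1⟩ := exists_cutoff (m := m) hYY'
    have h1 := congrFun (D.leibniz ψ X' (Y - Y') hψ hX' (hY.sub hY')) u
    rwa [key hψ1, hψ0, zero_smul, Pi.sub_apply, hYY'.self_of_nhds, sub_self, smul_zero,
      zero_add] at h1
  rw [D.sub_left hX hX' hY, Pi.sub_apply, sub_eq_zero] at e1
  rw [D.sub_right hX' hY hY', Pi.sub_apply, sub_eq_zero] at e2
  exact e1.trans e2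

end Germs

/-! ### Adapted frames and the metric -/

/-- Coordinates with respect to a basis of a nondegenerate subspace, expressed by the Gram
matrix. -/
lemma gram_repr {V ι : Type*} [AddCommGroup V] [Module ℝ V] [Fintype ι] [DecidableEq ι]
    (B : LinearMap.BilinForm ℝ V) (hsymm : ∀ x y, B x y = B y x) {S : Submodule ℝ V}
    (hnd : (B.restrict S).Nondegenerate) {b : ι → V} (hb : LinearIndependent ℝ b)
    (hS : Submodule.span ℝ (Set.range b) = S) :
    (Matrix.of fun i j => B (b i) (b j)).det ≠ 0 ∧
      ∀ v ∈ S, v = ∑ i, (∑ j, (Matrix.of fun i j => B (b i) (b j))⁻¹ i j * B v (b j)) • b i := by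
  subst hS
  have hdet : (Matrix.of fun i j => B (b i) (b j)).det ≠ 0 := by
    have h1 := (LinearMap.BilinForm.nondegenerate_iff_det_ne_zero (Module.Basis.span hb)).1 hnd
    convert! h1 using 2
    ext i j
    simp [LinearMap.BilinForm.toMatrix_apply, Module.Basis.span_apply]
  refine ⟨hdet, fun v hv => ?_⟩
  obtain ⟨a, rfl⟩ := (Submodule.mem_span_range_iff_exists_fun ℝ).1 hv
  refine Finset.sum_congr rfl fun i _ => ?_
  congr 1
  set g : Matrix ι ι ℝ := Matrix.of fun i j => B (b i) (b j) with hg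
  have h1 : ∀ j, B (∑ k, a k • b k) (b j) = (g.mulVec a) j := by
    intro j
    simp only [map_sum, map_smul, LinearMap.sum_apply, LinearMap.smul_apply, smul_eq_mul,
      Matrix.mulVec, dotProduct, hg, Matrix.of_apply]
    exact Finset.sum_congr rfl fun k _ => by rw [hsymm (b k), mul_comm]
  have h2 : (g⁻¹.mulVec (g.mulVec a)) i = a i := by
    rw [Matrix.mulVec_mulVec, Matrix.nonsing_inv_mul _ (isUnit_iff_ne_zero.2 hdet),
      Matrix.one_mulVec]
  simp only [h1]
  exact h2.symm

lemma ContMDiffAt.matrix_det {EQ HQ Q ι : Type*} [NormedAddCommGroup EQ] [NormedSpace ℝ EQ]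
    [TopologicalSpace HQ] {J : ModelWithCorners ℝ EQ HQ} [TopologicalSpace Q] [ChartedSpace HQ Q]
    [Fintype ι] [DecidableEq ι] {g : Q → Matrix ι ι ℝ} {x : Q}
    (hg : ∀ i j, ContMDiffAt J 𝓘(ℝ, ℝ) ∞ (fun x => g x i j) x) :
    ContMDiffAt J 𝓘(ℝ, ℝ) ∞ (fun x => (g x).det) x := by
  simp only [Matrix.det_apply']
  refine contMDiffAt_finsetSum fun σ _ => contMDiffAt_const.mul ?_
  exact contMDiffAt_finsetProd fun i _ => hg _ _

lemma ContMDiffAt.matrix_adjugate {EQ HQ Q ι : Type*} [NormedAddCommGroup EQ] [NormedSpace ℝ EQ]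
    [TopologicalSpace HQ] {J : ModelWithCorners ℝ EQ HQ} [TopologicalSpace Q] [ChartedSpace HQ Q]
    [Fintype ι] [DecidableEq ι] {g : Q → Matrix ι ι ℝ} {x : Q}
    (hg : ∀ i j, ContMDiffAt J 𝓘(ℝ, ℝ) ∞ (fun x => g x i j) x) (i j : ι) :
    ContMDiffAt J 𝓘(ℝ, ℝ) ∞ (fun x => (g x).adjugate i j) x := by
  simp only [Matrix.adjugate_apply]
  refine ContMDiffAt.matrix_det fun k l => ?_
  by_cases hk : k = j
  · subst hk
    simp only [Matrix.updateRow_self]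
    exact contMDiffAt_const
  · simp only [Matrix.updateRow_ne hk]
    exact hg k l

lemma ContMDiffAt.matrix_inv {EQ HQ Q ι : Type*} [NormedAddCommGroup EQ] [NormedSpace ℝ EQ]
    [TopologicalSpace HQ] {J : ModelWithCorners ℝ EQ HQ} [TopologicalSpace Q] [ChartedSpace HQ Q]
    [Fintype ι] [DecidableEq ι] {g : Q → Matrix ι ι ℝ} {x : Q}
    (hg : ∀ i j, ContMDiffAt J 𝓘(ℝ, ℝ) ∞ (fun x => g x i j) x) (h0 : (g x).det ≠ 0) (i j : ι) :
    ContMDiffAt J 𝓘(ℝ, ℝ) ∞ (fun x => (g x)⁻¹ i j) x := by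
  simp only [Matrix.inv_def, Ring.inverse_eq_inv', Matrix.smul_apply, smul_eq_mul]
  exact ((ContMDiffAt.matrix_det hg).inv₀ h0).mul (ContMDiffAt.matrix_adjugate hg i j)

section Frames

variable {m : ℕ}
  {M : Type*} [TopologicalSpace M] [ChartedSpace (EuclideanSpace ℝ (Fin m)) M]
  [IsManifold (𝓡 m) ∞ M] [T2Space M]
  {N : Type*} [TopologicalSpace N] [ChartedSpace (EuclideanSpace ℝ (Fin m)) N]
  [IsManifold (𝓡 m) ∞ N] [T2Space N]
  {FF : Type*} [NormedAddCommGroup FF] [NormedSpace ℝ FF] [FiniteDimensional ℝ FF]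
  {F : N → Type*} [TopologicalSpace (TotalSpace FF F)]
  [∀ y, AddCommGroup (F y)] [∀ y, Module ℝ (F y)] [∀ y, TopologicalSpace (F y)]
  [FiberBundle FF F] [VectorBundle ℝ FF F] [ContMDiffVectorBundle ∞ FF F (𝓡 m)]
  {h : M ≃ₘ^∞⟮𝓡 m, 𝓡 m⟯ N} {η : N ≃ₘ^∞⟮𝓡 m, 𝓡 m⟯ M}
variable {FW : Type*} [NormedAddCommGroup FW] [NormedSpace ℝ FW] [FiniteDimensional ℝ FW]
  {W : M → Type*} [TopologicalSpace (TotalSpace FW W)]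
  [∀ x, AddCommGroup (W x)] [∀ x, Module ℝ (W x)] [∀ x, TopologicalSpace (W x)]
  [FiberBundle FW W] [VectorBundle ℝ FW W] [ContMDiffVectorBundle ∞ FW W (𝓡 m)]
  {A : GenLieAlgebroid FF F h η}
variable (C : RhoConnection FW W A)

lemma RhoConnection.liftₗ_injective (u : TotalSpace FW W) : Function.Injective (C.liftₗ u) := by
  intro z z' hzz
  rw [← (C.lift_spec u z).1, ← (C.lift_spec u z').1]
  exact congrArg (A.pr u) hzz

lemma RhoConnection.range_liftₗ (u : TotalSpace FW W) :
    LinearMap.range (C.liftₗ u) = C.hor u := by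
  refine le_antisymm ?_ fun X hX => ?_
  · rintro _ ⟨z, rfl⟩
    exact (C.lift_spec u z).2
  · have h0 : C.Γ u X = 0 := hX
    exact ⟨A.pr u X, by rw [C.lift_pr, h0, sub_zero]⟩

lemma RhoConnection.isCompl (u : TotalSpace FW W) : IsCompl (C.hor u) (A.vert u) := by
  refine ⟨Submodule.disjoint_def.2 fun X h1 h2 => ?_, codisjoint_iff.2 <| eq_top_iff.2 fun X _ => ?_⟩
  · rw [← C.split u X h2]
    exact h1
  · have h1 : X - C.Γ u X ∈ C.hor u := by
      rw [← C.lift_pr]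
      exact (C.lift_spec u _).2
    have h2 := Submodule.add_mem_sup h1 (C.mem_vert u X)
    rwa [sub_add_cancel] at h2

/-- The horizontal lifts of a basis of the fibre of `F` form a basis of the horizontal space. -/
lemma RhoConnection.delta_isBasis {ι : Type*} {u : TotalSpace FW W} {z : ι → F (h u.proj)}
    (hz : LinearIndependent ℝ z) (hz' : ⊤ ≤ Submodule.span ℝ (Set.range z)) :
    LinearIndependent ℝ (fun i => C.liftₗ u (z i)) ∧
      Submodule.span ℝ (Set.range fun i => C.liftₗ u (z i)) = C.hor u := by
  refine ⟨hz.map' _ (LinearMap.ker_eq_bot.2 (C.liftₗ_injective u)), ?_⟩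
  rw [← C.range_liftₗ, LinearMap.range_eq_map, ← top_le_iff.1 hz', Submodule.map_span,
    ← Set.range_comp]
  rfl

variable (A) in
/-- The vertical lifts of a basis of the fibre of `W` form a basis of the vertical space. -/
lemma GenLieAlgebroid.dot_isBasis {κ : Type*} {u : TotalSpace FW W} {z : κ → W u.proj}
    (hz : LinearIndependent ℝ z) (hz' : ⊤ ≤ Submodule.span ℝ (Set.range z)) :
    LinearIndependent ℝ (fun i => A.dotₗ u (z i)) ∧
      Submodule.span ℝ (Set.range fun i => A.dotₗ u (z i)) = A.vert u := by
  refine ⟨hz.map' _ (LinearMap.ker_eq_bot.2 (A.dotₗ_injective u)), ?_⟩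
  rw [← A.range_dotₗ, LinearMap.range_eq_map, ← top_le_iff.1 hz', Submodule.map_span,
    ← Set.range_comp]
  rfl

/-- Around every point there are global smooth sections that form a frame. -/
lemma exists_smooth_frame {B : Type*} [TopologicalSpace B] [T2Space B]
    [ChartedSpace (EuclideanSpace ℝ (Fin m)) B] [IsManifold (𝓡 m) ∞ B] {FV : Type*}
    [NormedAddCommGroup FV] [NormedSpace ℝ FV] [FiniteDimensional ℝ FV] {V : B → Type*}
    [TopologicalSpace (TotalSpace FV V)] [∀ b, AddCommGroup (V b)] [∀ b, Module ℝ (V b)]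
    [∀ b, TopologicalSpace (V b)] [FiberBundle FV V] [VectorBundle ℝ FV V]
    [ContMDiffVectorBundle ∞ FV V (𝓡 m)] (b₀ : B) :
    ∃ s : Fin (Module.finrank ℝ FV) → Π b, V b, (∀ i, IsSmoothSec m FV (s i)) ∧
      ∀ᶠ b in 𝓝 b₀, LinearIndependent ℝ (fun i => s i b) ∧
        ⊤ ≤ Submodule.span ℝ (Set.range fun i => s i b) := by
  set e := trivializationAt FV V b₀
  have hb : e.baseSet ∈ 𝓝 b₀ :=
    e.open_baseSet.mem_nhds (FiberBundle.mem_baseSet_trivializationAt' b₀)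
  have hfr := e.isLocalFrameOn_localFrame_baseSet (𝓡 m) ∞ (Module.finBasis ℝ FV)
  obtain ⟨s, hs, hsg⟩ := exists_smooth_section_germ (𝓡 m) hb hfr.contMDiffOn
  refine ⟨s, hs, ?_⟩
  filter_upwards [hb, hsg] with b hb hsb
  simp only [hsb]
  exact ⟨hfr.linearIndependent hb, hfr.generating hb⟩

/-- Around every point there are global sections that form a frame adapted to the splitting: each
of them is the sum of the horizontal lift of a section of `F` and the vertical lift of a section of
`W`. -/
lemma RhoConnection.exists_adapted_frame (u₀ : TotalSpace FW W) :
    ∃ (n : ℕ) (s : Fin n → Π y, F y) (e : Fin n → Π x, W x),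
      (∀ i, IsSmoothSec m FF (s i)) ∧ (∀ i, IsSmoothSec m FW (e i)) ∧
      ∀ᶠ u in 𝓝 u₀,
        LinearIndependent ℝ (fun i => C.liftₗ u (s i (h u.proj)) + A.dotₗ u (e i u.proj)) ∧
        Submodule.span ℝ (Set.range fun i =>
          C.liftₗ u (s i (h u.proj)) + A.dotₗ u (e i u.proj)) = ⊤ := by
  obtain ⟨s, hs, hsb⟩ := exists_smooth_frame (m := m) (FV := FF) (V := F) (h u₀.proj)
  obtain ⟨e, he, heb⟩ := exists_smooth_frame (m := m) (FV := FW) (V := W) u₀.proj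
  have hπ : Tendsto (fun u : TotalSpace FW W => u.proj) (𝓝 u₀) (𝓝 u₀.proj) :=
    (FiberBundle.continuous_proj FW W).tendsto u₀
  have hhπ := (h.continuous.tendsto u₀.proj).comp hπ
  let σ : Fin (Module.finrank ℝ FF) ⊕ Fin (Module.finrank ℝ FW) ≃
      Fin (Module.finrank ℝ FF + Module.finrank ℝ FW) := finSumFinEquiv
  refine ⟨_, fun i => Sum.elim s (fun _ => 0) (σ.symm i),
    fun i => Sum.elim (fun _ => 0) e (σ.symm i), fun i => ?_, fun i => ?_, ?_⟩
  · change IsSmoothSec m FF (Sum.elim s (fun _ => 0) (σ.symm i))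
    rcases σ.symm i with i | i
    exacts [hs i, contMDiff_zeroSection ℝ F]
  · change IsSmoothSec m FW (Sum.elim (fun _ => 0) e (σ.symm i))
    rcases σ.symm i with i | i
    exacts [contMDiff_zeroSection ℝ W, he i]
  filter_upwards [hhπ.eventually hsb, hπ.eventually heb] with u h1 h2
  obtain ⟨hl, hlS⟩ := C.delta_isBasis (z := fun i => s i (h u.proj)) h1.1 h1.2
  obtain ⟨hd, hdS⟩ := A.dot_isBasis (z := fun i => e i u.proj) h2.1 h2.2
  have hE : (fun i => C.liftₗ u (Sum.elim s (fun _ => 0) (σ.symm i) (h u.proj)) +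
      A.dotₗ u (Sum.elim (fun _ => 0) e (σ.symm i) u.proj)) =
      Sum.elim (fun i => C.liftₗ u (s i (h u.proj))) (fun i => A.dotₗ u (e i u.proj)) ∘ σ.symm := by
    funext i
    rcases hi : σ.symm i with i | i <;> simp [hi]
  rw [hE]
  refine ⟨(linearIndependent_equiv σ.symm).2 (hl.sum_type hd ?_), ?_⟩
  · rw [hlS, hdS]
    exact (C.isCompl u).disjoint
  · rw [σ.symm.surjective.range_comp, Set.Sum.elim_range, Submodule.span_union, hlS, hdS]
    exact (C.isCompl u).sup_eq_top

end Frames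
end

noncomputable section

/-! ### Sections of the generalized tangent bundle and the pairing -/

section Gram

variable {V ι : Type*} [AddCommGroup V] [Module ℝ V] [Fintype ι] [DecidableEq ι]

/-- An expansion with coefficients given by an inverse matrix, cleared of the denominator. -/
lemma smul_eq_sum_adjugate {g : Matrix ι ι ℝ} (hg : g.det ≠ 0) {a : ι → ℝ} {b : ι → V} {v : V}
    (hv : v = ∑ i, (∑ j, g⁻¹ i j * a j) • b i) (c : ℝ) :
    (c * g.det) • v = ∑ i, (∑ j, g.adjugate i j * a j) • (c • b i) := by
  rw [hv, Finset.smul_sum]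
  refine Finset.sum_congr rfl fun i _ => ?_
  rw [smul_smul, smul_smul]
  congr 1
  rw [Finset.mul_sum, Finset.sum_mul]
  refine Finset.sum_congr rfl fun j _ => ?_
  rw [Matrix.inv_def, Ring.inverse_eq_inv', Matrix.smul_apply, smul_eq_mul]
  field_simp

/-- The vector with prescribed pairings `a j` with the `b j`, paired with `v`. -/
lemma sum_inv_gram_pairing (B : LinearMap.BilinForm ℝ V) (hsymm : ∀ x y, B x y = B y x)
    (b : ι → V) (a : ι → ℝ) (v : V) :
    B (∑ i, (∑ j, (Matrix.of fun i j => B (b i) (b j))⁻¹ i j * a j) • b i) v =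
      ∑ i, (∑ j, (Matrix.of fun i j => B (b i) (b j))⁻¹ i j * B v (b j)) * a i := by
  set g : Matrix ι ι ℝ := Matrix.of fun i j => B (b i) (b j) with hg
  have hgs : ∀ i j, g⁻¹ i j = g⁻¹ j i := by
    intro i j
    have h1 : g.transpose = g := by
      ext i j
      exact hsymm _ _
    conv_lhs => rw [← h1, ← Matrix.transpose_nonsing_inv]
    rfl
  simp only [map_sum, map_smul, LinearMap.sum_apply, LinearMap.smul_apply, smul_eq_mul,
    Finset.sum_mul]
  rw [Finset.sum_comm]
  refine Finset.sum_congr rfl fun i _ => Finset.sum_congr rfl fun j _ => ?_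
  rw [hgs j i, hsymm (b j)]
  ring

end Gram

section Pairing

variable {m : ℕ}
  {M : Type*} [TopologicalSpace M] [ChartedSpace (EuclideanSpace ℝ (Fin m)) M]
  [IsManifold (𝓡 m) ∞ M] [T2Space M]
  {N : Type*} [TopologicalSpace N] [ChartedSpace (EuclideanSpace ℝ (Fin m)) N]
  [IsManifold (𝓡 m) ∞ N] [T2Space N]
  {FF : Type*} [NormedAddCommGroup FF] [NormedSpace ℝ FF] [FiniteDimensional ℝ FF]
  {F : N → Type*} [TopologicalSpace (TotalSpace FF F)]
  [∀ y, AddCommGroup (F y)] [∀ y, Module ℝ (F y)] [∀ y, TopologicalSpace (F y)]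
  [FiberBundle FF F] [VectorBundle ℝ FF F] [ContMDiffVectorBundle ∞ FF F (𝓡 m)]
  {h : M ≃ₘ^∞⟮𝓡 m, 𝓡 m⟯ N} {η : N ≃ₘ^∞⟮𝓡 m, 𝓡 m⟯ M}
variable {FW : Type*} [NormedAddCommGroup FW] [NormedSpace ℝ FW] [FiniteDimensional ℝ FW]
  {W : M → Type*} [TopologicalSpace (TotalSpace FW W)]
  [∀ x, AddCommGroup (W x)] [∀ x, Module ℝ (W x)] [∀ x, TopologicalSpace (W x)]
  [FiberBundle FW W] [VectorBundle ℝ FW W] [ContMDiffVectorBundle ∞ FW W (𝓡 m)]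
  {A : GenLieAlgebroid FF F h η}
variable {C : RhoConnection FW W A} {G : ∀ u : TotalSpace FW W, LinearMap.BilinForm ℝ (A.GT u)}

/-- The Gram matrix of a family of sections. -/
def gram {ι : Type*} (G : ∀ u : TotalSpace FW W, LinearMap.BilinForm ℝ (A.GT u))
    (E : ι → Π u : TotalSpace FW W, A.GT u) (u : TotalSpace FW W) : Matrix ι ι ℝ :=
  Matrix.of fun i j => G u (E i u) (E j u)

lemma IsPseudoMetrical.mixed' (hG : IsPseudoMetrical C G) {u : TotalSpace FW W} {X Y : A.GT u}
    (hX : X ∈ A.vert u) (hY : Y ∈ C.hor u) : G u X Y = 0 := by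
  rw [hG.symm, hG.mixed u Y hY X hX]

lemma RhoConnection.sub_mem_hor (C : RhoConnection FW W A) (u : TotalSpace FW W) (X : A.GT u) :
    X - C.Γ u X ∈ C.hor u := by
  rw [← C.lift_pr]
  exact (C.lift_spec u _).2

/-- The horizontal space is the orthogonal complement of the vertical one. -/
lemma IsPseudoMetrical.mem_hor (hG : IsPseudoMetrical C G) {u : TotalSpace FW W} {X : A.GT u}
    (hX : ∀ Z ∈ A.vert u, G u X Z = 0) : X ∈ C.hor u := by
  have h1 := (hG.nondegenerate_vert u).1 ⟨C.Γ u X, C.mem_vert u X⟩ fun Z => by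
    have h2 := hG.mixed u _ (C.sub_mem_hor u X) Z.1 Z.2
    rw [map_sub, LinearMap.sub_apply, hX Z.1 Z.2, zero_sub, neg_eq_zero] at h2
    exact h2
  exact congrArg Subtype.val h1

lemma IsPseudoMetrical.mem_vert (hG : IsPseudoMetrical C G) {u : TotalSpace FW W} {X : A.GT u}
    (hX : ∀ Z ∈ C.hor u, G u X Z = 0) : X ∈ A.vert u := by
  have h1 := (hG.nondegenerate_hor u).1 ⟨X - C.Γ u X, C.sub_mem_hor u X⟩ fun Z => by
    have h2 := hG.mixed' (C.mem_vert u X) Z.2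
    change G u (X - C.Γ u X) Z = 0
    rw [map_sub, LinearMap.sub_apply, hX Z.1 Z.2, h2, sub_zero]
  have h2 : X = C.Γ u X := sub_eq_zero.1 (congrArg Subtype.val h1)
  rw [h2]
  exact C.mem_vert u X

lemma IsPseudoMetrical.eq_zero_of_pairing (hG : IsPseudoMetrical C G) {u : TotalSpace FW W}
    {X : A.GT u} (hX : ∀ Z, G u X Z = 0) : X = 0 :=
  Submodule.disjoint_def.1 (C.isCompl u).disjoint X (hG.mem_hor fun Z _ => hX Z)
    (hG.mem_vert fun Z _ => hX Z)

lemma IsPseudoMetrical.nondegenerate_top (hG : IsPseudoMetrical C G) (u : TotalSpace FW W) :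
    ((G u).restrict ⊤).Nondegenerate :=
  ⟨fun _ hX => Subtype.ext <| hG.eq_zero_of_pairing fun Z => hX ⟨Z, trivial⟩,
    fun _ hX => Subtype.ext <| hG.eq_zero_of_pairing fun Z =>
      (hG.symm u _ _).trans (hX ⟨Z, trivial⟩)⟩

/-- Around every point there are finitely many smooth sections in which every element of the
bundle is expressed through its pairings with these sections. -/
lemma IsPseudoMetrical.exists_frame (hG : IsPseudoMetrical C G) (u₀ : TotalSpace FW W) :
    ∃ (n : ℕ) (E : Fin n → Π u : TotalSpace FW W, A.GT u), (∀ i, A.SmoothGT (E i)) ∧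
      ∀ᶠ u in 𝓝 u₀, (gram G E u).det ≠ 0 ∧
        ∀ v : A.GT u, v = ∑ i, (∑ j, (gram G E u)⁻¹ i j *
          G u v (E j u)) • E i u := by
  obtain ⟨n, s, e, hs, he, hE⟩ := C.exists_adapted_frame u₀
  refine ⟨n, fun i u => C.liftₗ u (s i (h u.proj)) + A.dotₗ u (e i u.proj),
    fun i => (C.smoothGT_lift (hs i)).add (A.smoothGT_dot (he i)), ?_⟩
  filter_upwards [hE] with u hu
  obtain ⟨h1, h2⟩ := gram_repr (G u) (hG.symm u) (hG.nondegenerate_top u) hu.1 hu.2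
  exact ⟨h1, fun v => h2 v trivial⟩

lemma RhoConnection.exists_section_through (C : RhoConnection FW W A) {u : TotalSpace FW W}
    (X : A.GT u) : ∃ Z : Π u : TotalSpace FW W, A.GT u, A.SmoothGT Z ∧ Z u = X := by
  have hΓ := C.mem_vert u X
  rw [← A.range_dotₗ] at hΓ
  obtain ⟨w, hw⟩ := hΓ
  obtain ⟨s, hs, hsu⟩ := exists_smooth_section_through (𝓡 m) (FV := FF) (A.pr u X)
  obtain ⟨e, he, heu⟩ := exists_smooth_section_through (𝓡 m) (FV := FW) w
  refine ⟨_, (C.smoothGT_lift hs).add (A.smoothGT_dot he), ?_⟩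
  change C.liftₗ u (s (h u.proj)) + A.dotₗ u (e u.proj) = X
  rw [hsu, heu, C.lift_pr, hw, sub_add_cancel]

lemma GenLieAlgebroid.SmoothGT.sum_smul {ι : Type*} (S : Finset ι)
    {f : ι → TotalSpace FW W → ℝ} {E : ι → Π u : TotalSpace FW W, A.GT u}
    (hf : ∀ i, ContMDiff ((𝓡 m).prod 𝓘(ℝ, FW)) 𝓘(ℝ, ℝ) ∞ (f i)) (hE : ∀ i, A.SmoothGT (E i)) :
    A.SmoothGT (fun v => ∑ i ∈ S, f i v • E i v) := by
  have h1 := GenLieAlgebroid.SmoothGT.sum (T := S) fun i _ => (hE i).smul (hf i)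
  have h2 : (fun v => ∑ i ∈ S, f i v • E i v) = ∑ i ∈ S, fun v => f i v • E i v := by
    funext v
    rw [Finset.sum_apply]
  rwa [h2]

lemma GenLieAlgebroid.SmoothGTAt.sum_smul {ι : Type*} (S : Finset ι) {u : TotalSpace FW W}
    {f : ι → TotalSpace FW W → ℝ} {E : ι → Π u : TotalSpace FW W, A.GT u}
    (hf : ∀ i, ContMDiffAt ((𝓡 m).prod 𝓘(ℝ, FW)) 𝓘(ℝ, ℝ) ∞ (f i) u)
    (hE : ∀ i, A.SmoothGTAt (E i) u) : A.SmoothGTAt (fun v => ∑ i ∈ S, f i v • E i v) u := by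
  have h1 := GenLieAlgebroid.SmoothGTAt.sum (T := S) fun i _ => (hE i).smul (hf i)
  have h2 : (fun v => ∑ i ∈ S, f i v • E i v) = ∑ i ∈ S, fun v => f i v • E i v := by
    funext v
    rw [Finset.sum_apply]
  rwa [h2]

/-- A functional on smooth sections which is additive and `C^∞`-linear at the point `u`. -/
structure IsTensorialAt (A : GenLieAlgebroid FF F h η) (u : TotalSpace FW W)
    (Φ : (Π u : TotalSpace FW W, A.GT u) → ℝ) : Prop where
  add : ∀ X Y, A.SmoothGT X → A.SmoothGT Y → Φ (X + Y) = Φ X + Φ Y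
  smul : ∀ (f : TotalSpace FW W → ℝ) (X), ContMDiff ((𝓡 m).prod 𝓘(ℝ, FW)) 𝓘(ℝ, ℝ) ∞ f →
    A.SmoothGT X → Φ (fun v => f v • X v) = f u * Φ X

lemma IsTensorialAt.zero {u : TotalSpace FW W} {Φ : (Π u : TotalSpace FW W, A.GT u) → ℝ}
    (hΦ : IsTensorialAt A u Φ) : Φ 0 = 0 := by
  have h1 := hΦ.add 0 0 A.smoothGT_zero A.smoothGT_zero
  rw [add_zero] at h1
  linarith

lemma IsTensorialAt.sub {u : TotalSpace FW W} {Φ : (Π u : TotalSpace FW W, A.GT u) → ℝ}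
    (hΦ : IsTensorialAt A u Φ) {X Y : Π u : TotalSpace FW W, A.GT u} (hX : A.SmoothGT X)
    (hY : A.SmoothGT Y) : Φ (X - Y) = Φ X - Φ Y := by
  rw [eq_sub_iff_add_eq, ← hΦ.add _ _ (hX.sub hY) hY, sub_add_cancel]

lemma IsTensorialAt.sum {u : TotalSpace FW W} {Φ : (Π u : TotalSpace FW W, A.GT u) → ℝ}
    (hΦ : IsTensorialAt A u Φ) {ι : Type*} (S : Finset ι) {f : ι → TotalSpace FW W → ℝ}
    {E : ι → Π u : TotalSpace FW W, A.GT u}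
    (hf : ∀ i, ContMDiff ((𝓡 m).prod 𝓘(ℝ, FW)) 𝓘(ℝ, ℝ) ∞ (f i)) (hE : ∀ i, A.SmoothGT (E i)) :
    Φ (fun v => ∑ i ∈ S, f i v • E i v) = ∑ i ∈ S, f i u * Φ (E i) := by
  classical
  induction S using Finset.induction_on with
  | empty =>
    simp only [Finset.sum_empty]
    exact hΦ.zero
  | insert i S hi ih =>
    simp only [Finset.sum_insert hi]
    rw [← ih, ← hΦ.smul _ _ (hf i) (hE i)]
    exact hΦ.add _ _ ((hE i).smul (hf i)) (GenLieAlgebroid.SmoothGT.sum_smul S hf hE)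

/-- A tensorial functional depends only on the value of the section at the point. -/
lemma IsPseudoMetrical.tensorial_eq_zero (hG : IsPseudoMetrical C G) {u : TotalSpace FW W}
    {Φ : (Π u : TotalSpace FW W, A.GT u) → ℝ} (hΦ : IsTensorialAt A u Φ)
    {X : Π u : TotalSpace FW W, A.GT u} (hX : A.SmoothGT X) (h0 : X u = 0) : Φ X = 0 := by
  have : T2Space (TotalSpace FW W) := t2Space_totalSpace
  obtain ⟨n, E, hE, hrep⟩ := hG.exists_frame u
  obtain ⟨φ, hφ, hφ1, hsupp⟩ := exists_bump ((𝓡 m).prod 𝓘(ℝ, FW)) hrep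
  have hg : ∀ v i j, ContMDiffAt ((𝓡 m).prod 𝓘(ℝ, FW)) 𝓘(ℝ, ℝ) ∞ (fun x => gram G E x i j) v :=
    fun v i j => hG.smooth _ _ (hE i) (hE j) v
  have hdet : ContMDiff ((𝓡 m).prod 𝓘(ℝ, FW)) 𝓘(ℝ, ℝ) ∞ (fun v => φ v * (gram G E v).det) :=
    hφ.mul fun v => ContMDiffAt.matrix_det (hg v)
  -- Multiplication with the determinant turns the inverse Gram matrix into the adjugate, and the
  -- cut-off makes the identity a global one.
  have key : (fun v => (φ v * (gram G E v).det) • X v) =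
      fun v => ∑ i, (∑ j, (gram G E v).adjugate i j * G v (X v) (E j v)) • (φ v • E i v) := by
    funext v
    by_cases hv : v ∈ tsupport φ
    · obtain ⟨hd, hr⟩ := hsupp hv
      exact smul_eq_sum_adjugate hd (hr (X v)) (φ v)
    · simp only [image_eq_zero_of_notMem_tsupport hv, zero_mul, zero_smul, smul_zero,
        Finset.sum_const_zero]
  have hc : ∀ i, ContMDiff ((𝓡 m).prod 𝓘(ℝ, FW)) 𝓘(ℝ, ℝ) ∞
      (fun v => ∑ j, (gram G E v).adjugate i j * G v (X v) (E j v)) := fun i =>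
    contMDiff_finsetSum fun j _ => ContMDiff.mul
      (fun v => ContMDiffAt.matrix_adjugate (hg v) i j) (hG.smooth _ _ hX (hE j))
  have h1 := hΦ.smul _ X hdet hX
  have h2 := hΦ.sum Finset.univ hc (fun i => (hE i).smul hφ)
  have h3 : ∀ i, ∑ j, (gram G E u).adjugate i j * G u (X u) (E j u) = 0 := fun i =>
    Finset.sum_eq_zero fun j _ => by rw [h0, map_zero, LinearMap.zero_apply, mul_zero]
  simp only [h3, zero_mul, Finset.sum_const_zero] at h2
  rw [key, h2, hφ1.self_of_nhds, one_mul] at h1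
  exact (mul_eq_zero.1 h1.symm).resolve_left hrep.self_of_nhds.1

/-- A section with smooth pairings is smooth. -/
lemma IsPseudoMetrical.smoothGT_of_pairing (hG : IsPseudoMetrical C G)
    {V : Π u : TotalSpace FW W, A.GT u} (hV : ∀ Z, A.SmoothGT Z →
      ContMDiff ((𝓡 m).prod 𝓘(ℝ, FW)) 𝓘(ℝ, ℝ) ∞ (fun u => G u (V u) (Z u))) :
    A.SmoothGT V := by
  refine A.smoothGT_of_smoothGTAt fun u => ?_
  obtain ⟨n, E, hE, hrep⟩ := hG.exists_frame u
  have hinv := ContMDiffAt.matrix_inv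
    (g := gram G E)
    (fun i j => hG.smooth _ _ (hE i) (hE j) u) hrep.self_of_nhds.1
  exact GenLieAlgebroid.SmoothGTAt.congr (GenLieAlgebroid.SmoothGTAt.sum_smul Finset.univ
    (fun i => contMDiffAt_finsetSum fun j _ => (hinv i j).mul (hV _ (hE j) u))
    (fun i => (hE i).smoothGTAt u)) (hrep.mono fun v hv => hv.2 (V v))

/-- A `C^∞`-linear functional on the smooth sections, with smooth values, is the pairing with a
smooth section. -/
lemma IsPseudoMetrical.exists_riesz (hG : IsPseudoMetrical C G)
    {Φ : (Π u : TotalSpace FW W, A.GT u) → TotalSpace FW W → ℝ}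
    (hΦ : ∀ u, IsTensorialAt A u fun X => Φ X u)
    (hsm : ∀ X, A.SmoothGT X → ContMDiff ((𝓡 m).prod 𝓘(ℝ, FW)) 𝓘(ℝ, ℝ) ∞ (Φ X)) :
    ∃ V, A.SmoothGT V ∧ ∀ Z, A.SmoothGT Z → ∀ u, G u (V u) (Z u) = Φ Z u := by
  have key : ∀ u, ∃ v : A.GT u, ∀ Z, A.SmoothGT Z → G u v (Z u) = Φ Z u := by
    intro u
    obtain ⟨n, E, hE, hrep⟩ := hG.exists_frame u
    obtain ⟨hd, hr⟩ := hrep.self_of_nhds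
    refine ⟨∑ i, (∑ j, (gram G E u)⁻¹ i j * Φ (E j) u) • E i u, fun Z hZ => ?_⟩
    -- The section `Z` agrees at `u` with a combination of the frame with constant coefficients.
    set c : Fin n → ℝ := fun i => ∑ j, (gram G E u)⁻¹ i j * G u (Z u) (E j u) with hc
    have hZ' : Φ Z u = ∑ i, c i * Φ (E i) u := by
      have h1 := (hΦ u).sum Finset.univ (f := fun i _ => c i) (fun i => contMDiff_const) hE
      have hS : A.SmoothGT (fun v => ∑ i, c i • E i v) :=
        GenLieAlgebroid.SmoothGT.sum_smul _ (fun _ => contMDiff_const) hE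
      rw [← h1, ← sub_eq_zero, ← (hΦ u).sub hZ hS]
      exact hG.tensorial_eq_zero (hΦ u) (hZ.sub hS) (sub_eq_zero.2 (hr (Z u)))
    rw [hZ']
    exact sum_inv_gram_pairing (G u) (hG.symm u) (fun i => E i u) (fun j => Φ (E j) u) (Z u)
  choose V hV using key
  refine ⟨V, hG.smoothGT_of_pairing fun Z hZ => ?_, fun Z hZ u => hV u Z hZ⟩
  simp only [hV _ Z hZ]
  exact hsm Z hZ

end Pairing
end

noncomputable section

/-! ### Tensor fields with three arguments -/

section Tensors

variable {m : ℕ}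
  {M : Type*} [TopologicalSpace M] [ChartedSpace (EuclideanSpace ℝ (Fin m)) M]
  [IsManifold (𝓡 m) ∞ M] [T2Space M]
  {N : Type*} [TopologicalSpace N] [ChartedSpace (EuclideanSpace ℝ (Fin m)) N]
  [IsManifold (𝓡 m) ∞ N] [T2Space N]
  {FF : Type*} [NormedAddCommGroup FF] [NormedSpace ℝ FF] [FiniteDimensional ℝ FF]
  {F : N → Type*} [TopologicalSpace (TotalSpace FF F)]
  [∀ y, AddCommGroup (F y)] [∀ y, Module ℝ (F y)] [∀ y, TopologicalSpace (F y)]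
  [FiberBundle FF F] [VectorBundle ℝ FF F] [ContMDiffVectorBundle ∞ FF F (𝓡 m)]
  {h : M ≃ₘ^∞⟮𝓡 m, 𝓡 m⟯ N} {η : N ≃ₘ^∞⟮𝓡 m, 𝓡 m⟯ M}
variable {FW : Type*} [NormedAddCommGroup FW] [NormedSpace ℝ FW] [FiniteDimensional ℝ FW]
  {W : M → Type*} [TopologicalSpace (TotalSpace FW W)]
  [∀ x, AddCommGroup (W x)] [∀ x, Module ℝ (W x)] [∀ x, TopologicalSpace (W x)]
  [FiberBundle FW W] [VectorBundle ℝ FW W] [ContMDiffVectorBundle ∞ FW W (𝓡 m)]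
  {A : GenLieAlgebroid FF F h η}
variable {C : RhoConnection FW W A} {G : ∀ u : TotalSpace FW W, LinearMap.BilinForm ℝ (A.GT u)}

lemma IsTensorialAt.fun_add {u : TotalSpace FW W} {Φ Ψ : (Π u : TotalSpace FW W, A.GT u) → ℝ}
    (hΦ : IsTensorialAt A u Φ) (hΨ : IsTensorialAt A u Ψ) :
    IsTensorialAt A u (fun X => Φ X + Ψ X) where
  add X Y hX hY := by rw [hΦ.add X Y hX hY, hΨ.add X Y hX hY]; ring
  smul f X hf hX := by rw [hΦ.smul f X hf hX, hΨ.smul f X hf hX]; ring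

lemma IsTensorialAt.const_mul {u : TotalSpace FW W} {Φ : (Π u : TotalSpace FW W, A.GT u) → ℝ}
    (hΦ : IsTensorialAt A u Φ) (c : ℝ) : IsTensorialAt A u (fun X => c * Φ X) where
  add X Y hX hY := by rw [hΦ.add X Y hX hY]; ring
  smul f X hf hX := by rw [hΦ.smul f X hf hX]; ring

/-- A smooth field of endomorphisms of the generalized tangent bundle. -/
structure SmoothEnd (A : GenLieAlgebroid FF F h η) where
  /-- the endomorphism of a fibre -/
  toLin : ∀ u : TotalSpace FW W, A.GT u →ₗ[ℝ] A.GT u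
  smooth : ∀ X : Π u : TotalSpace FW W, A.GT u, A.SmoothGT X →
    A.SmoothGT (fun u => toLin u (X u))

/-- The action on sections. -/
def SmoothEnd.app (P : SmoothEnd (FW := FW) (W := W) A) (X : Π u : TotalSpace FW W, A.GT u) :
    Π u : TotalSpace FW W, A.GT u :=
  fun u => P.toLin u (X u)

lemma SmoothEnd.smooth_app (P : SmoothEnd A) {X : Π u : TotalSpace FW W, A.GT u}
    (hX : A.SmoothGT X) : A.SmoothGT (P.app X) :=
  P.smooth X hX

lemma IsTensorialAt.comp {u : TotalSpace FW W} {Φ : (Π u : TotalSpace FW W, A.GT u) → ℝ}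
    (hΦ : IsTensorialAt A u Φ) (P : SmoothEnd A) : IsTensorialAt A u (fun X => Φ (P.app X)) where
  add X Y hX hY := by
    rw [← hΦ.add _ _ (P.smooth_app hX) (P.smooth_app hY)]
    exact congrArg Φ (funext fun v => map_add (P.toLin v) (X v) (Y v))
  smul f X hf hX := by
    rw [← hΦ.smul _ _ hf (P.smooth_app hX)]
    exact congrArg Φ (funext fun v => map_smul (P.toLin v) (f v) (X v))

/-- A smooth tensor field of type (0,3), as an operation on smooth sections which is `C^∞`-linear in
each argument. -/
structure IsTensor3 (A : GenLieAlgebroid FF F h η)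
    (σ : (Π u : TotalSpace FW W, A.GT u) → (Π u : TotalSpace FW W, A.GT u) →
      (Π u : TotalSpace FW W, A.GT u) → TotalSpace FW W → ℝ) : Prop where
  left : ∀ Y Z, A.SmoothGT Y → A.SmoothGT Z → ∀ u, IsTensorialAt A u fun X => σ X Y Z u
  mid : ∀ X Z, A.SmoothGT X → A.SmoothGT Z → ∀ u, IsTensorialAt A u fun Y => σ X Y Z u
  right : ∀ X Y, A.SmoothGT X → A.SmoothGT Y → ∀ u, IsTensorialAt A u fun Z => σ X Y Z u
  smooth : ∀ X Y Z, A.SmoothGT X → A.SmoothGT Y → A.SmoothGT Z →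
    ContMDiff ((𝓡 m).prod 𝓘(ℝ, FW)) 𝓘(ℝ, ℝ) ∞ (σ X Y Z)

variable {σ τ : (Π u : TotalSpace FW W, A.GT u) → (Π u : TotalSpace FW W, A.GT u) →
      (Π u : TotalSpace FW W, A.GT u) → TotalSpace FW W → ℝ}

lemma IsTensor3.add (hσ : IsTensor3 A σ) (hτ : IsTensor3 A τ) :
    IsTensor3 A (fun X Y Z u => σ X Y Z u + τ X Y Z u) where
  left Y Z hY hZ u := (hσ.left Y Z hY hZ u).fun_add (hτ.left Y Z hY hZ u)
  mid X Z hX hZ u := (hσ.mid X Z hX hZ u).fun_add (hτ.mid X Z hX hZ u)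
  right X Y hX hY u := (hσ.right X Y hX hY u).fun_add (hτ.right X Y hX hY u)
  smooth X Y Z hX hY hZ := (hσ.smooth X Y Z hX hY hZ).add (hτ.smooth X Y Z hX hY hZ)

lemma IsTensor3.const_mul (hσ : IsTensor3 A σ) (c : ℝ) :
    IsTensor3 A (fun X Y Z u => c * σ X Y Z u) where
  left Y Z hY hZ u := (hσ.left Y Z hY hZ u).const_mul c
  mid X Z hX hZ u := (hσ.mid X Z hX hZ u).const_mul c
  right X Y hX hY u := (hσ.right X Y hX hY u).const_mul c
  smooth X Y Z hX hY hZ := contMDiff_const.mul (hσ.smooth X Y Z hX hY hZ)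

lemma IsTensor3.swap_left (hσ : IsTensor3 A σ) : IsTensor3 A (fun X Y Z => σ Y X Z) where
  left Y Z hY hZ u := hσ.mid Y Z hY hZ u
  mid X Z hX hZ u := hσ.left X Z hX hZ u
  right X Y hX hY u := hσ.right Y X hY hX u
  smooth X Y Z hX hY hZ := hσ.smooth Y X Z hY hX hZ

lemma IsTensor3.swap_right (hσ : IsTensor3 A σ) : IsTensor3 A (fun X Y Z => σ X Z Y) where
  left Y Z hY hZ u := hσ.left Z Y hZ hY u
  mid X Z hX hZ u := hσ.right X Z hX hZ u
  right X Y hX hY u := hσ.mid X Y hX hY u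
  smooth X Y Z hX hY hZ := hσ.smooth X Z Y hX hZ hY

lemma IsTensor3.comp (hσ : IsTensor3 A σ) (P P' P'' : SmoothEnd A) :
    IsTensor3 A (fun X Y Z => σ (P.app X) (P'.app Y) (P''.app Z)) where
  left _ _ hY hZ u := (hσ.left _ _ (P'.smooth_app hY) (P''.smooth_app hZ) u).comp P
  mid _ _ hX hZ u := (hσ.mid _ _ (P.smooth_app hX) (P''.smooth_app hZ) u).comp P'
  right _ _ hX hY u := (hσ.right _ _ (P.smooth_app hX) (P'.smooth_app hY) u).comp P''
  smooth _ _ _ hX hY hZ := hσ.smooth _ _ _ (P.smooth_app hX) (P'.smooth_app hY) (P''.smooth_app hZ)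

/-- The covariant derivative of a pseudometrical structure is a tensor field. -/
lemma DLinearConnection.isTensor3_covTensor (D : DLinearConnection C)
    (hG : IsPseudoMetrical C G) : IsTensor3 A (D.covTensor G) := by
  have hmid : ∀ X Z, A.SmoothGT X → A.SmoothGT Z → ∀ u,
      IsTensorialAt A u fun Y => D.covTensor G X Y Z u := by
    intro X Z hX hZ u
    refine ⟨fun Y Y' hY hY' => ?_, fun f Y hf hY => ?_⟩
    · have h1 := A.act_add_right (X u) (hG.smooth Y Z hY hZ) (hG.smooth Y' Z hY' hZ)
      simp only [DLinearConnection.covTensor, D.add_right X Y Y' hX hY hY', Pi.add_apply, map_add,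
        LinearMap.add_apply, h1]
      ring
    · have h1 := A.act_mul (X u) hf (hG.smooth Y Z hY hZ)
      simp only [DLinearConnection.covTensor, D.leibniz f X Y hf hX hY, map_smul, map_add,
        LinearMap.add_apply, LinearMap.smul_apply, smul_eq_mul, h1]
      ring
  have hsymm : ∀ X Y Z u, D.covTensor G X Y Z u = D.covTensor G X Z Y u := by
    intro X Y Z u
    simp only [DLinearConnection.covTensor, hG.symm _ (Y _), hG.symm u _ (Z u)]
    ring
  refine ⟨fun Y Z hY hZ u => ⟨fun X X' hX hX' => ?_, fun f X hf hX => ?_⟩, hmid,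
    fun X Y hX hY u => ?_, fun X Y Z hX hY hZ => ?_⟩
  · simp only [DLinearConnection.covTensor, D.add_left X X' _ hX hX' hY,
      D.add_left X X' _ hX hX' hZ, Pi.add_apply, map_add, LinearMap.add_apply, A.act_add_left]
    ring
  · simp only [DLinearConnection.covTensor, D.smul_left f X _ hf hX hY,
      D.smul_left f X _ hf hX hZ, map_smul, LinearMap.smul_apply, smul_eq_mul, A.act_smul_left]
    ring
  · simp only [fun Z => hsymm X Y Z u]
    exact hmid X Y hX hY u
  · exact ((A.contMDiff_act hX (hG.smooth Y Z hY hZ)).sub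
      (hG.smooth _ _ (D.smooth X Y hX hY) hZ)).sub (hG.smooth _ _ hY (D.smooth X Z hX hZ))

lemma DLinearConnection.covTensor_symm (D : DLinearConnection C) (hG : IsPseudoMetrical C G)
    (X Y Z : Π u : TotalSpace FW W, A.GT u) (u : TotalSpace FW W) :
    D.covTensor G X Y Z u = D.covTensor G X Z Y u := by
  simp only [DLinearConnection.covTensor, hG.symm _ (Y _), hG.symm u _ (Z u)]
  ring

/-- The covariant derivative of the metric has no mixed components, since the connection preserves
the splitting and the metric has none. -/
lemma DLinearConnection.covTensor_mixed (D : DLinearConnection C) (hG : IsPseudoMetrical C G)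
    {X Y Z : Π u : TotalSpace FW W, A.GT u} (hX : A.SmoothGT X) (hY : A.SmoothGT Y)
    (hZ : A.SmoothGT Z) (hYh : ∀ u, Y u ∈ C.hor u) (hZv : ∀ u, Z u ∈ A.vert u)
    (u : TotalSpace FW W) : D.covTensor G X Y Z u = 0 := by
  have h1 : (fun v => G v (Y v) (Z v)) = fun _ => 0 :=
    funext fun v => hG.mixed v _ (hYh v) _ (hZv v)
  have h2 : A.act u (X u) (fun _ => (0 : ℝ)) = 0 := by
    rw [GenLieAlgebroid.act, dirDeriv, mfderiv_const]
    rfl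
  rw [DLinearConnection.covTensor, h1, h2, hG.mixed u _ (D.horizontal X Y hX hY hYh u) _ (hZv u),
    hG.mixed u _ (hYh u) _ (D.vertical X Z hX hZ hZv u)]
  simp

/-- The vertical projection. -/
def RhoConnection.vProj (C : RhoConnection FW W A) : SmoothEnd (FW := FW) (W := W) A where
  toLin := C.Γ
  smooth := C.smooth

/-- The horizontal projection. -/
def RhoConnection.hProj (C : RhoConnection FW W A) : SmoothEnd (FW := FW) (W := W) A where
  toLin u := LinearMap.id - C.Γ u
  smooth X hX := hX.sub (C.smooth X hX)

lemma RhoConnection.hProj_mem (X : Π u : TotalSpace FW W, A.GT u) (u : TotalSpace FW W) :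
    C.hProj.app X u ∈ C.hor u :=
  C.sub_mem_hor u (X u)

lemma RhoConnection.vProj_mem (X : Π u : TotalSpace FW W, A.GT u) (u : TotalSpace FW W) :
    C.vProj.app X u ∈ A.vert u :=
  C.mem_vert u (X u)

lemma RhoConnection.hProj_add_vProj (X : Π u : TotalSpace FW W, A.GT u) :
    C.hProj.app X + C.vProj.app X = X :=
  funext fun u => sub_add_cancel (X u) (C.Γ u (X u))

lemma RhoConnection.hProj_of_hor {X : Π u : TotalSpace FW W, A.GT u}
    (hX : ∀ u, X u ∈ C.hor u) : C.hProj.app X = X :=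
  funext fun u => by
    have h1 : C.Γ u (X u) = 0 := hX u
    change X u - C.Γ u (X u) = X u
    rw [h1, sub_zero]

lemma RhoConnection.vProj_of_hor {X : Π u : TotalSpace FW W, A.GT u}
    (hX : ∀ u, X u ∈ C.hor u) : C.vProj.app X = 0 :=
  funext fun u => hX u

lemma RhoConnection.vProj_of_vert {X : Π u : TotalSpace FW W, A.GT u}
    (hX : ∀ u, X u ∈ A.vert u) : C.vProj.app X = X :=
  funext fun u => C.split u _ (hX u)

lemma RhoConnection.hProj_of_vert {X : Π u : TotalSpace FW W, A.GT u}
    (hX : ∀ u, X u ∈ A.vert u) : C.hProj.app X = 0 :=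
  funext fun u => by
    change X u - C.Γ u (X u) = 0
    rw [C.split u _ (hX u), sub_self]

end Tensors
end

noncomputable section

/-! ### The Koszul correction along a subbundle -/

section Koszul

variable {m : ℕ}
  {M : Type*} [TopologicalSpace M] [ChartedSpace (EuclideanSpace ℝ (Fin m)) M]
  [IsManifold (𝓡 m) ∞ M] [T2Space M]
  {N : Type*} [TopologicalSpace N] [ChartedSpace (EuclideanSpace ℝ (Fin m)) N]
  [IsManifold (𝓡 m) ∞ N] [T2Space N]
  {FF : Type*} [NormedAddCommGroup FF] [NormedSpace ℝ FF] [FiniteDimensional ℝ FF]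
  {F : N → Type*} [TopologicalSpace (TotalSpace FF F)]
  [∀ y, AddCommGroup (F y)] [∀ y, Module ℝ (F y)] [∀ y, TopologicalSpace (F y)]
  [FiberBundle FF F] [VectorBundle ℝ FF F] [ContMDiffVectorBundle ∞ FF F (𝓡 m)]
  {h : M ≃ₘ^∞⟮𝓡 m, 𝓡 m⟯ N} {η : N ≃ₘ^∞⟮𝓡 m, 𝓡 m⟯ M}
variable {FW : Type*} [NormedAddCommGroup FW] [NormedSpace ℝ FW] [FiniteDimensional ℝ FW]
  {W : M → Type*} [TopologicalSpace (TotalSpace FW W)]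
  [∀ x, AddCommGroup (W x)] [∀ x, Module ℝ (W x)] [∀ x, TopologicalSpace (W x)]
  [FiberBundle FW W] [VectorBundle ℝ FW W] [ContMDiffVectorBundle ∞ FW W (𝓡 m)]
  {A : GenLieAlgebroid FF F h η}
variable {C : RhoConnection FW W A} {G : ∀ u : TotalSpace FW W, LinearMap.BilinForm ℝ (A.GT u)}
variable {B : Type*} [TopologicalSpace B] [T2Space B]
    [ChartedSpace (EuclideanSpace ℝ (Fin m)) B] [IsManifold (𝓡 m) ∞ B] {FV : Type*}
    [NormedAddCommGroup FV] [NormedSpace ℝ FV] [FiniteDimensional ℝ FV] {V : B → Type*}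
    [TopologicalSpace (TotalSpace FV V)] [∀ b, AddCommGroup (V b)] [∀ b, Module ℝ (V b)]
    [∀ b, TopologicalSpace (V b)] [FiberBundle FV V] [VectorBundle ℝ FV V]
    [ContMDiffVectorBundle ∞ FV V (𝓡 m)]

variable (m FV) in
/-- A smooth section through a given element. -/
def sectionThrough {b : B} (z : V b) : Π b, V b :=
  (exists_smooth_section_through (𝓡 m) (FV := FV) z).choose

lemma smooth_sectionThrough {b : B} (z : V b) : IsSmoothSec m FV (sectionThrough m FV z) :=
  (exists_smooth_section_through (𝓡 m) (FV := FV) z).choose_spec.1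

lemma sectionThrough_self {b : B} (z : V b) : sectionThrough m FV z b = z :=
  (exists_smooth_section_through (𝓡 m) (FV := FV) z).choose_spec.2

variable (FW W A FV V) in
/-- A subbundle of the generalized tangent bundle, given as the image of an injective lift of the
pullback along `q` of a bundle `V`, with a smooth projection onto it, and with a bracket of the lifts
of sections of `V`, which takes values in the generalized tangent bundle. Both the horizontal
subbundle (for `V = F` and the bracket of the algebroid) and the vertical subbundle (for `V = W` and
the zero bracket) are of this form. -/
structure LiftedBundle where
  /-- the map along which `V` is pulled back -/
  q : TotalSpace FW W → B
  smooth_q : ContMDiff ((𝓡 m).prod 𝓘(ℝ, FW)) (𝓡 m) ∞ q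
  /-- the lift -/
  lam : ∀ u : TotalSpace FW W, V (q u) →ₗ[ℝ] A.GT u
  /-- a left inverse of the lift -/
  coord : ∀ u : TotalSpace FW W, A.GT u →ₗ[ℝ] V (q u)
  coord_lam : ∀ u z, coord u (lam u z) = z
  smooth_lam : ∀ s, IsSmoothSec m FV s → A.SmoothGT (fun u => lam u (s (q u)))
  smooth_proj : ∀ X, A.SmoothGT X → A.SmoothGT (fun u => lam u (coord u (X u)))
  /-- the bracket of the lifts of two sections -/
  bracket : (Π b, V b) → (Π b, V b) → Π u : TotalSpace FW W, A.GT u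
  bracket_smooth : ∀ s s', IsSmoothSec m FV s → IsSmoothSec m FV s' → A.SmoothGT (bracket s s')
  bracket_add : ∀ s s' s'', IsSmoothSec m FV s → IsSmoothSec m FV s' → IsSmoothSec m FV s'' →
    bracket s (s' + s'') = bracket s s' + bracket s s''
  bracket_skew : ∀ s s', IsSmoothSec m FV s → IsSmoothSec m FV s' → bracket s' s = -bracket s s'
  leibniz : ∀ (f : B → ℝ) (s s'), ContMDiff (𝓡 m) 𝓘(ℝ, ℝ) ∞ f → IsSmoothSec m FV s →
    IsSmoothSec m FV s' → ∀ u, bracket s (fun b => f b • s' b) u =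
      f (q u) • bracket s s' u + A.act u (lam u (s (q u))) (fun v => f (q v)) • lam u (s' (q u))

namespace LiftedBundle

variable (S : LiftedBundle FW W A FV V) (D : DLinearConnection C)

/-- The lift of a section. -/
def sec (s : Π b, V b) (u : TotalSpace FW W) : A.GT u := S.lam u (s (S.q u))

/-- The projection onto the subbundle. -/
def proj : SmoothEnd (FW := FW) (W := W) A where
  toLin u := S.lam u ∘ₗ S.coord u
  smooth := S.smooth_proj

lemma smooth_sec {s : Π b, V b} (hs : IsSmoothSec m FV s) : A.SmoothGT (S.sec s) :=
  S.smooth_lam s hs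

lemma sec_add (s s' : Π b, V b) : S.sec (s + s') = S.sec s + S.sec s' :=
  funext fun u => map_add (S.lam u) _ _

lemma sec_smul (f : B → ℝ) (s : Π b, V b) :
    S.sec (fun b => f b • s b) = fun u => f (S.q u) • S.sec s u :=
  funext fun u => map_smul (S.lam u) _ _

lemma smooth_comp_q {f : B → ℝ} (hf : ContMDiff (𝓡 m) 𝓘(ℝ, ℝ) ∞ f) :
    ContMDiff ((𝓡 m).prod 𝓘(ℝ, FW)) 𝓘(ℝ, ℝ) ∞ (fun u => f (S.q u)) :=
  hf.comp S.smooth_q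

/-- The torsion of `D` on the lifts of two sections. -/
def torsion (s s' : Π b, V b) : Π u : TotalSpace FW W, A.GT u :=
  D.D (S.sec s) (S.sec s') - D.D (S.sec s') (S.sec s) - S.bracket s s'

lemma smooth_torsion {s s' : Π b, V b} (hs : IsSmoothSec m FV s) (hs' : IsSmoothSec m FV s') :
    A.SmoothGT (S.torsion D s s') :=
  ((D.smooth _ _ (S.smooth_sec hs) (S.smooth_sec hs')).sub
    (D.smooth _ _ (S.smooth_sec hs') (S.smooth_sec hs))).sub (S.bracket_smooth s s' hs hs')

lemma torsion_skew {s s' : Π b, V b} (hs : IsSmoothSec m FV s) (hs' : IsSmoothSec m FV s') :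
    S.torsion D s' s = -S.torsion D s s' := by
  rw [torsion, torsion, S.bracket_skew s s' hs hs']
  abel

lemma torsion_add {s s' s'' : Π b, V b} (hs : IsSmoothSec m FV s) (hs' : IsSmoothSec m FV s')
    (hs'' : IsSmoothSec m FV s'') :
    S.torsion D s (s' + s'') = S.torsion D s s' + S.torsion D s s'' := by
  rw [torsion, torsion, torsion, S.bracket_add s s' s'' hs hs' hs'', sec_add,
    D.add_right _ _ _ (S.smooth_sec hs) (S.smooth_sec hs') (S.smooth_sec hs''),
    D.add_left _ _ _ (S.smooth_sec hs') (S.smooth_sec hs'') (S.smooth_sec hs)]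
  abel

/-- The two terms in the derivative of `f`, from the connection and from the bracket, cancel. -/
lemma torsion_smul {f : B → ℝ} (hf : ContMDiff (𝓡 m) 𝓘(ℝ, ℝ) ∞ f) {s s' : Π b, V b}
    (hs : IsSmoothSec m FV s) (hs' : IsSmoothSec m FV s') (u : TotalSpace FW W) :
    S.torsion D s (fun b => f b • s' b) u = f (S.q u) • S.torsion D s s' u := by
  rw [torsion, torsion, sec_smul,
    D.leibniz _ _ _ (S.smooth_comp_q hf) (S.smooth_sec hs) (S.smooth_sec hs'),
    D.smul_left _ _ _ (S.smooth_comp_q hf) (S.smooth_sec hs') (S.smooth_sec hs)]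
  simp only [Pi.sub_apply, S.leibniz f s s' hf hs hs' u, smul_sub]
  change _ + A.act u (S.lam u (s (S.q u))) (fun v => f (S.q v)) • S.lam u (s' (S.q u)) - _ - _ = _
  abel

lemma torsion_eq_right {s s' s'' : Π b, V b} (hs : IsSmoothSec m FV s)
    (hs' : IsSmoothSec m FV s') (hs'' : IsSmoothSec m FV s'') {u : TotalSpace FW W}
    (h1 : s' (S.q u) = s'' (S.q u)) : S.torsion D s s' u = S.torsion D s s'' u := by
  have hsub : IsSmoothSec m FV (s' - s'') := ContMDiff.sub_section hs' hs''
  have key := eq_zero_of_tensorial (𝓡 m) (b := S.q u) (fun s' => S.torsion D s s' u)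
    (fun s' s'' hs' hs'' => congrFun (S.torsion_add D hs hs' hs'') u)
    (fun f s' hf hs' => S.torsion_smul D hf hs hs' u) (s := s' - s'') hsub (by simp [h1])
  have h2 := congrFun (S.torsion_add D hs hsub hs'') u
  rwa [sub_add_cancel, Pi.add_apply, key, zero_add] at h2

/-- The torsion is tensorial: at `u` it depends only on the values of the sections at `q u`. -/
lemma torsion_eq_of_eq {s₁ s₂ s₁' s₂' : Π b, V b} (hs₁ : IsSmoothSec m FV s₁)
    (hs₂ : IsSmoothSec m FV s₂) (hs₁' : IsSmoothSec m FV s₁') (hs₂' : IsSmoothSec m FV s₂')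
    {u : TotalSpace FW W} (h1 : s₁ (S.q u) = s₁' (S.q u)) (h2 : s₂ (S.q u) = s₂' (S.q u)) :
    S.torsion D s₁ s₂ u = S.torsion D s₁' s₂' u := by
  rw [S.torsion_eq_right D hs₁ hs₂ hs₂' h2, S.torsion_skew D hs₂' hs₁, Pi.neg_apply,
    S.torsion_eq_right D hs₂' hs₁ hs₁' h1, S.torsion_skew D hs₁' hs₂', Pi.neg_apply, neg_neg]

/-- The torsion at a point, as a function of two elements of the fibre. -/
def torAt (u : TotalSpace FW W) (z z' : V (S.q u)) : A.GT u :=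
  S.torsion D (sectionThrough m FV z) (sectionThrough m FV z') u

lemma torAt_eq {s s' : Π b, V b} (hs : IsSmoothSec m FV s) (hs' : IsSmoothSec m FV s')
    {u : TotalSpace FW W} {z z' : V (S.q u)} (h1 : s (S.q u) = z) (h2 : s' (S.q u) = z') :
    S.torAt D u z z' = S.torsion D s s' u :=
  S.torsion_eq_of_eq D (smooth_sectionThrough z) (smooth_sectionThrough z') hs hs'
    ((sectionThrough_self z).trans h1.symm) ((sectionThrough_self z').trans h2.symm)

lemma torAt_skew (u : TotalSpace FW W) (z z' : V (S.q u)) :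
    S.torAt D u z' z = -S.torAt D u z z' :=
  congrFun (S.torsion_skew D (smooth_sectionThrough z) (smooth_sectionThrough z')) u

lemma torAt_add_right (u : TotalSpace FW W) (z z' z'' : V (S.q u)) :
    S.torAt D u z (z' + z'') = S.torAt D u z z' + S.torAt D u z z'' := by
  have h1 := smooth_sectionThrough (m := m) (FV := FV) z
  have h2 := smooth_sectionThrough (m := m) (FV := FV) z'
  have h3 := smooth_sectionThrough (m := m) (FV := FV) z''
  rw [S.torAt_eq D h1 (ContMDiff.add_section h2 h3) (sectionThrough_self z) (z' := z' + z'')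
    (by rw [Pi.add_apply, sectionThrough_self, sectionThrough_self])]
  exact congrFun (S.torsion_add D h1 h2 h3) u

lemma torAt_smul_right (u : TotalSpace FW W) (c : ℝ) (z z' : V (S.q u)) :
    S.torAt D u z (c • z') = c • S.torAt D u z z' := by
  have h1 := smooth_sectionThrough (m := m) (FV := FV) z
  have h2 := smooth_sectionThrough (m := m) (FV := FV) z'
  rw [S.torAt_eq D h1 (s' := fun b => c • sectionThrough m FV z' b)
    (ContMDiff.const_smul_section h2) (sectionThrough_self z) (z' := c • z')
    (by rw [sectionThrough_self])]
  exact S.torsion_smul D (f := fun _ => c) contMDiff_const h1 h2 u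

/-- The torsion tensor at a point. -/
def torLin (u : TotalSpace FW W) : V (S.q u) →ₗ[ℝ] V (S.q u) →ₗ[ℝ] A.GT u :=
  LinearMap.mk₂ ℝ (S.torAt D u)
    (fun z z' z'' => by
      rw [S.torAt_skew D u z'', S.torAt_add_right, S.torAt_skew D u z z'', S.torAt_skew D u z' z'']
      abel)
    (fun c z z' => by
      rw [S.torAt_skew D u z', S.torAt_smul_right, S.torAt_skew D u z z', smul_neg, neg_neg])
    (S.torAt_add_right D u) (S.torAt_smul_right D u)

/-- The torsion tensor on sections. -/
def tor (X Y : Π u : TotalSpace FW W, A.GT u) (u : TotalSpace FW W) : A.GT u :=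
  S.torLin D u (S.coord u (X u)) (S.coord u (Y u))

lemma tor_skew (X Y : Π u : TotalSpace FW W, A.GT u) (u : TotalSpace FW W) :
    S.tor D Y X u = -S.tor D X Y u :=
  S.torAt_skew D u _ _

lemma tor_sec {s s' : Π b, V b} (hs : IsSmoothSec m FV s) (hs' : IsSmoothSec m FV s')
    (u : TotalSpace FW W) : S.tor D (S.sec s) (S.sec s') u = S.torsion D s s' u :=
  S.torAt_eq D hs hs' (S.coord_lam u _).symm (S.coord_lam u _).symm

/-- The coordinates of the projection of a smooth section, in a local frame of `V`, are smooth if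
the metric is nondegenerate on the subbundle. -/
lemma exists_coordinates (hG : IsPseudoMetrical C G)
    (hnd : ∀ u, ((G u).restrict (LinearMap.range (S.lam u))).Nondegenerate)
    (u₀ : TotalSpace FW W) : ∃ (n : ℕ) (s : Fin n → Π b, V b), (∀ i, IsSmoothSec m FV (s i)) ∧
      ∀ X, A.SmoothGT X → ∃ c : Fin n → TotalSpace FW W → ℝ,
        (∀ i, ContMDiffAt ((𝓡 m).prod 𝓘(ℝ, FW)) 𝓘(ℝ, ℝ) ∞ (c i) u₀) ∧
        ∀ᶠ u in 𝓝 u₀, S.coord u (X u) = ∑ i, c i u • s i (S.q u) := by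
  obtain ⟨s, hs, hsb⟩ := exists_smooth_frame (m := m) (FV := FV) (V := V) (S.q u₀)
  have hE : ∀ i, A.SmoothGT (S.sec (s i)) := fun i => S.smooth_sec (hs i)
  have hrep : ∀ᶠ u in 𝓝 u₀, (gram G (fun i => S.sec (s i)) u).det ≠ 0 ∧
      ∀ v ∈ LinearMap.range (S.lam u), v = ∑ i, (∑ j, (gram G (fun i => S.sec (s i)) u)⁻¹ i j *
        G u v (S.sec (s j) u)) • S.sec (s i) u := by
    filter_upwards [(S.smooth_q.continuous.tendsto u₀).eventually hsb] with u hu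
    refine gram_repr (G u) (hG.symm u) (hnd u) (hu.1.map' (S.lam u) ?_) ?_
    · exact LinearMap.ker_eq_bot.2 (Function.LeftInverse.injective (S.coord_lam u))
    · rw [LinearMap.range_eq_map, ← top_le_iff.1 hu.2, Submodule.map_span, ← Set.range_comp]
      rfl
  refine ⟨_, s, hs, fun X hX => ⟨fun i u => ∑ j, (gram G (fun i => S.sec (s i)) u)⁻¹ i j *
        G u (S.proj.app X u) (S.sec (s j) u), fun i => ?_, ?_⟩⟩
  · have hinv := ContMDiffAt.matrix_inv (g := gram G (fun i => S.sec (s i)))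
      (fun i j => hG.smooth _ _ (hE i) (hE j) u₀) hrep.self_of_nhds.1
    exact contMDiffAt_finsetSum fun j _ =>
      (hinv i j).mul (hG.smooth _ _ (S.proj.smooth_app hX) (hE j) u₀)
  · filter_upwards [hrep] with u hu
    have h1 := congrArg (S.coord u) (hu.2 (S.proj.app X u) ⟨_, rfl⟩)
    rw [map_sum] at h1
    refine (S.coord_lam u _).symm.trans (h1.trans (Finset.sum_congr rfl fun i _ => ?_))
    rw [map_smul]
    exact congrArg _ (S.coord_lam u _)

/-- In local frames the torsion tensor is a combination, with smooth coefficients, of the torsions of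
pairs of smooth sections. -/
lemma smooth_tor (hG : IsPseudoMetrical C G)
    (hnd : ∀ u, ((G u).restrict (LinearMap.range (S.lam u))).Nondegenerate)
    {X Y : Π u : TotalSpace FW W, A.GT u} (hX : A.SmoothGT X) (hY : A.SmoothGT Y) :
    A.SmoothGT (S.tor D X Y) := by
  refine A.smoothGT_of_smoothGTAt fun u₀ => ?_
  obtain ⟨n, s, hs, hc⟩ := S.exists_coordinates hG hnd u₀
  obtain ⟨c, hc1, hcX⟩ := hc X hX
  obtain ⟨d, hd1, hdY⟩ := hc Y hY
  refine GenLieAlgebroid.SmoothGTAt.congr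
    (GenLieAlgebroid.SmoothGTAt.sum_smul Finset.univ hd1 fun j =>
      GenLieAlgebroid.SmoothGTAt.sum_smul Finset.univ hc1 fun i =>
        (S.smooth_torsion D (hs i) (hs j)).smoothGTAt u₀) ?_
  filter_upwards [hcX, hdY] with u h1 h2
  rw [tor, h1, h2]
  simp only [map_sum, map_smul, LinearMap.sum_apply, LinearMap.smul_apply]
  refine Finset.sum_congr rfl fun j _ => congrArg _ ?_
  refine Finset.sum_congr rfl fun i _ => congrArg _ ?_
  exact S.torAt_eq D (hs i) (hs j) rfl rfl

lemma isTensor3_tor (hG : IsPseudoMetrical C G)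
    (hnd : ∀ u, ((G u).restrict (LinearMap.range (S.lam u))).Nondegenerate) :
    IsTensor3 A (fun X Y Z u => G u (S.tor D X Y u) (Z u)) where
  left Y Z _ _ u := ⟨fun X X' _ _ => by
      simp only [tor, Pi.add_apply, map_add, LinearMap.add_apply], fun f X _ _ => by
      simp only [tor, map_smul, LinearMap.smul_apply, smul_eq_mul]⟩
  mid X Z _ _ u := ⟨fun X X' _ _ => by
      simp only [tor, Pi.add_apply, map_add, LinearMap.add_apply], fun f X _ _ => by
      simp only [tor, map_smul, LinearMap.smul_apply, smul_eq_mul]⟩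
  right X Y _ _ u := ⟨fun Z Z' _ _ => by
      simp only [Pi.add_apply, map_add], fun f X _ _ => by
      simp only [map_smul, smul_eq_mul]⟩
  smooth X Y Z hX hY hZ := hG.smooth _ _ (S.smooth_tor D hG hnd hX hY) hZ

variable (G) in
/-- The difference between the Koszul expression of the metric and the given connection. It is
written through the covariant derivative of the metric and the torsion of the given connection, so
that it is visibly a tensor field. -/
def koszul (X Y Z : Π u : TotalSpace FW W, A.GT u) (u : TotalSpace FW W) : ℝ :=
  1 / 2 * (D.covTensor G X Y Z u + D.covTensor G Y X Z u + -1 * D.covTensor G Z X Y u +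
    -1 * G u (S.tor D X Y u) (Z u) + G u (S.tor D X Z u) (Y u) + G u (S.tor D Y Z u) (X u))

lemma isTensor3_koszul (hG : IsPseudoMetrical C G)
    (hnd : ∀ u, ((G u).restrict (LinearMap.range (S.lam u))).Nondegenerate) :
    IsTensor3 A (S.koszul G D) := by
  have hQ := D.isTensor3_covTensor hG
  have hT := S.isTensor3_tor D hG hnd
  exact (((((hQ.add hQ.swap_left).add (hQ.swap_left.swap_right.const_mul (-1))).add
    (hT.const_mul (-1))).add hT.swap_right).add hT.swap_right.swap_left).const_mul (1 / 2)

/-- The symmetrization of the Koszul correction is the covariant derivative of the metric, so that the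
corrected connection is metric along the subbundle. -/
lemma koszul_add_koszul (hG : IsPseudoMetrical C G) (X Y Z : Π u : TotalSpace FW W, A.GT u)
    (u : TotalSpace FW W) :
    S.koszul G D X Y Z u + S.koszul G D X Z Y u = D.covTensor G X Y Z u := by
  rw [koszul, koszul, D.covTensor_symm hG X Z Y, S.tor_skew D Y Z u, map_neg,
    LinearMap.neg_apply]
  ring

/-- The corrected connection is given on lifts by the Koszul formula. -/
lemma koszul_sec (hG : IsPseudoMetrical C G) {s₁ s₂ s₃ : Π b, V b} (h1 : IsSmoothSec m FV s₁)
    (h2 : IsSmoothSec m FV s₂) (h3 : IsSmoothSec m FV s₃) (u : TotalSpace FW W) :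
    G u (D.D (S.sec s₁) (S.sec s₂) u) (S.sec s₃ u) +
      S.koszul G D (S.sec s₁) (S.sec s₂) (S.sec s₃) u =
    1 / 2 * (A.act u (S.sec s₁ u) (fun v => G v (S.sec s₃ v) (S.sec s₂ v)) +
      A.act u (S.sec s₂ u) (fun v => G v (S.sec s₃ v) (S.sec s₁ v)) -
      A.act u (S.sec s₃ u) (fun v => G v (S.sec s₂ v) (S.sec s₁ v)) +
      G u (S.bracket s₁ s₂ u) (S.sec s₃ u) - G u (S.bracket s₁ s₃ u) (S.sec s₂ u) -
      G u (S.bracket s₂ s₃ u) (S.sec s₁ u)) := by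
  simp only [koszul, S.tor_sec D h1 h2, S.tor_sec D h1 h3, S.tor_sec D h2 h3, torsion,
    DLinearConnection.covTensor, Pi.sub_apply, map_sub, LinearMap.sub_apply]
  simp only [hG.symm _ (S.sec s₃ _), hG.symm _ (S.sec s₂ _) (S.sec s₁ _),
    hG.symm u (S.sec s₂ u) (D.D _ _ u), hG.symm u (S.sec s₁ u) (D.D _ _ u)]
  ring

end LiftedBundle

end Koszul
end

noncomputable section

/-! ### The metric connection -/

section Metric

variable {m : ℕ}
  {M : Type*} [TopologicalSpace M] [ChartedSpace (EuclideanSpace ℝ (Fin m)) M]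
  [IsManifold (𝓡 m) ∞ M] [T2Space M]
  {N : Type*} [TopologicalSpace N] [ChartedSpace (EuclideanSpace ℝ (Fin m)) N]
  [IsManifold (𝓡 m) ∞ N] [T2Space N]
  {FF : Type*} [NormedAddCommGroup FF] [NormedSpace ℝ FF] [FiniteDimensional ℝ FF]
  {F : N → Type*} [TopologicalSpace (TotalSpace FF F)]
  [∀ y, AddCommGroup (F y)] [∀ y, Module ℝ (F y)] [∀ y, TopologicalSpace (F y)]
  [FiberBundle FF F] [VectorBundle ℝ FF F] [ContMDiffVectorBundle ∞ FF F (𝓡 m)]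
  {h : M ≃ₘ^∞⟮𝓡 m, 𝓡 m⟯ N} {η : N ≃ₘ^∞⟮𝓡 m, 𝓡 m⟯ M}
variable {FW : Type*} [NormedAddCommGroup FW] [NormedSpace ℝ FW] [FiniteDimensional ℝ FW]
  {W : M → Type*} [TopologicalSpace (TotalSpace FW W)]
  [∀ x, AddCommGroup (W x)] [∀ x, Module ℝ (W x)] [∀ x, TopologicalSpace (W x)]
  [FiberBundle FW W] [VectorBundle ℝ FW W] [ContMDiffVectorBundle ∞ FW W (𝓡 m)]
  {A : GenLieAlgebroid FF F h η}
variable {C : RhoConnection FW W A} {G : ∀ u : TotalSpace FW W, LinearMap.BilinForm ℝ (A.GT u)}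

variable (C) in
/-- The horizontal subbundle, as the lift of the pullback of `F`. -/
def RhoConnection.horBundle : LiftedBundle FW W A FF F where
  q u := h u.proj
  smooth_q := h.contMDiff.comp (contMDiff_proj W)
  lam := C.liftₗ
  coord := A.pr
  coord_lam u z := (C.lift_spec u z).1
  smooth_lam _ hs := C.smoothGT_lift hs
  smooth_proj X hX := by
    simp only [C.lift_pr]
    exact hX.sub (C.smooth X hX)
  bracket s s' u := C.liftₗ u (A.bracket s s' (h u.proj))
  bracket_smooth s s' hs hs' := C.smoothGT_lift (A.bracket_smooth s s' hs hs')
  bracket_add s s' s'' hs hs' hs'' := by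
    rw [A.bracket_add s s' s'' hs hs' hs'']
    exact funext fun u => map_add (C.liftₗ u) _ _
  bracket_skew s s' hs hs' := by
    rw [A.bracket_skew s s' hs hs']
    exact funext fun u => map_neg (C.liftₗ u) _
  leibniz f s s' hf hs hs' u := by
    rw [A.leibniz f s s' hf hs hs', map_add, map_smul, map_smul, C.act_lift_comp_proj hf]

variable (C) in
/-- The vertical subbundle, as the lift of the pullback of `W`; vertical lifts commute. -/
def RhoConnection.vertBundle : LiftedBundle FW W A FW W where
  q u := u.proj
  smooth_q := contMDiff_proj W
  lam := A.dotₗ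
  coord u := ((A.dotₗ u).exists_leftInverse_of_injective
    (LinearMap.ker_eq_bot.2 (A.dotₗ_injective u))).choose ∘ₗ C.Γ u
  coord_lam u z := by
    rw [LinearMap.comp_apply, C.split u (A.dotₗ u z) (A.dot_mem_vert u z)]
    exact DFunLike.congr_fun ((A.dotₗ u).exists_leftInverse_of_injective
      (LinearMap.ker_eq_bot.2 (A.dotₗ_injective u))).choose_spec z
  smooth_lam _ hs := A.smoothGT_dot hs
  smooth_proj X hX := by
    convert! C.smooth X hX using 2 with u
    have hΓ := C.mem_vert u (X u)
    rw [← A.range_dotₗ] at hΓ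
    obtain ⟨z, hz⟩ := hΓ
    rw [LinearMap.comp_apply, ← hz]
    exact congrArg _ (DFunLike.congr_fun ((A.dotₗ u).exists_leftInverse_of_injective
      (LinearMap.ker_eq_bot.2 (A.dotₗ_injective u))).choose_spec z)
  bracket _ _ := 0
  bracket_smooth _ _ _ _ := A.smoothGT_zero
  bracket_add _ _ _ _ _ _ := (add_zero _).symm
  bracket_skew _ _ _ _ := neg_zero.symm
  leibniz f s s' hf hs hs' u := by
    rw [A.act_dot_comp_proj _ hf, zero_smul, add_zero, Pi.zero_apply, smul_zero]

lemma IsPseudoMetrical.nondegenerate_horBundle (hG : IsPseudoMetrical C G)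
    (u : TotalSpace FW W) :
    ((G u).restrict (LinearMap.range (C.horBundle.lam u))).Nondegenerate := by
  have h1 : LinearMap.range (C.horBundle.lam u) = C.hor u := C.range_liftₗ u
  rw [h1]
  exact hG.nondegenerate_hor u

lemma IsPseudoMetrical.nondegenerate_vertBundle (hG : IsPseudoMetrical C G)
    (u : TotalSpace FW W) :
    ((G u).restrict (LinearMap.range (C.vertBundle.lam u))).Nondegenerate := by
  have h1 : LinearMap.range (C.vertBundle.lam u) = A.vert u := A.range_dotₗ u
  rw [h1]
  exact hG.nondegenerate_vert u

lemma RhoConnection.sec_mem_hor (s : Π y, F y) (u : TotalSpace FW W) :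
    C.horBundle.sec s u ∈ C.hor u :=
  (C.lift_spec u _).2

lemma RhoConnection.sec_mem_vert (s : Π x, W x) (u : TotalSpace FW W) :
    C.vertBundle.sec s u ∈ A.vert u :=
  A.dot_mem_vert u _

/-- Sections are determined by their pairings with the smooth sections. -/
lemma IsPseudoMetrical.section_ext (hG : IsPseudoMetrical C G)
    {V V' : Π u : TotalSpace FW W, A.GT u}
    (hV : ∀ Z, A.SmoothGT Z → ∀ u, G u (V u) (Z u) = G u (V' u) (Z u)) : V = V' := by
  funext u
  refine sub_eq_zero.1 (hG.eq_zero_of_pairing fun Z => ?_)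
  obtain ⟨Z, hZ, rfl⟩ := C.exists_section_through Z
  rw [map_sub, LinearMap.sub_apply, hV Z hZ, sub_self]

set_option maxHeartbeats 1000000 in
/-- A connection can be changed by a tensor field without mixed parts. -/
lemma DLinearConnection.exists_add_tensor (D₀ : DLinearConnection C) (hG : IsPseudoMetrical C G)
    {σ : (Π u : TotalSpace FW W, A.GT u) → (Π u : TotalSpace FW W, A.GT u) →
      (Π u : TotalSpace FW W, A.GT u) → TotalSpace FW W → ℝ} (hσ : IsTensor3 A σ)
    (hhv : ∀ X Y Z, A.SmoothGT X → A.SmoothGT Y → A.SmoothGT Z → (∀ u, Y u ∈ C.hor u) →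
      (∀ u, Z u ∈ A.vert u) → ∀ u, σ X Y Z u = 0)
    (hvh : ∀ X Y Z, A.SmoothGT X → A.SmoothGT Y → A.SmoothGT Z → (∀ u, Y u ∈ A.vert u) →
      (∀ u, Z u ∈ C.hor u) → ∀ u, σ X Y Z u = 0) :
    ∃ D : DLinearConnection C, ∀ X Y Z, A.SmoothGT X → A.SmoothGT Y → A.SmoothGT Z → ∀ u,
      G u (D.D X Y u) (Z u) = G u (D₀.D X Y u) (Z u) + σ X Y Z u := by
  have hex : ∀ X Y : Π u : TotalSpace FW W, A.GT u, ∃ V : Π u : TotalSpace FW W, A.GT u,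
      A.SmoothGT X → A.SmoothGT Y → A.SmoothGT V ∧ ∀ Z, A.SmoothGT Z → ∀ u,
        G u (V u) (Z u) = σ X Y Z u := by
    intro X Y
    by_cases hXY : A.SmoothGT X ∧ A.SmoothGT Y
    · obtain ⟨V, h1, h2⟩ := hG.exists_riesz (hσ.right X Y hXY.1 hXY.2)
        (hσ.smooth X Y · hXY.1 hXY.2)
      exact ⟨V, fun _ _ => ⟨h1, h2⟩⟩
    · exact ⟨0, fun hX hY => absurd ⟨hX, hY⟩ hXY⟩
  choose V hV using hex
  have hpair : ∀ X Y Z, A.SmoothGT X → A.SmoothGT Y → A.SmoothGT Z → ∀ u,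
      G u ((D₀.D X Y + V X Y) u) (Z u) = G u (D₀.D X Y u) (Z u) + σ X Y Z u := by
    intro X Y Z hX hY hZ u
    rw [Pi.add_apply, map_add, LinearMap.add_apply, (hV X Y hX hY).2 Z hZ]
  refine ⟨{ D := fun X Y => D₀.D X Y + V X Y
            smooth := fun X Y hX hY => (D₀.smooth X Y hX hY).add (hV X Y hX hY).1
            add_left := fun X X' Y hX hX' hY => ?_
            smul_left := fun f X Y hf hX hY => ?_
            add_right := fun X Y Y' hX hY hY' => ?_
            leibniz := fun f X Y hf hX hY => ?_
            horizontal := fun X Y hX hY hYh u => ?_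
            vertical := fun X Y hX hY hYv u => ?_ }, hpair⟩
  · have h1 : V (X + X') Y = V X Y + V X' Y := hG.section_ext fun Z hZ u => by
      rw [(hV _ _ (hX.add hX') hY).2 Z hZ, Pi.add_apply, map_add, LinearMap.add_apply,
        (hV X Y hX hY).2 Z hZ, (hV X' Y hX' hY).2 Z hZ, (hσ.left Y Z hY hZ u).add X X' hX hX']
    rw [h1, D₀.add_left X X' Y hX hX' hY]
    abel
  · have h1 : V (fun u => f u • X u) Y = fun u => f u • V X Y u := hG.section_ext fun Z hZ u => by
      rw [(hV _ _ (hX.smul hf) hY).2 Z hZ, map_smul, LinearMap.smul_apply, smul_eq_mul,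
        (hV X Y hX hY).2 Z hZ, (hσ.left Y Z hY hZ u).smul f X hf hX]
    rw [h1, D₀.smul_left f X Y hf hX hY]
    exact funext fun u => (smul_add _ _ _).symm
  · have h1 : V X (Y + Y') = V X Y + V X Y' := hG.section_ext fun Z hZ u => by
      rw [(hV _ _ hX (hY.add hY')).2 Z hZ, Pi.add_apply, map_add, LinearMap.add_apply,
        (hV X Y hX hY).2 Z hZ, (hV X Y' hX hY').2 Z hZ, (hσ.mid X Z hX hZ u).add Y Y' hY hY']
    rw [h1, D₀.add_right X Y Y' hX hY hY']
    abel
  · have h1 : V X (fun u => f u • Y u) = fun u => f u • V X Y u := hG.section_ext fun Z hZ u => by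
      rw [(hV _ _ hX (hY.smul hf)).2 Z hZ, map_smul, LinearMap.smul_apply, smul_eq_mul,
        (hV X Y hX hY).2 Z hZ, (hσ.mid X Z hX hZ u).smul f Y hf hY]
    rw [h1, D₀.leibniz f X Y hf hX hY]
    funext u
    have h2 : ∀ (V : Submodule ℝ (F (h u.proj) × TangentSpace ((𝓡 m).prod 𝓘(ℝ, FW)) u))
        (c : ℝ) (a b d : V), (c • a + b) + c • d = c • (a + d) + b := fun V c a b d => by
      rw [smul_add, add_right_comm]
    exact h2 _ _ _ _ _
  · refine hG.mem_hor fun Z hZ => ?_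
    obtain ⟨Z', hZ', rfl⟩ := C.exists_section_through Z
    have h1 : C.vProj.app Z' u = Z' u := C.split u _ hZ
    have h2 := C.vProj.smooth_app hZ'
    rw [← h1, hpair X Y _ hX hY h2, hhv X Y _ hX hY h2 hYh (C.vProj_mem Z'), add_zero]
    exact hG.mixed u _ (D₀.horizontal X Y hX hY hYh u) _ (C.vProj_mem Z' u)
  · refine hG.mem_vert fun Z hZ => ?_
    obtain ⟨Z', hZ', rfl⟩ := C.exists_section_through Z
    have h0 : C.Γ u (Z' u) = 0 := hZ
    have h1 : C.hProj.app Z' u = Z' u := by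
      change Z' u - C.Γ u (Z' u) = Z' u
      rw [h0, sub_zero]
    have h2 := C.hProj.smooth_app hZ'
    rw [← h1, hpair X Y _ hX hY h2, hvh X Y _ hX hY h2 hYv (C.hProj_mem Z'), add_zero]
    exact hG.mixed' (D₀.vertical X Y hX hY hYv u) (C.hProj_mem Z' u)

variable (G) in
/-- The tensor field that turns the given connection into the metric one: half of the covariant
derivative of the metric in the mixed directions, and the Koszul corrections along the horizontal
and the vertical subbundle. -/
def DLinearConnection.correction (D₀ : DLinearConnection C)
    (X Y Z : Π u : TotalSpace FW W, A.GT u) (u : TotalSpace FW W) : ℝ :=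
  1 / 2 * D₀.covTensor G (C.vProj.app X) (C.hProj.app Y) (C.hProj.app Z) u +
    1 / 2 * D₀.covTensor G (C.hProj.app X) (C.vProj.app Y) (C.vProj.app Z) u +
    C.horBundle.koszul G D₀ (C.hProj.app X) (C.hProj.app Y) (C.hProj.app Z) u +
    C.vertBundle.koszul G D₀ (C.vProj.app X) (C.vProj.app Y) (C.vProj.app Z) u

lemma DLinearConnection.isTensor3_correction (D₀ : DLinearConnection C)
    (hG : IsPseudoMetrical C G) : IsTensor3 A (D₀.correction G) := by
  have hQ := D₀.isTensor3_covTensor hG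
  exact ((((hQ.comp C.vProj C.hProj C.hProj).const_mul (1 / 2)).add
    ((hQ.comp C.hProj C.vProj C.vProj).const_mul (1 / 2))).add
    ((C.horBundle.isTensor3_koszul D₀ hG hG.nondegenerate_horBundle).comp _ _ _)).add
    ((C.vertBundle.isTensor3_koszul D₀ hG hG.nondegenerate_vertBundle).comp _ _ _)


end Metric
end

noncomputable section

/-! ### Values of the metric connection on lifts -/

section Values

variable {m : ℕ}
  {M : Type*} [TopologicalSpace M] [ChartedSpace (EuclideanSpace ℝ (Fin m)) M]
  [IsManifold (𝓡 m) ∞ M] [T2Space M]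
  {N : Type*} [TopologicalSpace N] [ChartedSpace (EuclideanSpace ℝ (Fin m)) N]
  [IsManifold (𝓡 m) ∞ N] [T2Space N]
  {FF : Type*} [NormedAddCommGroup FF] [NormedSpace ℝ FF] [FiniteDimensional ℝ FF]
  {F : N → Type*} [TopologicalSpace (TotalSpace FF F)]
  [∀ y, AddCommGroup (F y)] [∀ y, Module ℝ (F y)] [∀ y, TopologicalSpace (F y)]
  [FiberBundle FF F] [VectorBundle ℝ FF F] [ContMDiffVectorBundle ∞ FF F (𝓡 m)]
  {h : M ≃ₘ^∞⟮𝓡 m, 𝓡 m⟯ N} {η : N ≃ₘ^∞⟮𝓡 m, 𝓡 m⟯ M}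
variable {FW : Type*} [NormedAddCommGroup FW] [NormedSpace ℝ FW] [FiniteDimensional ℝ FW]
  {W : M → Type*} [TopologicalSpace (TotalSpace FW W)]
  [∀ x, AddCommGroup (W x)] [∀ x, Module ℝ (W x)] [∀ x, TopologicalSpace (W x)]
  [FiberBundle FW W] [VectorBundle ℝ FW W] [ContMDiffVectorBundle ∞ FW W (𝓡 m)]
  {A : GenLieAlgebroid FF F h η}
variable {C : RhoConnection FW W A} {G : ∀ u : TotalSpace FW W, LinearMap.BilinForm ℝ (A.GT u)}

section Zero

variable {σ : (Π u : TotalSpace FW W, A.GT u) → (Π u : TotalSpace FW W, A.GT u) →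
      (Π u : TotalSpace FW W, A.GT u) → TotalSpace FW W → ℝ}
  {X Y : Π u : TotalSpace FW W, A.GT u}

lemma IsTensor3.zero_left (hσ : IsTensor3 A σ) (hX : A.SmoothGT X) (hY : A.SmoothGT Y)
    (u : TotalSpace FW W) : σ 0 X Y u = 0 :=
  (hσ.left X Y hX hY u).zero

lemma IsTensor3.zero_mid (hσ : IsTensor3 A σ) (hX : A.SmoothGT X) (hY : A.SmoothGT Y)
    (u : TotalSpace FW W) : σ X 0 Y u = 0 :=
  (hσ.mid X Y hX hY u).zero

lemma IsTensor3.zero_right (hσ : IsTensor3 A σ) (hX : A.SmoothGT X) (hY : A.SmoothGT Y)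
    (u : TotalSpace FW W) : σ X Y 0 u = 0 :=
  (hσ.right X Y hX hY u).zero

end Zero

variable (D₀ : DLinearConnection C) {X Y Z : Π u : TotalSpace FW W, A.GT u}

lemma DLinearConnection.correction_hor_vert (hG : IsPseudoMetrical C G) (hX : A.SmoothGT X)
    (hY : A.SmoothGT Y) (hZ : A.SmoothGT Z) (hYh : ∀ u, Y u ∈ C.hor u)
    (hZv : ∀ u, Z u ∈ A.vert u) (u : TotalSpace FW W) : D₀.correction G X Y Z u = 0 := by
  have hQ := D₀.isTensor3_covTensor hG
  have hh := C.horBundle.isTensor3_koszul D₀ hG hG.nondegenerate_horBundle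
  have hv := C.vertBundle.isTensor3_koszul D₀ hG hG.nondegenerate_vertBundle
  have hXh := C.hProj.smooth_app hX
  have hXv := C.vProj.smooth_app hX
  rw [DLinearConnection.correction, C.hProj_of_hor hYh, C.hProj_of_vert hZv, C.vProj_of_hor hYh,
    C.vProj_of_vert hZv, hQ.zero_right hXv hY, hQ.zero_mid hXh hZ, hh.zero_right hXh hY,
    hv.zero_mid hXv hZ]
  ring

lemma DLinearConnection.correction_vert_hor (hG : IsPseudoMetrical C G) (hX : A.SmoothGT X)
    (hY : A.SmoothGT Y) (hZ : A.SmoothGT Z) (hYv : ∀ u, Y u ∈ A.vert u)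
    (hZh : ∀ u, Z u ∈ C.hor u) (u : TotalSpace FW W) : D₀.correction G X Y Z u = 0 := by
  have hQ := D₀.isTensor3_covTensor hG
  have hh := C.horBundle.isTensor3_koszul D₀ hG hG.nondegenerate_horBundle
  have hv := C.vertBundle.isTensor3_koszul D₀ hG hG.nondegenerate_vertBundle
  have hXh := C.hProj.smooth_app hX
  have hXv := C.vProj.smooth_app hX
  rw [DLinearConnection.correction, C.hProj_of_hor hZh, C.hProj_of_vert hYv, C.vProj_of_hor hZh,
    C.vProj_of_vert hYv, hQ.zero_mid hXv hZ, hQ.zero_right hXh hY, hh.zero_mid hXh hZ,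
    hv.zero_right hXv hY]
  ring

/-- On horizontal sections only the horizontal Koszul part of the correction survives. -/
lemma DLinearConnection.correction_hor_hor_hor (hG : IsPseudoMetrical C G) (hX : A.SmoothGT X)
    (hY : A.SmoothGT Y) (hZ : A.SmoothGT Z) (hXh : ∀ u, X u ∈ C.hor u) (hYh : ∀ u, Y u ∈ C.hor u)
    (hZh : ∀ u, Z u ∈ C.hor u) (u : TotalSpace FW W) :
    D₀.correction G X Y Z u = C.horBundle.koszul G D₀ X Y Z u := by
  have hQ := D₀.isTensor3_covTensor hG
  have hv := C.vertBundle.isTensor3_koszul D₀ hG hG.nondegenerate_vertBundle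
  rw [DLinearConnection.correction, C.hProj_of_hor hXh, C.hProj_of_hor hYh, C.hProj_of_hor hZh,
    C.vProj_of_hor hXh, C.vProj_of_hor hYh, C.vProj_of_hor hZh, hQ.zero_left hY hZ,
    hQ.zero_mid hX A.smoothGT_zero, hv.zero_left A.smoothGT_zero A.smoothGT_zero]
  ring

lemma DLinearConnection.correction_vert_vert_vert (hG : IsPseudoMetrical C G) (hX : A.SmoothGT X)
    (hY : A.SmoothGT Y) (hZ : A.SmoothGT Z) (hXv : ∀ u, X u ∈ A.vert u)
    (hYv : ∀ u, Y u ∈ A.vert u) (hZv : ∀ u, Z u ∈ A.vert u) (u : TotalSpace FW W) :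
    D₀.correction G X Y Z u = C.vertBundle.koszul G D₀ X Y Z u := by
  have hQ := D₀.isTensor3_covTensor hG
  have hh := C.horBundle.isTensor3_koszul D₀ hG hG.nondegenerate_horBundle
  rw [DLinearConnection.correction, C.hProj_of_vert hXv, C.hProj_of_vert hYv,
    C.hProj_of_vert hZv, C.vProj_of_vert hXv, C.vProj_of_vert hYv, C.vProj_of_vert hZv,
    hQ.zero_left hY hZ, hQ.zero_mid hX A.smoothGT_zero,
    hh.zero_left A.smoothGT_zero A.smoothGT_zero]
  ring

lemma DLinearConnection.correction_hor_vert_vert (hG : IsPseudoMetrical C G) (hX : A.SmoothGT X)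
    (hY : A.SmoothGT Y) (hZ : A.SmoothGT Z) (hXh : ∀ u, X u ∈ C.hor u)
    (hYv : ∀ u, Y u ∈ A.vert u) (hZv : ∀ u, Z u ∈ A.vert u) (u : TotalSpace FW W) :
    D₀.correction G X Y Z u = 1 / 2 * D₀.covTensor G X Y Z u := by
  have hQ := D₀.isTensor3_covTensor hG
  have hh := C.horBundle.isTensor3_koszul D₀ hG hG.nondegenerate_horBundle
  have hv := C.vertBundle.isTensor3_koszul D₀ hG hG.nondegenerate_vertBundle
  rw [DLinearConnection.correction, C.hProj_of_hor hXh, C.hProj_of_vert hYv,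
    C.hProj_of_vert hZv, C.vProj_of_hor hXh, C.vProj_of_vert hYv, C.vProj_of_vert hZv,
    hQ.zero_left A.smoothGT_zero A.smoothGT_zero, hh.zero_mid hX A.smoothGT_zero,
    hv.zero_left hY hZ]
  ring

lemma DLinearConnection.correction_vert_hor_hor (hG : IsPseudoMetrical C G) (hX : A.SmoothGT X)
    (hY : A.SmoothGT Y) (hZ : A.SmoothGT Z) (hXv : ∀ u, X u ∈ A.vert u)
    (hYh : ∀ u, Y u ∈ C.hor u) (hZh : ∀ u, Z u ∈ C.hor u) (u : TotalSpace FW W) :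
    D₀.correction G X Y Z u = 1 / 2 * D₀.covTensor G X Y Z u := by
  have hQ := D₀.isTensor3_covTensor hG
  have hh := C.horBundle.isTensor3_koszul D₀ hG hG.nondegenerate_horBundle
  have hv := C.vertBundle.isTensor3_koszul D₀ hG hG.nondegenerate_vertBundle
  rw [DLinearConnection.correction, C.hProj_of_vert hXv, C.hProj_of_hor hYh, C.hProj_of_hor hZh,
    C.vProj_of_vert hXv, C.vProj_of_hor hYh, C.vProj_of_hor hZh,
    hQ.zero_left A.smoothGT_zero A.smoothGT_zero, hh.zero_left hY hZ,
    hv.zero_mid hX A.smoothGT_zero]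
  ring

/-- The symmetrization of the correction is the covariant derivative of the metric. -/
lemma DLinearConnection.correction_add_correction (hG : IsPseudoMetrical C G)
    (hX : A.SmoothGT X) (hY : A.SmoothGT Y) (hZ : A.SmoothGT Z) (u : TotalSpace FW W) :
    D₀.correction G X Y Z u + D₀.correction G X Z Y u = D₀.covTensor G X Y Z u := by
  have hQ := D₀.isTensor3_covTensor hG
  have hXh := C.hProj.smooth_app hX
  have hXv := C.vProj.smooth_app hX
  have hYh := C.hProj.smooth_app hY
  have hYv := C.vProj.smooth_app hY
  have hZh := C.hProj.smooth_app hZ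
  have hZv := C.vProj.smooth_app hZ
  have e1 := (hQ.left Y Z hY hZ u).add _ _ hXh hXv
  have e2 : ∀ X', A.SmoothGT X' → D₀.covTensor G X' Y Z u =
      D₀.covTensor G X' (C.hProj.app Y) (C.hProj.app Z) u +
        D₀.covTensor G X' (C.vProj.app Y) (C.vProj.app Z) u := by
    intro X' hX'
    have f1 := (hQ.mid X' Z hX' hZ u).add _ _ hYh hYv
    have f2 := (hQ.right X' _ hX' hYh u).add _ _ hZh hZv
    have f3 := (hQ.right X' _ hX' hYv u).add _ _ hZh hZv
    have f4 := D₀.covTensor_mixed hG hX' hYh hZv (C.hProj_mem Y) (C.vProj_mem Z) u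
    have f5 := D₀.covTensor_mixed hG hX' hZh hYv (C.hProj_mem Z) (C.vProj_mem Y) u
    rw [D₀.covTensor_symm hG] at f5
    rw [C.hProj_add_vProj] at f1 f2 f3
    rw [f1, f2, f3, f4, f5]
    ring
  rw [C.hProj_add_vProj] at e1
  rw [e1, e2 _ hXh, e2 _ hXv]
  have k1 := C.horBundle.koszul_add_koszul D₀ hG (C.hProj.app X) (C.hProj.app Y)
    (C.hProj.app Z) u
  have k2 := C.vertBundle.koszul_add_koszul D₀ hG (C.vProj.app X) (C.vProj.app Y)
    (C.vProj.app Z) u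
  rw [DLinearConnection.correction, DLinearConnection.correction, ← k1, ← k2,
    D₀.covTensor_symm hG _ (C.hProj.app Z) (C.hProj.app Y),
    D₀.covTensor_symm hG _ (C.vProj.app Z) (C.vProj.app Y)]
  ring

/-- The given connection plus the correction is a metric connection. -/
lemma DLinearConnection.exists_metric (hG : IsPseudoMetrical C G) :
    ∃ D : DLinearConnection C, D.Parallel G ∧
      ∀ X Y Z, A.SmoothGT X → A.SmoothGT Y → A.SmoothGT Z → ∀ u,
        G u (D.D X Y u) (Z u) = G u (D₀.D X Y u) (Z u) + D₀.correction G X Y Z u := by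
  obtain ⟨D, hD⟩ := D₀.exists_add_tensor hG (D₀.isTensor3_correction hG)
    (fun X Y Z hX hY hZ hYh hZv => D₀.correction_hor_vert hG hX hY hZ hYh hZv)
    (fun X Y Z hX hY hZ hYv hZh => D₀.correction_vert_hor hG hX hY hZ hYv hZh)
  refine ⟨D, fun X Y Z hX hY hZ u => ?_, hD⟩
  have h1 := D₀.correction_add_correction hG hX hY hZ u
  rw [DLinearConnection.covTensor] at h1
  rw [DLinearConnection.covTensor, hG.symm u (Y u), hD X Y Z hX hY hZ, hD X Z Y hX hZ hY,
    hG.symm u _ (Y u)]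
  linarith

end Values
end

noncomputable section

/-! ### Components in adapted bases -/

section LocalComponents

variable {m : ℕ}
  {M : Type*} [TopologicalSpace M] [ChartedSpace (EuclideanSpace ℝ (Fin m)) M]
  [IsManifold (𝓡 m) ∞ M] [T2Space M]
  {N : Type*} [TopologicalSpace N] [ChartedSpace (EuclideanSpace ℝ (Fin m)) N]
  [IsManifold (𝓡 m) ∞ N] [T2Space N]
  {FF : Type*} [NormedAddCommGroup FF] [NormedSpace ℝ FF] [FiniteDimensional ℝ FF]
  {F : N → Type*} [TopologicalSpace (TotalSpace FF F)]
  [∀ y, AddCommGroup (F y)] [∀ y, Module ℝ (F y)] [∀ y, TopologicalSpace (F y)]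
  [FiberBundle FF F] [VectorBundle ℝ FF F] [ContMDiffVectorBundle ∞ FF F (𝓡 m)]
  {h : M ≃ₘ^∞⟮𝓡 m, 𝓡 m⟯ N} {η : N ≃ₘ^∞⟮𝓡 m, 𝓡 m⟯ M}
variable {FW : Type*} [NormedAddCommGroup FW] [NormedSpace ℝ FW] [FiniteDimensional ℝ FW]
  {W : M → Type*} [TopologicalSpace (TotalSpace FW W)]
  [∀ x, AddCommGroup (W x)] [∀ x, Module ℝ (W x)] [∀ x, TopologicalSpace (W x)]
  [FiberBundle FW W] [VectorBundle ℝ FW W] [ContMDiffVectorBundle ∞ FW W (𝓡 m)]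
  {A : GenLieAlgebroid FF F h η}
variable {C : RhoConnection FW W A} {G : ∀ u : TotalSpace FW W, LinearMap.BilinForm ℝ (A.GT u)}
variable {ι κ : Type*} [Fintype ι] [Fintype κ] [DecidableEq ι] [DecidableEq κ]
  {t : ι → Π y, F y} {e : κ → Π x, W x} {s : ι → Π y, F y} {c : κ → Π x, W x}

/-- Horizontal elements in terms of their pairings with the adapted base. -/
lemma IsPseudoMetrical.hor_repr (hG : IsPseudoMetrical C G) {u : TotalSpace FW W}
    (ht : LinearIndependent ℝ (t · (h u.proj)))
    (ht' : ⊤ ≤ Submodule.span ℝ (Set.range (t · (h u.proj)))) {v : A.GT u} (hv : v ∈ C.hor u) :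
    v = ∑ α, (∑ ε, (gHor C G t u)⁻¹ α ε * G u v (C.delta t ε u)) • C.delta t α u := by
  obtain ⟨h1, h2⟩ := C.delta_isBasis (z := (t · (h u.proj))) ht ht'
  exact (gram_repr (G u) (hG.symm u) (hG.nondegenerate_hor u) h1 h2).2 v hv

/-- Vertical elements in terms of their pairings with the adapted base. -/
lemma IsPseudoMetrical.vert_repr (hG : IsPseudoMetrical C G) {u : TotalSpace FW W}
    (he : LinearIndependent ℝ (e · u.proj))
    (he' : ⊤ ≤ Submodule.span ℝ (Set.range (e · u.proj))) {v : A.GT u} (hv : v ∈ A.vert u) :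
    v = ∑ a, (∑ d, (gVert G e u)⁻¹ a d * G u v (A.dotFrame e d u)) • A.dotFrame e a u := by
  obtain ⟨h1, h2⟩ := A.dot_isBasis (z := (e · u.proj)) he he'
  exact (gram_repr (G u) (hG.symm u) (hG.nondegenerate_vert u) h1 h2).2 v hv

lemma RhoConnection.sec_eq_delta {u : TotalSpace FW W}
    (hs : ∀ᶠ y in 𝓝 (h u.proj), ∀ i, s i y = t i y) :
    ∀ᶠ v in 𝓝 u, ∀ i, C.horBundle.sec (s i) v = C.delta t i v := by
  have hq : Tendsto (fun v : TotalSpace FW W => h v.proj) (𝓝 u) (𝓝 (h u.proj)) :=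
    (h.continuous.comp (FiberBundle.continuous_proj FW W)).tendsto u
  filter_upwards [hq.eventually hs] with v hv i
  exact congrArg (C.lift v) (hv i)

lemma RhoConnection.sec_eq_dotFrame {u : TotalSpace FW W}
    (hc : ∀ᶠ x in 𝓝 u.proj, ∀ i, c i x = e i x) :
    ∀ᶠ v in 𝓝 u, ∀ i, C.vertBundle.sec (c i) v = A.dotFrame e i v := by
  have hq : Tendsto (fun v : TotalSpace FW W => v.proj) (𝓝 u) (𝓝 u.proj) :=
    (FiberBundle.continuous_proj FW W).tendsto u
  filter_upwards [hq.eventually hc] with v hv i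
  exact congrArg (A.dot v) (hv i)

lemma RhoConnection.act_gHor (X : Π u : TotalSpace FW W, A.GT u) {u : TotalSpace FW W}
    (hs : ∀ᶠ v in 𝓝 u, ∀ i, C.horBundle.sec (s i) v = C.delta t i v) (α β : ι) :
    A.act u (X u) (fun v => G v (C.horBundle.sec (s α) v) (C.horBundle.sec (s β) v)) =
      A.act u (X u) (fun v => gHor C G t v α β) :=
  A.act_congr (X u) (hs.mono fun v hv => by rw [hv, hv]; rfl)

lemma RhoConnection.act_gVert (X : Π u : TotalSpace FW W, A.GT u) {u : TotalSpace FW W}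
    (hc : ∀ᶠ v in 𝓝 u, ∀ i, C.vertBundle.sec (c i) v = A.dotFrame e i v) (a b : κ) :
    A.act u (X u) (fun v => G v (C.vertBundle.sec (c a) v) (C.vertBundle.sec (c b) v)) =
      A.act u (X u) (fun v => gVert G e v a b) :=
  A.act_congr (X u) (hc.mono fun v hv => by rw [hv, hv]; rfl)

variable (D₀ D : DLinearConnection C)

set_option maxHeartbeats 1000000 in
/-- The Koszul formula in the base `δ̃_α`. -/
lemma DLinearConnection.pairing_horizontal (hG : IsPseudoMetrical C G)
    (hD : ∀ X Y Z, A.SmoothGT X → A.SmoothGT Y → A.SmoothGT Z → ∀ u,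
        G u (D.D X Y u) (Z u) = G u (D₀.D X Y u) (Z u) + D₀.correction G X Y Z u)
    (hsm : ∀ i, IsSmoothSec m FF (s i)) {u : TotalSpace FW W}
    (hs : ∀ᶠ v in 𝓝 u, ∀ i, C.horBundle.sec (s i) v = C.delta t i v)
    {L : ι → ι → ι → N → ℝ}
    (hL : ∀ α β, A.bracket (s α) (s β) (h u.proj) = ∑ γ, L γ α β (h u.proj) • t γ (h u.proj))
    (β γ ε : ι) :
    G u (D.D (C.horBundle.sec (s γ)) (C.horBundle.sec (s β)) u) (C.delta t ε u) =
    1 / 2 * (A.act u (C.delta t γ u) (fun v => gHor C G t v ε β)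
      + A.act u (C.delta t β u) (fun v => gHor C G t v ε γ)
      - A.act u (C.delta t ε u) (fun v => gHor C G t v β γ)
      + ∑ θ, gHor C G t u θ ε * L θ γ β (h u.proj)
      - ∑ θ, gHor C G t u β θ * L θ γ ε (h u.proj)
      - ∑ θ, gHor C G t u θ γ * L θ β ε (h u.proj)) := by
  have hsec := fun i => C.horBundle.smooth_sec (hsm i)
  have hu := hs.self_of_nhds
  have hbr : ∀ α β ε, G u (C.horBundle.bracket (s α) (s β) u) (C.delta t ε u) =
      ∑ θ, gHor C G t u θ ε * L θ α β (h u.proj) := by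
    intro α β ε
    have h1 : C.horBundle.bracket (s α) (s β) u =
        ∑ θ, L θ α β (h u.proj) • C.delta t θ u := by
      refine (congrArg (C.liftₗ u) (hL α β)).trans ?_
      rw [map_sum]
      exact Finset.sum_congr rfl fun θ _ => map_smul (C.liftₗ u) _ _
    rw [h1, map_sum, LinearMap.sum_apply]
    refine Finset.sum_congr rfl fun θ _ => ?_
    rw [map_smul, LinearMap.smul_apply, smul_eq_mul, mul_comm]
    rfl
  have h1 := hD _ _ _ (hsec γ) (hsec β) (hsec ε) u
  rw [D₀.correction_hor_hor_hor hG (hsec γ) (hsec β) (hsec ε) (C.sec_mem_hor _)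
    (C.sec_mem_hor _) (C.sec_mem_hor _), C.horBundle.koszul_sec D₀ hG (hsm γ) (hsm β) (hsm ε),
    C.act_gHor _ hs, C.act_gHor _ hs, C.act_gHor _ hs, hu ε, hu β, hu γ, hbr, hbr, hbr] at h1
  rw [h1]
  have h2 : ∀ θ, gHor C G t u θ β = gHor C G t u β θ := fun θ => hG.symm u _ _
  simp only [h2]

set_option maxHeartbeats 1000000 in
/-- The Koszul formula in the base `∂̇^a`, whose brackets vanish. -/
lemma DLinearConnection.pairing_vertical (hG : IsPseudoMetrical C G)
    (hD : ∀ X Y Z, A.SmoothGT X → A.SmoothGT Y → A.SmoothGT Z → ∀ u,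
        G u (D.D X Y u) (Z u) = G u (D₀.D X Y u) (Z u) + D₀.correction G X Y Z u)
    (hsm : ∀ i, IsSmoothSec m FW (c i)) {u : TotalSpace FW W}
    (hc : ∀ᶠ v in 𝓝 u, ∀ i, C.vertBundle.sec (c i) v = A.dotFrame e i v) (a b d : κ) :
    G u (D.D (C.vertBundle.sec (c a)) (C.vertBundle.sec (c b)) u) (A.dotFrame e d u) =
    1 / 2 * (A.act u (A.dotFrame e a u) (fun v => gVert G e v d b)
      + A.act u (A.dotFrame e b u) (fun v => gVert G e v d a)
      - A.act u (A.dotFrame e d u) (fun v => gVert G e v b a)) := by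
  have hsec := fun i => C.vertBundle.smooth_sec (hsm i)
  have hu := hc.self_of_nhds
  have hbr : ∀ a b, C.vertBundle.bracket (c a) (c b) u = 0 := fun _ _ => rfl
  have h1 := hD _ _ _ (hsec a) (hsec b) (hsec d) u
  rw [D₀.correction_vert_vert_vert hG (hsec a) (hsec b) (hsec d) (C.sec_mem_vert _)
    (C.sec_mem_vert _) (C.sec_mem_vert _), C.vertBundle.koszul_sec D₀ hG (hsm a) (hsm b) (hsm d),
    C.act_gVert _ hc, C.act_gVert _ hc, C.act_gVert _ hc, hu d, hu b, hu a, hbr, hbr, hbr,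
    map_zero, LinearMap.zero_apply, LinearMap.zero_apply, LinearMap.zero_apply] at h1
  rw [h1]
  ring

lemma DLinearConnection.pairing_hor_vert (hG : IsPseudoMetrical C G)
    (hD : ∀ X Y Z, A.SmoothGT X → A.SmoothGT Y → A.SmoothGT Z → ∀ u,
        G u (D.D X Y u) (Z u) = G u (D₀.D X Y u) (Z u) + D₀.correction G X Y Z u)
    (hsm : ∀ i, IsSmoothSec m FF (s i)) (hcm : ∀ i, IsSmoothSec m FW (c i))
    {u : TotalSpace FW W}
    (hs : ∀ᶠ v in 𝓝 u, ∀ i, C.horBundle.sec (s i) v = C.delta t i v)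
    (hc : ∀ᶠ v in 𝓝 u, ∀ i, C.vertBundle.sec (c i) v = A.dotFrame e i v)
    {K : DComponents (TotalSpace FW W) ι κ}
    (hK : ∀ a γ, D₀.D (C.horBundle.sec (s γ)) (C.vertBundle.sec (c a)) u =
      ∑ b, K.HV a b γ u • A.dotFrame e b u) (a d : κ) (γ : ι) :
    G u (D.D (C.horBundle.sec (s γ)) (C.vertBundle.sec (c a)) u -
      D₀.D (C.horBundle.sec (s γ)) (C.vertBundle.sec (c a)) u) (A.dotFrame e d u) =
      1 / 2 * gVertH C G t e K d a γ u := by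
  have hsec := fun i => C.horBundle.smooth_sec (hsm i)
  have hcec := fun i => C.vertBundle.smooth_sec (hcm i)
  have h1 := hD _ _ _ (hsec γ) (hcec a) (hcec d) u
  rw [D₀.correction_hor_vert_vert hG (hsec γ) (hcec a) (hcec d) (C.sec_mem_hor _)
    (C.sec_mem_vert _) (C.sec_mem_vert _), D₀.covTensor_symm hG, DLinearConnection.covTensor,
    C.act_gVert _ hc, hc.self_of_nhds d, hc.self_of_nhds a, hs.self_of_nhds γ] at h1
  rw [map_sub, LinearMap.sub_apply, h1, add_sub_cancel_left, hK, hK, gVertH]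
  simp only [map_sum, map_smul, LinearMap.sum_apply, LinearMap.smul_apply, smul_eq_mul]
  rfl

lemma DLinearConnection.pairing_vert_hor (hG : IsPseudoMetrical C G)
    (hD : ∀ X Y Z, A.SmoothGT X → A.SmoothGT Y → A.SmoothGT Z → ∀ u,
        G u (D.D X Y u) (Z u) = G u (D₀.D X Y u) (Z u) + D₀.correction G X Y Z u)
    (hsm : ∀ i, IsSmoothSec m FF (s i)) (hcm : ∀ i, IsSmoothSec m FW (c i))
    {u : TotalSpace FW W}
    (hs : ∀ᶠ v in 𝓝 u, ∀ i, C.horBundle.sec (s i) v = C.delta t i v)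
    (hc : ∀ᶠ v in 𝓝 u, ∀ i, C.vertBundle.sec (c i) v = A.dotFrame e i v)
    {K : DComponents (TotalSpace FW W) ι κ}
    (hK : ∀ β d, D₀.D (C.vertBundle.sec (c d)) (C.horBundle.sec (s β)) u =
      ∑ α, K.VH α β d u • C.delta t α u) (β ε : ι) (d : κ) :
    G u (D.D (C.vertBundle.sec (c d)) (C.horBundle.sec (s β)) u -
      D₀.D (C.vertBundle.sec (c d)) (C.horBundle.sec (s β)) u) (C.delta t ε u) =
      1 / 2 * gHorV C G t e K ε β d u := by
  have hsec := fun i => C.horBundle.smooth_sec (hsm i)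
  have hcec := fun i => C.vertBundle.smooth_sec (hcm i)
  have h1 := hD _ _ _ (hcec d) (hsec β) (hsec ε) u
  rw [D₀.correction_vert_hor_hor hG (hcec d) (hsec β) (hsec ε) (C.sec_mem_vert _)
    (C.sec_mem_hor _) (C.sec_mem_hor _), D₀.covTensor_symm hG, DLinearConnection.covTensor,
    C.act_gHor _ hs, hs.self_of_nhds ε, hs.self_of_nhds β, hc.self_of_nhds d] at h1
  rw [map_sub, LinearMap.sub_apply, h1, add_sub_cancel_left, hK, hK, gHorV]
  simp only [map_sum, map_smul, LinearMap.sum_apply, LinearMap.smul_apply, smul_eq_mul]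
  rfl

/-- The local components of the metric connection: the pairings of its values on adapted bases are
converted to components by the inverse matrices of the metric. -/
lemma DLinearConnection.hasComponents_metric (hG : IsPseudoMetrical C G)
    (hD : ∀ X Y Z, A.SmoothGT X → A.SmoothGT Y → A.SmoothGT Z → ∀ u,
        G u (D.D X Y u) (Z u) = G u (D₀.D X Y u) (Z u) + D₀.correction G X Y Z u)
    {U : Set M} (hU : IsOpen U) (ht : IsLocalFrameOn (𝓡 m) FF ∞ t (h '' U))
    (he : IsLocalFrameOn (𝓡 m) FW ∞ e U) {L : ι → ι → ι → N → ℝ}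
    (hL : A.IsStructureFunctions t (h '' U) L) {K : DComponents (TotalSpace FW W) ι κ}
    (hK : D₀.HasComponents t e U K) :
    D.HasComponents t e U (metricComponents C G t e L K) := by
  -- Near a given point, the local frames are replaced by frames of globally smooth sections.
  have key : ∀ u : TotalSpace FW W, u.proj ∈ U →
      ∃ (s : ι → Π y, F y) (c : κ → Π x, W x), (∀ i, IsSmoothSec m FF (s i)) ∧
        (∀ i, IsSmoothSec m FW (c i)) ∧
        (∀ᶠ v in 𝓝 u, ∀ i, C.horBundle.sec (s i) v = C.delta t i v) ∧
        (∀ᶠ v in 𝓝 u, ∀ i, C.vertBundle.sec (c i) v = A.dotFrame e i v) ∧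
        ∀ α β, A.bracket (s α) (s β) (h u.proj) =
          ∑ γ, L γ α β (h u.proj) • t γ (h u.proj) := by
    intro u hu
    have hhU : h '' U ∈ 𝓝 (h u.proj) :=
      (h.toHomeomorph.isOpenMap U hU).mem_nhds ⟨_, hu, rfl⟩
    obtain ⟨s, hs, hst⟩ := exists_smooth_section_germ (𝓡 m) hhU ht.contMDiffOn
    obtain ⟨c, hc, hce⟩ := exists_smooth_section_germ (𝓡 m) (hU.mem_nhds hu) he.contMDiffOn
    exact ⟨s, c, hs, hc, C.sec_eq_delta hst, C.sec_eq_dotFrame hce, fun α β =>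
      hL _ ⟨_, hu, rfl⟩ α β _ _ (hs α) (hs β) (hst.mono fun y hy => hy α)
        (hst.mono fun y hy => hy β)⟩
  refine ⟨fun u hu β γ X Y hX hY hXg hYg => ?_, fun u hu a γ X Y hX hY hXg hYg => ?_,
    fun u hu β d X Y hX hY hXg hYg => ?_, fun u hu b d X Y hX hY hXg hYg => ?_⟩ <;>
    obtain ⟨s, c, hsm, hcm, hs, hc, hbr⟩ := key u hu <;>
    have hsec := fun i => C.horBundle.smooth_sec (hsm i) <;>
    have hcec := fun i => C.vertBundle.smooth_sec (hcm i) <;>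
    have hsg := fun i => hs.mono fun v hv => hv i <;>
    have hcg := fun i => hc.mono fun v hv => hv i <;>
    have hut : h u.proj ∈ h '' U := ⟨_, hu, rfl⟩
  · rw [D.congr_of_eventually hX (hsec γ) hY (hsec β)
      (by filter_upwards [hXg, hs] with v h1 h2 using h1.trans (h2 γ).symm)
      (by filter_upwards [hYg, hs] with v h1 h2 using h1.trans (h2 β).symm)]
    refine (hG.hor_repr (ht.linearIndependent hut) (ht.generating hut)
      (D.horizontal _ _ (hsec γ) (hsec β) (C.sec_mem_hor _) u)).trans ?_
    refine Finset.sum_congr rfl fun α _ => congrArg (· • C.delta t α u) ?_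
    change _ = 1 / 2 * ∑ ε, _
    rw [Finset.mul_sum]
    refine Finset.sum_congr rfl fun ε _ => ?_
    rw [D₀.pairing_horizontal D hG hD hsm hs hbr, mul_left_comm]
  · rw [D.congr_of_eventually hX (hsec γ) hY (hcec a)
      (by filter_upwards [hXg, hs] with v h1 h2 using h1.trans (h2 γ).symm)
      (by filter_upwards [hYg, hc] with v h1 h2 using h1.trans (h2 a).symm)]
    have hK' := fun a γ => hK.hv u hu a γ _ _ (hsec γ) (hcec a) (hsg γ) (hcg a)
    have h1 := hG.vert_repr (he.linearIndependent hu) (he.generating hu)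
      (sub_mem (D.vertical _ _ (hsec γ) (hcec a) (C.sec_mem_vert _) u)
        (D₀.vertical _ _ (hsec γ) (hcec a) (C.sec_mem_vert _) u))
    rw [sub_eq_iff_eq_add', hK'] at h1
    rw [h1, ← Finset.sum_add_distrib]
    refine Finset.sum_congr rfl fun b _ => ?_
    rw [← add_smul]
    refine congrArg (· • A.dotFrame e b u) (congrArg (K.HV a b γ u + ·) ?_)
    rw [Finset.mul_sum]
    refine Finset.sum_congr rfl fun d _ => ?_
    rw [← hK', D₀.pairing_hor_vert D hG hD hsm hcm hs hc hK', mul_left_comm]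
  · rw [D.congr_of_eventually hX (hcec d) hY (hsec β)
      (by filter_upwards [hXg, hc] with v h1 h2 using h1.trans (h2 d).symm)
      (by filter_upwards [hYg, hs] with v h1 h2 using h1.trans (h2 β).symm)]
    have hK' := fun β d => hK.vh u hu β d _ _ (hcec d) (hsec β) (hcg d) (hsg β)
    have h1 := hG.hor_repr (ht.linearIndependent hut) (ht.generating hut)
      (sub_mem (D.horizontal _ _ (hcec d) (hsec β) (C.sec_mem_hor _) u)
        (D₀.horizontal _ _ (hcec d) (hsec β) (C.sec_mem_hor _) u))
    rw [sub_eq_iff_eq_add', hK'] at h1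
    rw [h1, ← Finset.sum_add_distrib]
    refine Finset.sum_congr rfl fun α _ => ?_
    rw [← add_smul]
    refine congrArg (· • C.delta t α u) (congrArg (K.VH α β d u + ·) ?_)
    rw [Finset.mul_sum]
    refine Finset.sum_congr rfl fun ε _ => ?_
    rw [← hK', D₀.pairing_vert_hor D hG hD hsm hcm hs hc hK', mul_left_comm]
  · rw [D.congr_of_eventually hX (hcec d) hY (hcec b)
      (by filter_upwards [hXg, hc] with v h1 h2 using h1.trans (h2 d).symm)
      (by filter_upwards [hYg, hc] with v h1 h2 using h1.trans (h2 b).symm)]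
    refine (hG.vert_repr (he.linearIndependent hu) (he.generating hu)
      (D.vertical _ _ (hcec d) (hcec b) (C.sec_mem_vert _) u)).trans ?_
    refine Finset.sum_congr rfl fun a _ => congrArg (· • A.dotFrame e a u) ?_
    change _ = 1 / 2 * ∑ d', _
    rw [Finset.mul_sum]
    refine Finset.sum_congr rfl fun d' _ => ?_
    rw [D₀.pairing_vertical D hG hD hcm hc, mul_left_comm]

end LocalComponents
end

/-- Given any distinguished linear `(ρ,η)`-connection `D₀` and any pseudometrical structure `G`,
the local functions `metricComponents` are, in all local frames, the components of one distinguished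
linear `(ρ,η)`-connection `D` with `D_X G = 0` for all `X`; hence the generalized tangent bundle of
the dual bundle of `E` is `(ρ,η)`-(pseudo)metrizable. -/
theorem theorem5p1 {m p r : ℕ}
    {M : Type*} [TopologicalSpace M] [T2Space M] [SecondCountableTopology M]
    [ChartedSpace (EuclideanSpace ℝ (Fin m)) M] [IsManifold (𝓡 m) ∞ M]
    {N : Type*} [TopologicalSpace N] [T2Space N] [SecondCountableTopology N]
    [ChartedSpace (EuclideanSpace ℝ (Fin m)) N] [IsManifold (𝓡 m) ∞ N]
    {F : N → Type*} [TopologicalSpace (TotalSpace (EuclideanSpace ℝ (Fin p)) F)]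
    [∀ y, AddCommGroup (F y)] [∀ y, Module ℝ (F y)] [∀ y, TopologicalSpace (F y)]
    [FiberBundle (EuclideanSpace ℝ (Fin p)) F] [VectorBundle ℝ (EuclideanSpace ℝ (Fin p)) F]
    [ContMDiffVectorBundle ∞ (EuclideanSpace ℝ (Fin p)) F (𝓡 m)]
    {E : M → Type*} [TopologicalSpace (TotalSpace (EuclideanSpace ℝ (Fin r)) E)]
    [∀ x, AddCommGroup (E x)] [∀ x, Module ℝ (E x)] [∀ x, TopologicalSpace (E x)]
    [∀ x, IsTopologicalAddGroup (E x)] [∀ x, ContinuousSMul ℝ (E x)]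
    [FiberBundle (EuclideanSpace ℝ (Fin r)) E] [VectorBundle ℝ (EuclideanSpace ℝ (Fin r)) E]
    [ContMDiffVectorBundle ∞ (EuclideanSpace ℝ (Fin r)) E (𝓡 m)]
    {h : M ≃ₘ^∞⟮𝓡 m, 𝓡 m⟯ N} {η : N ≃ₘ^∞⟮𝓡 m, 𝓡 m⟯ M}
    (A : GenLieAlgebroid (EuclideanSpace ℝ (Fin p)) F h η)
    (C : RhoConnection (EuclideanSpace ℝ (Fin r) →L[ℝ] ℝ) (DualFiber E) A)
    (D₀ : DLinearConnection C)
    (G : ∀ u : TotalSpace (EuclideanSpace ℝ (Fin r) →L[ℝ] ℝ) (DualFiber E),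
      LinearMap.BilinForm ℝ (A.GT u))
    (hG : IsPseudoMetrical C G) :
    (∃ D : DLinearConnection C,
      (∀ (U : Set M) (t : Fin p → Π y, F y) (e : Fin r → Π x, DualFiber E x)
          (L : Fin p → Fin p → Fin p → N → ℝ)
          (K : DComponents (TotalSpace (EuclideanSpace ℝ (Fin r) →L[ℝ] ℝ) (DualFiber E))
            (Fin p) (Fin r)),
        IsOpen U →
        IsLocalFrameOn (𝓡 m) (EuclideanSpace ℝ (Fin p)) ∞ t (h '' U) →
        IsLocalFrameOn (𝓡 m) (EuclideanSpace ℝ (Fin r) →L[ℝ] ℝ) ∞ e U →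
        A.IsStructureFunctions t (h '' U) L →
        D₀.HasComponents t e U K →
        D.HasComponents t e U (metricComponents C G t e L K)) ∧
      D.Parallel G) ∧
    C.PseudoMetrizable ∧ (IsMetrical C G → C.Metrizable) := by
  classical
  obtain ⟨D, hpar, hD⟩ := D₀.exists_metric hG
  exact ⟨⟨D, fun U t e L K hU ht he hL hK => D₀.hasComponents_metric D hG hD hU ht he hL hK, hpar⟩,
    ⟨G, D, hG, hpar⟩, fun hM => ⟨G, D, hM, hpar⟩⟩
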